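/- **Conventions.** All powers and logarithms use the branch $-\pi<\arg\le\pi$. Write $\mathbb H=\{\operatorname{Im} z>0\}$, $j_M(z)=cz+d$ for a matrix $M$ with bottom row $(c,d)$, and $f^{M}(z)=(\det M)^{r/2}f(Mz)\,j_M(z)^{-r}$. Let $r>0$ be real, let $\Gamma$ be a subgroup of finite index of $\mathrm{SL}_2(\mathbb Z)$, and let $f\neq 0$ be a modular form of weight $r$ for $\Gamma$ with multipliers $\mu_\gamma$. That is, $f$ is analytic on $\mathbb H$, $f(\gamma z)=\mu_\gamma\, j_\gamma(z)^r f(z)$ with $|\mu_\gamma|=1$ for every $\gamma\in\Gamma$, and $f$ has at most polynomial growth as $\operatorname{Im} z\to0^+$ (uniformly in $\operatorname{Re} z$). For a cusp $\mathfrak a\in\mathbb Q\cup\{\infty\}$ let $m_{\mathfrak a}$ be its width, i.e. the index of the stabilizer of $\mathfrak a$ in $\Gamma$ inside the stabilizer of $\mathfrak a$ in $\mathrm{SL}_2(\mathbb Z)$, both taken modulo $\pm1$. A scaling matrix for $\mathfrak a$ is $\sigma_{\mathfrak a}=\gamma\begin{pmatrix}\sqrt{m_{\mathfrak a}}&0\\0&1/\sqrt{m_{\mathfrak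 a}}\end{pmatrix}$, where $\gamma\in \mathrm{SL}_2(\mathbb Z)$ satisfies $\gamma(\infty)=\mathfrak a$ and has bottom row $(c,d)$ with $c<0$, or $c=0$ and $d=1$. Then $$f^{\sigma_{\mathfrak a}}(z)=\sum_{n\ge0}a_n^{\mathfrak a}e^{2\pi i(n+\kappa_{\mathfrak a})z},\qquad 0\le\kappa_{\mathfrak a}<1 .$$ Assume $\kappa_{\mathfrak a}\in\mathbb Q$ for every cusp. Put $f(\mathfrak a)=a_0^{\mathfrak a}$ if $\kappa_{\mathfrak a}=0$ and $f(\mathfrak a)=0$ otherwise (this depends on the choice of $\sigma_{\mathfrak a}$). Call $f$ a cusp form if $f(\mathfrak a)=0$ at every cusp. Let $\alpha_0=r/2$ if $f$ is a cusp form and $\alpha_0=r$ otherwise, and let $\alpha>\alpha_0$. With $m=m_\infty$, $\kappa=\kappa_\infty$ and $f(mz)=\sum_{n\ge0}a_ne^{2\pi i(n+\kappa)z}$, and with $\sigma=\sigma_{\mathfrak a}$ a scaling matrix, define $$f_\alpha(mx)=\sum_{n+\kappa>0}\frac{a_n}{(n+\kappa)^\alpha}e^{2\pi i(n+\kappa)x},\qquad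 f_\alpha^{\sigma}(x)=\sum_{n+\kappa_{\mathfrak a}>0}\frac{a_n^{\mathfrak a}}{(n+\kappa_{\mathfrak a})^\alpha}e^{2\pi i(n+\kappa_{\mathfrak a})x}.$$ **Theorem (Approximate functional equation).** Let $x_0\in\mathbb Q$ and let $\sigma=\sigma_{x_0}$ be any scaling matrix for the cusp $x_0$, with $f(x_0)$ computed from it. Then the series defining $f_\alpha$ and $f_\alpha^\sigma$ converge at every real point, and there exist real constants $A\ne0$ and $B>0$ and a function $E:\mathbb R\to\mathbb C$ such that for all real $x\neq x_0$ $$f_\alpha(x)=A\,i^{-\alpha}f(x_0)\,\psi(x-x_0)+B\,|x-x_0|^{2\alpha}(x-x_0)^{-r}f_\alpha^{\sigma}(\sigma^{-1}x)+E(x),$$ while $E(x_0)=f_\alpha(x_0)$. Here $$\psi(x)=\begin{cases}x^{\alpha-r}&\alpha-r\notin\mathbb Z,\\ x^{\alpha-r}\log x&\alpha-r\in\mathbb Z.\end{cases}$$ The function $E$ lies in $\mathcal C^{1,0}(\mathbb R\setminus\{x_0\})$, i.e. it is continuously differentiable on $\mathbb R\setminus\{x_0\}$. It also lies in $\mathcal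 C^{2\alpha-r+1}(x_0)$, i.e. $E$ is continuous on $\mathbb R$ and there is a polynomial $P$ of degree less than $2\alpha-r+1$ with $E(x)-P(x-x_0)=O(|x-x_0|^{2\alpha-r+1})$ as $x\to x_0$. -/

import Mathlib

open Filter Topology Matrix

noncomputable section

namespace FracModular

/-! ### Regularity spaces of functions on the real line -/

/-- `g ∈ Λ^s(K)`: `g` is continuous on `K` and satisfies a uniform `s`-Hölder condition on `K`
(for `s = 0` the second condition just says that the oscillation of `g` on `K` is finite). -/
def MemLambdaOn (s : ℝ) (K : Set ℝ) (g : ℝ → ℂ) : Prop :=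
  ContinuousOn g K ∧ ∃ C : ℝ, ∀ x ∈ K, ∀ y ∈ K, ‖g x - g y‖ ≤ C * |x - y| ^ s

/-- `g ∈ C^{k,s}(Ω)`, for an open set `Ω`: `g` is continuous on `Ω`, its `k`-th derivative exists
in `Ω`, and that derivative lies in `Λ^s(K)` for every compact subset `K` of `Ω`. -/
def MemCkHolder (k : ℕ) (s : ℝ) (Ω : Set ℝ) (g : ℝ → ℂ) : Prop :=
  ContinuousOn g Ω ∧
  (∀ j < k, ∀ x ∈ Ω, DifferentiableAt ℝ (iteratedDeriv j g) x) ∧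
  ∀ K ⊆ Ω, IsCompact K → MemLambdaOn s K (iteratedDeriv k g)

/-- `g ∈ C^s(x₀)`: `g` is continuous and there is a polynomial `P` of degree less than `s` with
`g x - P (x - x₀) = O(|x - x₀|^s)` as `x → x₀`. -/
def MemPointwiseHolder (s : ℝ) (x₀ : ℝ) (g : ℝ → ℂ) : Prop :=
  Continuous g ∧ ∃ P : Polynomial ℂ, (∀ n ∈ P.support, (n : ℝ) < s) ∧
    (fun x : ℝ => g x - P.eval ((x - x₀ : ℝ) : ℂ)) =O[𝓝 x₀] fun x : ℝ => |x - x₀| ^ s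

/-! ### Möbius transformations and the slash operator -/

/-- The automorphy factor `j_M(z) = c z + d`. -/
def autFactor (M : Matrix (Fin 2) (Fin 2) ℝ) (z : ℂ) : ℂ := (M 1 0 : ℂ) * z + (M 1 1 : ℂ)

/-- The Möbius transformation `M z = (a z + b) / (c z + d)` on complex numbers. -/
def moebius (M : Matrix (Fin 2) (Fin 2) ℝ) (z : ℂ) : ℂ :=
  ((M 0 0 : ℂ) * z + (M 0 1 : ℂ)) / autFactor M z

/-- The Möbius transformation `M x = (a x + b) / (c x + d)` on real numbers (away from its pole). -/
def realMoebius (M : Matrix (Fin 2) (Fin 2) ℝ) (x : ℝ) : ℝ :=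
  (M 0 0 * x + M 0 1) / (M 1 0 * x + M 1 1)

/-- The slash operator `f^M(z) = det(M)^{r/2} f(M z) / j_M(z)^r` of real weight `r`, with the
principal branch of the power. -/
def slash (r : ℝ) (M : Matrix (Fin 2) (Fin 2) ℝ) (f : ℂ → ℂ) (z : ℂ) : ℂ :=
  ((M.det ^ (r / 2) : ℝ) : ℂ) * f (moebius M z) / autFactor M z ^ (r : ℂ)

/-- An element of `SL₂(ℤ)` as a real matrix. -/
def realMat (γ : SpecialLinearGroup (Fin 2) ℤ) : Matrix (Fin 2) (Fin 2) ℝ :=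
  (γ : Matrix (Fin 2) (Fin 2) ℤ).map (fun n : ℤ => (n : ℝ))

/-! ### Modular forms of real weight with a multiplier system -/

/-- `f` (only its values on the upper half-plane matter) is a modular form of real weight `r` for
`Γ ≤ SL₂(ℤ)` with multipliers `μ γ`. -/
structure IsModularForm (r : ℝ) (Γ : Subgroup (SpecialLinearGroup (Fin 2) ℤ)) (μ : Γ → ℂ)
    (f : ℂ → ℂ) : Prop where
  analytic : DifferentiableOn ℂ f {z : ℂ | 0 < z.im}
  norm_multiplier : ∀ γ : Γ, ‖μ γ‖ = 1
  transform : ∀ γ : Γ, ∀ z : ℂ, 0 < z.im →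
    f (moebius (realMat γ) z) = μ γ * autFactor (realMat γ) z ^ (r : ℂ) * f z
  /-- At most polynomial growth as `Im z → 0⁺`. -/
  growth : ∃ C K δ : ℝ, 0 < δ ∧ ∀ z : ℂ, 0 < z.im → z.im < δ → ‖f z‖ ≤ C * z.im ^ (-K)

/-! ### Cusps, scaling matrices and Fourier expansions -/

/-- The stabilizer in `SL₂(ℤ)` of a cusp, i.e. of an element of `ℚ ∪ {∞}`. -/
def cuspStabilizer (a : OnePoint ℚ) : Subgroup (SpecialLinearGroup (Fin 2) ℤ) :=
  (MulAction.stabilizer (GL (Fin 2) ℚ) a).comap (SpecialLinearGroup.mapGL ℚ)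

/-- The width of the cusp `a` for `Γ`: the index in the stabilizer of `a` in `SL₂(ℤ)` of its
elements lying in `Γ`, everything being taken modulo `±1` (as linear fractional
transformations). -/
def cuspWidth (Γ : Subgroup (SpecialLinearGroup (Fin 2) ℤ)) (a : OnePoint ℚ) : ℕ :=
  (Γ ⊔ Subgroup.zpowers (-1)).relIndex (cuspStabilizer a)

/-- `σ` is a scaling matrix for the cusp `a` of `Γ`: `σ = γ diag(√m, 1/√m)`, where `m` is the
width of `a`, and `γ ∈ SL₂(ℤ)` maps `∞` to `a` and has bottom row `(c, d)` with either `c < 0`,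
or `c = 0` and `d = 1`. -/
def IsScalingMatrix (Γ : Subgroup (SpecialLinearGroup (Fin 2) ℤ)) (a : OnePoint ℚ)
    (σ : Matrix (Fin 2) (Fin 2) ℝ) : Prop :=
  ∃ γ : SpecialLinearGroup (Fin 2) ℤ,
    SpecialLinearGroup.mapGL ℚ γ • (OnePoint.infty : OnePoint ℚ) = a ∧
    (γ 1 0 < 0 ∨ (γ 1 0 = 0 ∧ γ 1 1 = 1)) ∧
    σ = realMat γ * !![√(cuspWidth Γ a : ℝ), 0; 0, 1 / √(cuspWidth Γ a : ℝ)]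

/-- For `g ≠ 0` on the upper half-plane with `g (z + 1) = u g z` for some constant `u` of modulus
one, this is the number `κ ∈ [0, 1)` with `g (z + 1) = e^{2πiκ} g z`: the least `κ ≥ 0` with that
property. -/
def cuspParameter (g : ℂ → ℂ) : ℝ :=
  sInf {κ : ℝ | 0 ≤ κ ∧ ∀ z : ℂ, 0 < z.im →
    g (z + 1) = Complex.exp (2 * Real.pi * Complex.I * κ) * g z}

/-- The coefficient `a_n` in `g z = ∑_{n ≥ 0} a_n e^{2πi(n+κ)z}`, where `κ` is the cusp parameter
of `g`, given by the usual integral formula along `Im z = 1`. -/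
def fourierCoeff (g : ℂ → ℂ) (n : ℕ) : ℂ :=
  ∫ x in (0 : ℝ)..1, g (x + Complex.I) *
    Complex.exp (-(2 * Real.pi * Complex.I * (n + cuspParameter g) * (x + Complex.I)))

open Classical in
/-- The value at `∞` of `g`: the coefficient `a_0` if `κ = 0`, and `0` if `κ > 0`. -/
def valueAtInfty (g : ℂ → ℂ) : ℂ :=
  if cuspParameter g = 0 then fourierCoeff g 0 else 0

/-- `f` is a cusp form: it is cuspidal at every cusp. -/
def IsCuspForm (r : ℝ) (Γ : Subgroup (SpecialLinearGroup (Fin 2) ℤ)) (f : ℂ → ℂ) : Prop :=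
  ∀ (a : OnePoint ℚ) (σ : Matrix (Fin 2) (Fin 2) ℝ), IsScalingMatrix Γ a σ →
    valueAtInfty (slash r σ f) = 0

/-- The cusp parameter of `f` is rational at every cusp. -/
def HasRationalCuspParameters (r : ℝ) (Γ : Subgroup (SpecialLinearGroup (Fin 2) ℤ))
    (f : ℂ → ℂ) : Prop :=
  ∀ (a : OnePoint ℚ) (σ : Matrix (Fin 2) (Fin 2) ℝ), IsScalingMatrix Γ a σ →
    ∃ q : ℚ, cuspParameter (slash r σ f) = q

open Classical in
/-- `α₀ = r/2` for cusp forms, and `α₀ = r` otherwise. -/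
def alphaZero (r : ℝ) (Γ : Subgroup (SpecialLinearGroup (Fin 2) ℤ)) (f : ℂ → ℂ) : ℝ :=
  if IsCuspForm r Γ f then r / 2 else r

/-! ### Fractional integrals -/

open Classical in
/-- The partial sum over `n < N`, `n + κ > 0`, of `∑ a_n (n + κ)^{-α} e^{2πi(n+κ)x}`. -/
def fracPartialSum (g : ℂ → ℂ) (α x : ℝ) (N : ℕ) : ℂ :=
  ∑ n ∈ Finset.range N, if 0 < (n : ℝ) + cuspParameter g then
    fourierCoeff g n / ((((n : ℝ) + cuspParameter g) ^ α : ℝ) : ℂ) *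
      Complex.exp (2 * Real.pi * Complex.I * (n + cuspParameter g) * x)
  else 0

/-- The sum of the (in general only conditionally convergent) series
`∑_{n + κ > 0} a_n (n + κ)^{-α} e^{2πi(n+κ)x}`. -/
def fracSeries (g : ℂ → ℂ) (α x : ℝ) : ℂ :=
  limUnder atTop (fracPartialSum g α x)

/-- The function `z ↦ f (m z)`, where `m` is the width of `∞`. -/
def dilate (Γ : Subgroup (SpecialLinearGroup (Fin 2) ℤ)) (f : ℂ → ℂ) (z : ℂ) : ℂ :=
  f ((cuspWidth Γ OnePoint.infty : ℂ) * z)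

/-- The fractional integral `f_α`: `f_α (m x) = ∑_{n + κ > 0} a_n (n + κ)^{-α} e^{2πi(n+κ)x}`,
where `f (m z) = ∑ a_n e^{2πi(n+κ)z}` and `m` is the width of `∞`. -/
def fracIntegral (Γ : Subgroup (SpecialLinearGroup (Fin 2) ℤ)) (f : ℂ → ℂ) (α x : ℝ) : ℂ :=
  fracSeries (dilate Γ f) α (x / (cuspWidth Γ OnePoint.infty : ℝ))

open Classical in
/-- `ψ(x) = x^{α-r}`, or `x^{α-r} log x` if `α - r` is an integer (principal branches). -/
def psi (α r x : ℝ) : ℂ :=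
  if ∃ k : ℤ, α - r = k then (x : ℂ) ^ ((α - r : ℝ) : ℂ) * Complex.log x
  else (x : ℂ) ^ ((α - r : ℝ) : ℂ)

end FracModular

end

namespace FracModular

open MeasureTheory Set Metric

/-! Write a for the constant term of a form f at infinity. The Gamma integral turns the fractional
series into a constant multiple of the vertical integral V(x) = ∫₀^∞ t^{α-1} (f(x+it) - a) dt. This
converges because f - a is O(y^{-s} e^{-cy}) with s = α₀ < α. That bound (`cuspExpansion_slash`)
comes from reduction theory: |f| y^{r/2} is invariant under Γ, there are finitely many cosets, and
every point can be moved to height at least 1/2. The same bound for the derivative makes V Hölder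
continuous, so a Dini test shows that the possibly only conditionally convergent series sums to the
integral (`tendsto_fracPartialSum`).

After a translation and rescaling the rational point is 0, and the scaling matrix becomes an
inversion: f(z) = z^{-r} g(-1/z), where g is the expansion at the cusp, with constant term b. The
integral over t > 1 is smooth in x. For t ≤ 1 one writes f - a = z^{-r} (g-b)(-1/z) + b z^{-r} - a.
The last term integrates to a constant. The middle one gives b ∫₀¹ t^{α-1} (x+it)^{-r} dt, whose
singular part at x = 0 is a multiple of i^{-α} ψ(x) (`verticalKernel_expansion`). This follows from
a recursion in r obtained by integration by parts.

The first term is treated by contour deformation (`contour_identity`). The form (z-x)^{α-1} z^{-r}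
(g-b)(-1/z) dz is holomorphic, so the path from x to x+i may be replaced by three pieces: the
semicircle from x to 0 that is the image of the vertical line above -1/x, the imaginary axis from 0
to i, and the segment from i to x+i. The last two are smooth in x, the axis because (g-b)(-1/z) is
flat at 0. On the semicircle the inversion yields |x|^{2α} x^{-r} ∫ t^{α-1} (1-ixt)^{-(α+1-r)}
(g-b)(-1/x+it) dt. Replacing the tilt factor (1-ixt)^{-(α+1-r)} by 1 produces the fractional
integral of g at -1/x. The difference carries an extra factor O(|x|), which is the source of the
exponent 2α-r+1, and it is continuously differentiable away from 0 because tilt minus one vanishes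
to first order in t.

`approx_functional_equation_zero` assembles these pieces at the origin, and the final theorem
transports the result back to the rational point. -/

/-! ### Holomorphic functions on the upper half-plane -/

/-- The open upper half-plane as a set of complex numbers. -/
abbrev halfPlane : Set ℂ := {z : ℂ | 0 < z.im}

lemma isOpen_halfPlane : IsOpen halfPlane := isOpen_lt continuous_const Complex.continuous_im

lemma convex_halfPlane : Convex ℝ halfPlane := convex_halfSpace_im_gt 0

/-- A holomorphic function of constant modulus one on the upper half-plane is constant. -/
lemma exists_eq_const_of_norm_eq_one {u : ℂ → ℂ} (hu : DifferentiableOn ℂ u halfPlane)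
    (h1 : ∀ z ∈ halfPlane, ‖u z‖ = 1) : ∃ c : ℂ, ‖c‖ = 1 ∧ ∀ z ∈ halfPlane, u z = c := by
  have hI : Complex.I ∈ halfPlane := by simp
  refine ⟨u Complex.I, h1 _ hI, ?_⟩
  have := Complex.eqOn_of_isPreconnected_of_isMaxOn_norm convex_halfPlane.isPreconnected
    isOpen_halfPlane hu hI (fun z hz => by simp [h1 z hz, h1 _ hI])
  exact fun z hz => this hz

/-- Holomorphic functions on the upper half-plane have primitives. -/
lemma exists_primitive_halfPlane {φ : ℂ → ℂ} (hφ : DifferentiableOn ℂ φ halfPlane) :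
    ∃ G : ℂ → ℂ, ∀ z ∈ halfPlane, HasDerivAt G (φ z) z := by
  -- The Cayley transform c from the unit disc and its inverse k reduce the question to a disc,
  -- where primitives exist; φ is pulled back as the form φ(c(u)) c'(u) du.
  set c : ℂ → ℂ := fun u => Complex.I * (1 + u) / (1 - u) with hc
  set k : ℂ → ℂ := fun z => (z - Complex.I) / (z + Complex.I) with hk
  have hne : ∀ u ∈ ball (0 : ℂ) 1, 1 - u ≠ 0 := by
    intro u hu h
    rw [sub_eq_zero] at h
    simp [← h] at hu
  have hc' : ∀ u ∈ ball (0 : ℂ) 1, HasDerivAt c (2 * Complex.I / (1 - u) ^ 2) u := by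
    intro u hu
    have h1 : HasDerivAt (fun u : ℂ => Complex.I * (1 + u)) (Complex.I * 1) u :=
      ((hasDerivAt_id u).const_add 1).const_mul _
    have h2 : HasDerivAt (fun u : ℂ => 1 - u) (-1) u := (hasDerivAt_id u).const_sub 1
    exact (h1.div h2 (hne u hu)).congr_deriv (by ring)
  have hcim : ∀ u ∈ ball (0 : ℂ) 1, c u ∈ halfPlane := by
    intro u hu
    have h0 := hne u hu
    have h3 : 0 < Complex.normSq (1 - u) := Complex.normSq_pos.2 h0
    have h4 : Complex.normSq u < 1 := by
      rw [Complex.normSq_eq_norm_sq]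
      have : ‖u‖ < 1 := by simpa using hu
      nlinarith [norm_nonneg u]
    rw [Complex.normSq_apply] at h4
    simp only [hc, mem_ofPred_eq, Complex.div_im, Complex.mul_im, Complex.mul_re, Complex.I_re,
      Complex.I_im, Complex.add_re, Complex.one_re, Complex.add_im, Complex.one_im,
      Complex.sub_re, Complex.sub_im]
    rw [← sub_div]
    apply div_pos _ h3
    nlinarith
  have hzI : ∀ z ∈ halfPlane, z + Complex.I ≠ 0 := by
    intro z hz h
    have := congrArg Complex.im h
    have hz' : 0 < z.im := hz
    simp at this
    linarith
  have hkball : ∀ z ∈ halfPlane, k z ∈ ball (0 : ℂ) 1 := by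
    intro z hz
    have hz' : 0 < z.im := hz
    simp only [hk, mem_ball, dist_zero_right, norm_div]
    rw [div_lt_one (norm_pos_iff.2 (hzI z hz))]
    rw [← sq_lt_sq₀ (norm_nonneg _) (norm_nonneg _), ← Complex.normSq_eq_norm_sq,
      ← Complex.normSq_eq_norm_sq, Complex.normSq_apply, Complex.normSq_apply]
    simp
    nlinarith
  have hck : ∀ z ∈ halfPlane, c (k z) = z := by
    intro z hz
    have h1 := hzI z hz
    have h2 := hne _ (hkball z hz)
    simp only [hc]
    rw [div_eq_iff h2]
    simp only [hk]
    field_simp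
    ring
  have hd : DifferentiableOn ℂ (fun u => φ (c u) * (2 * Complex.I / (1 - u) ^ 2))
      (ball (0 : ℂ) 1) := by
    refine DifferentiableOn.mul
      (hφ.comp (fun u hu => (hc' u hu).differentiableAt.differentiableWithinAt) hcim) ?_
    refine DifferentiableOn.div (by fun_prop) (by fun_prop) ?_
    exact fun u hu => pow_ne_zero 2 (hne u hu)
  obtain ⟨g, hg⟩ := hd.isExactOn_ball
  refine ⟨g ∘ k, fun z hz => ?_⟩
  have h1 := hzI z hz
  have hk' : HasDerivAt k (2 * Complex.I / (z + Complex.I) ^ 2) z := by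
    exact (((hasDerivAt_id z).sub_const Complex.I).div
      ((hasDerivAt_id z).add_const Complex.I) h1).congr_deriv (by simp only [id]; ring)
  refine ((hg _ (hkball z hz)).comp z hk').congr_deriv ?_
  simp only
  rw [hck z hz, mul_assoc]
  have h2 : 1 - k z = 2 * Complex.I / (z + Complex.I) := by
    simp only [hk]; field_simp; ring
  rw [h2]
  have := Complex.I_ne_zero
  field_simp

/-! ### Decay estimates and integrals depending on a parameter -/

/-- Powers are dominated by exponentials. -/
lemma exists_rpow_mul_exp_le {p c : ℝ} (hp : 0 ≤ p) (hc : 0 < c) :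
    ∃ C : ℝ, 0 < C ∧ ∀ u : ℝ, 0 < u → u ^ p * Real.exp (-c * u) ≤ C := by
  rcases hp.eq_or_lt with rfl | hp
  · refine ⟨1, one_pos, fun u hu => ?_⟩
    simp only [Real.rpow_zero, one_mul, Real.exp_le_one_iff]
    nlinarith
  -- The constant comes from raising v ≤ e^v, with v = uc/p, to the power p.
  · refine ⟨(p / c) ^ p, by positivity, fun u hu => ?_⟩
    have h1 : u * c / p ≤ Real.exp (u * c / p) := by
      linarith [Real.add_one_le_exp (u * c / p)]
    have h2 : (u * c / p) ^ p ≤ Real.exp (c * u) := by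
      calc (u * c / p) ^ p ≤ (Real.exp (u * c / p)) ^ p :=
            Real.rpow_le_rpow (by positivity) h1 hp.le
        _ = Real.exp (c * u) := by
            rw [← Real.exp_mul]; congr 1; field_simp
    have h3 : u ^ p = (p / c) ^ p * (u * c / p) ^ p := by
      rw [← Real.mul_rpow (by positivity) (by positivity)]; congr 1; field_simp
    rw [h3, mul_assoc]
    refine mul_le_of_le_one_right (by positivity) ?_
    calc (u * c / p) ^ p * Real.exp (-c * u) ≤ Real.exp (c * u) * Real.exp (-c * u) := by gcongr
      _ = 1 := by rw [← Real.exp_add]; simp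

/-- Powers are dominated by exponentials away from zero, with an arbitrary real exponent. -/
lemma exists_rpow_mul_exp_le_of_one_le (p : ℝ) {c : ℝ} (hc : 0 < c) :
    ∃ C : ℝ, 0 < C ∧ ∀ u : ℝ, 1 ≤ u → u ^ p * Real.exp (-c * u) ≤ C := by
  obtain ⟨C, hC, h⟩ := exists_rpow_mul_exp_le (abs_nonneg p) hc
  refine ⟨C, hC, fun u hu => le_trans ?_ (h u (by linarith))⟩
  gcongr
  exact le_abs_self p

lemma integrableOn_rpow_mul_exp {p c : ℝ} (hp : -1 < p) (hc : 0 < c) :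
    IntegrableOn (fun t : ℝ => t ^ p * Real.exp (-c * t)) (Ioi 0) := by
  simpa using integrableOn_rpow_mul_exp_neg_mul_rpow hp one_pos hc

/-- `h` decays exponentially at `i∞` and grows at most like `(Im z)^{-s}` near the real axis. -/
def DecayBound (s : ℝ) (h : ℂ → ℂ) : Prop :=
  ∃ C c : ℝ, 0 < C ∧ 0 < c ∧ ∀ z : ℂ, 0 < z.im →
    ‖h z‖ ≤ C * (z.im ^ (-s) * Real.exp (-c * z.im))

/-- Cauchy's estimate on the disc of radius (Im z)/2, where heights stay at least (Im z)/2. The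
radius costs one power of Im z, and the lower height halves the exponential rate. -/
lemma DecayBound.deriv {s : ℝ} {h : ℂ → ℂ} (hb : DecayBound s h) (hs : 0 ≤ s)
    (hd : DifferentiableOn ℂ h halfPlane) : DecayBound (s + 1) (deriv h) := by
  obtain ⟨C, c, hC, hc, hb⟩ := hb
  refine ⟨C * 2 ^ s * 2, c / 2, by positivity, by positivity, fun z hz => ?_⟩
  have hsub : ∀ w ∈ closedBall z (z.im / 2), z.im / 2 ≤ w.im := by
    intro w hw
    have := (Complex.abs_im_le_norm (w - z)).trans (by simpa [dist_eq_norm] using hw)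
    rw [Complex.sub_im, abs_le] at this
    linarith
  have key := Complex.norm_deriv_le_of_forall_mem_sphere_norm_le (c := z) (R := z.im / 2)
    (C := C * ((z.im / 2) ^ (-s) * Real.exp (-c * (z.im / 2)))) (f := h) (by positivity)
    (DifferentiableOn.diffContOnCl (by
      rw [closure_ball _ (by positivity)]
      exact hd.mono fun w hw => lt_of_lt_of_le (by positivity) (hsub w hw)))
    (fun w hw => by
      have hw' := hsub w (sphere_subset_closedBall hw)
      have h0 : 0 < z.im / 2 := by positivity
      refine (hb w (by linarith)).trans ?_
      gcongr ?_ * (?_ * ?_)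
      · exact Real.rpow_le_rpow_of_nonpos h0 hw' (by linarith)
      · apply Real.exp_le_exp.2; nlinarith)
  refine key.trans (le_of_eq ?_)
  have e1 : (z.im / 2) ^ (-s) = z.im ^ (-s) * 2 ^ s := by
    rw [Real.div_rpow hz.le (by norm_num), Real.rpow_neg (by norm_num : (0:ℝ) ≤ 2), div_inv_eq_mul]
  have e2 : z.im ^ (-(s + 1)) = z.im ^ (-s) / z.im := by
    rw [neg_add, Real.rpow_add hz, Real.rpow_neg_one]; rfl
  rw [e1, e2]
  have e3 : -c * (z.im / 2) = -(c / 2) * z.im := by ring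
  rw [e3]
  field_simp

/-- Holomorphic dependence of an integral on a parameter, under local domination. -/
lemma hasDerivAt_integral_of_dominated {μ : Measure ℝ} {U : Set ℂ} (hU : IsOpen U)
    {Φ : ℂ → ℝ → ℂ} (hm : ∀ s ∈ U, AEStronglyMeasurable (Φ s) μ)
    (hd : ∀ᵐ t ∂μ, DifferentiableOn ℂ (fun s => Φ s t) U)
    (hb : ∀ s₀ ∈ U, ∃ ε > 0, ∃ bound : ℝ → ℝ, Integrable bound μ ∧
      ∀ᵐ t ∂μ, ∀ s ∈ ball s₀ ε ∩ U, ‖Φ s t‖ ≤ bound t) :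
    ∀ s₀ ∈ U, HasDerivAt (fun s => ∫ t, Φ s t ∂μ) (∫ t, deriv (fun s => Φ s t) s₀ ∂μ) s₀ := by
  intro s₀ hs₀
  obtain ⟨ε₁, hε₁, bound, hbi, hbd⟩ := hb s₀ hs₀
  obtain ⟨ε₂, hε₂, hsub⟩ := Metric.isOpen_iff.1 hU s₀ hs₀
  set ε := min ε₁ ε₂ / 2 with hε
  have hε0 : 0 < ε := by positivity
  have hball : ∀ s ∈ ball s₀ ε, closedBall s (ε / 2) ⊆ ball s₀ ε₁ ∩ U := by
    intro s hs w hw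
    have h1 : dist w s₀ < 2 * ε := by
      have := dist_triangle w s s₀
      rw [mem_ball] at hs; rw [mem_closedBall] at hw
      linarith
    have h2 : 2 * ε = min ε₁ ε₂ := by rw [hε]; ring
    rw [h2, lt_min_iff] at h1
    exact ⟨h1.1, hsub h1.2⟩
  -- Cauchy's estimate on discs of radius ε/2 turns domination of the integrand into domination of
  -- its derivative, so only the former has to be assumed.
  have hbound : ∀ᵐ t ∂μ, ∀ s ∈ ball s₀ ε, ‖deriv (fun s => Φ s t) s‖ ≤ bound t / (ε / 2) := by
    filter_upwards [hd, hbd] with t ht1 ht2 s hs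
    refine Complex.norm_deriv_le_of_forall_mem_sphere_norm_le (by positivity) ?_ ?_
    · refine DifferentiableOn.diffContOnCl ?_
      rw [closure_ball _ (by positivity)]
      exact ht1.mono fun w hw => (hball s hs hw).2
    · exact fun w hw => ht2 w (hball s hs (sphere_subset_closedBall hw))
  have hder : ∀ᵐ t ∂μ, ∀ s ∈ ball s₀ ε,
      HasDerivAt (fun s => Φ s t) (deriv (fun s => Φ s t) s) s := by
    filter_upwards [hd] with t ht s hs
    have hsU : s ∈ U := (hball s hs (mem_closedBall_self (by positivity))).2
    exact (ht.differentiableAt (hU.mem_nhds hsU)).hasDerivAt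
  have hs₀b : s₀ ∈ ball s₀ ε := mem_ball_self hε0
  -- The derivative is measurable as an almost everywhere limit of difference quotients along a
  -- sequence tending to s₀.
  have hmeas' : AEStronglyMeasurable (fun t => deriv (fun s => Φ s t) s₀) μ := by
    have hu : Tendsto (fun n : ℕ => s₀ + ((ε / 2 / (n + 1) : ℝ) : ℂ)) atTop (𝓝[≠] s₀) := by
      refine tendsto_nhdsWithin_iff.2 ⟨?_, Eventually.of_forall fun n => ?_⟩
      · have : Tendsto (fun n : ℕ => (ε / 2 / ((n : ℝ) + 1))) atTop (𝓝 0) :=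
          tendsto_const_nhds.div_atTop
            (tendsto_natCast_atTop_atTop.atTop_add tendsto_const_nhds)
        simpa using ((Complex.continuous_ofReal.tendsto 0).comp this).const_add s₀
      · have : (ε / 2 / ((n : ℝ) + 1)) ≠ 0 := by positivity
        rw [mem_compl_iff, mem_singleton_iff, add_eq_left]
        exact_mod_cast this
    have hin : ∀ n : ℕ, s₀ + ((ε / 2 / (n + 1) : ℝ) : ℂ) ∈ U := by
      intro n
      refine (hball s₀ hs₀b ?_).2
      rw [mem_closedBall, dist_eq_norm, add_sub_cancel_left, Complex.norm_real, Real.norm_eq_abs,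
        abs_of_nonneg (by positivity)]
      exact div_le_self (by positivity) (by linarith [(Nat.cast_nonneg n : (0:ℝ) ≤ n)])
    refine aestronglyMeasurable_of_tendsto_ae (u := atTop)
      (f := fun (n : ℕ) t => slope (fun s => Φ s t) s₀ (s₀ + ((ε / 2 / (n + 1) : ℝ) : ℂ))) ?_ ?_
    · intro n
      simp only [slope_def_module]
      exact ((hm _ (hin n)).sub (hm _ hs₀)).const_smul (s₀ + ((ε / 2 / (n + 1) : ℝ) : ℂ) - s₀)⁻¹
    · filter_upwards [hder] with t ht
      exact (hasDerivAt_iff_tendsto_slope.1 (ht s₀ hs₀b)).comp hu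
  have hint : Integrable (Φ s₀) μ := by
    refine hbi.mono' (hm _ hs₀) ?_
    filter_upwards [hbd] with t ht
    exact ht s₀ ⟨mem_ball_self hε₁, hs₀⟩
  exact (hasDerivAt_integral_of_dominated_loc_of_deriv_le (F' := fun s t => deriv (fun s => Φ s t) s)
    (ball_mem_nhds s₀ hε0)
    (by filter_upwards [hU.mem_nhds hs₀] with s hs using hm s hs) hint hmeas' hbound
    (hbi.div_const _) hder).2

/-- Continuously differentiable dependence of an integral on a real parameter. -/
lemma hasDerivAt_integral_of_dominated_real {μ : Measure ℝ} {U : Set ℝ} (hU : IsOpen U)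
    {Φ Φ' : ℝ → ℝ → ℂ} (hm' : ∀ x ∈ U, AEStronglyMeasurable (Φ' x) μ)
    (hi : ∀ x ∈ U, Integrable (Φ x) μ)
    (hd : ∀ᵐ t ∂μ, ∀ x ∈ U, HasDerivAt (fun x => Φ x t) (Φ' x t) x)
    (hc : ∀ᵐ t ∂μ, ContinuousOn (fun x => Φ' x t) U)
    (hb : ∀ x₀ ∈ U, ∃ ε > 0, ∃ bound : ℝ → ℝ, Integrable bound μ ∧
      ∀ᵐ t ∂μ, ∀ x ∈ ball x₀ ε ∩ U, ‖Φ' x t‖ ≤ bound t) :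
    (∀ x ∈ U, HasDerivAt (fun x => ∫ t, Φ x t ∂μ) (∫ t, Φ' x t ∂μ) x) ∧
      ContinuousOn (fun x => ∫ t, Φ' x t ∂μ) U := by
  refine ⟨fun x₀ hx₀ => ?_, fun x₀ hx₀ => ?_⟩
  · obtain ⟨ε, hε, bound, hbi, hbd⟩ := hb x₀ hx₀
    refine (hasDerivAt_integral_of_dominated_loc_of_deriv_le
      (inter_mem (ball_mem_nhds x₀ hε) (hU.mem_nhds hx₀)) ?_ (hi _ hx₀) (hm' _ hx₀) hbd hbi ?_).2
    · filter_upwards [hU.mem_nhds hx₀] with x hx using (hi x hx).aestronglyMeasurable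
    · filter_upwards [hd] with t ht x hx using ht x hx.2
  · obtain ⟨ε, hε, bound, hbi, hbd⟩ := hb x₀ hx₀
    refine ContinuousAt.continuousWithinAt ?_
    refine continuousAt_of_dominated (bound := bound) ?_ ?_ hbi ?_
    · filter_upwards [hU.mem_nhds hx₀] with x hx using hm' x hx
    · filter_upwards [inter_mem (ball_mem_nhds x₀ hε) (hU.mem_nhds hx₀)] with x hx
      filter_upwards [hbd] with t ht using ht x hx
    · filter_upwards [hc] with t ht using ht.continuousAt (hU.mem_nhds hx₀)

/-! ### The vertical Mellin integral -/

/-- The Mellin-type integral `∫₀^∞ t^{α-1} h(x + it) dt` along a vertical half-line. -/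
noncomputable def vertIntegral (α : ℝ) (h : ℂ → ℂ) (x : ℝ) : ℂ :=
  ∫ t in Ioi (0 : ℝ), ((t ^ (α - 1) : ℝ) : ℂ) * h (x + t * Complex.I)

lemma vert_mem_halfPlane (x : ℝ) {t : ℝ} (ht : 0 < t) : (x : ℂ) + t * Complex.I ∈ halfPlane := by
  simpa using ht

lemma continuousOn_vert {h : ℂ → ℂ} (hc : ContinuousOn h halfPlane) (x : ℝ) :
    ContinuousOn (fun t : ℝ => h (x + t * Complex.I)) (Ioi 0) :=
  hc.comp (by fun_prop) fun _ ht => vert_mem_halfPlane x ht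

lemma continuousOn_ofReal_rpow (p : ℝ) :
    ContinuousOn (fun t : ℝ => ((t ^ p : ℝ) : ℂ)) (Ioi 0) :=
  Complex.continuous_ofReal.comp_continuousOn fun t ht =>
    (Real.continuousAt_rpow_const t p (Or.inl (ne_of_gt ht))).continuousWithinAt

lemma integrableOn_vert {s α : ℝ} {h : ℂ → ℂ} (hb : DecayBound s h)
    (hc : ContinuousOn h halfPlane) (hα : s < α) (x : ℝ) :
    IntegrableOn (fun t : ℝ => ((t ^ (α - 1) : ℝ) : ℂ) * h (x + t * Complex.I)) (Ioi 0) := by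
  obtain ⟨C, c, hC, hc0, hb⟩ := hb
  have hi := (integrableOn_rpow_mul_exp (p := α - 1 - s) (by linarith) hc0).const_mul C
  refine Integrable.mono' hi
    (((continuousOn_ofReal_rpow _).mul (continuousOn_vert hc x)).aestronglyMeasurable
      measurableSet_Ioi) ?_
  filter_upwards [ae_restrict_mem measurableSet_Ioi] with t ht
  have ht' : 0 < t := ht
  have h1 := hb (x + t * Complex.I) (vert_mem_halfPlane x ht)
  simp only [Complex.add_im, Complex.ofReal_im, Complex.mul_im, Complex.ofReal_re, Complex.I_im,
    mul_one, Complex.I_re, mul_zero, add_zero, zero_add] at h1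
  rw [norm_mul, Complex.norm_real, Real.norm_eq_abs, abs_of_pos (by positivity)]
  calc t ^ (α - 1) * ‖h (x + t * Complex.I)‖
      ≤ t ^ (α - 1) * (C * (t ^ (-s) * Real.exp (-c * t))) := by gcongr
    _ = C * (t ^ (α - 1 - s) * Real.exp (-c * t)) := by
        rw [sub_eq_add_neg (α - 1) s, Real.rpow_add ht']; ring

lemma exists_norm_vertIntegral_le {s α : ℝ} {h : ℂ → ℂ} (hb : DecayBound s h) (hα : s < α) :
    ∃ M : ℝ, ∀ x, ‖vertIntegral α h x‖ ≤ M := by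
  obtain ⟨C, c, hC, hc0, hb⟩ := hb
  have hi := (integrableOn_rpow_mul_exp (p := α - 1 - s) (by linarith) hc0).const_mul C
  refine ⟨∫ t in Ioi (0 : ℝ), C * (t ^ (α - 1 - s) * Real.exp (-c * t)), fun x => ?_⟩
  refine norm_integral_le_of_norm_le hi ?_
  filter_upwards [ae_restrict_mem measurableSet_Ioi] with t ht
  have ht' : 0 < t := ht
  have h1 := hb (x + t * Complex.I) (vert_mem_halfPlane x ht)
  simp only [Complex.add_im, Complex.ofReal_im, Complex.mul_im, Complex.ofReal_re, Complex.I_im,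
    mul_one, Complex.I_re, mul_zero, add_zero, zero_add] at h1
  rw [norm_mul, Complex.norm_real, Real.norm_eq_abs, abs_of_pos (by positivity)]
  calc t ^ (α - 1) * ‖h (x + t * Complex.I)‖
      ≤ t ^ (α - 1) * (C * (t ^ (-s) * Real.exp (-c * t))) := by gcongr
    _ = C * (t ^ (α - 1 - s) * Real.exp (-c * t)) := by
        rw [sub_eq_add_neg (α - 1) s, Real.rpow_add ht']; ring

/-- `vertIntegral α h` is uniformly Hölder continuous of some positive order. -/
lemma exists_norm_vertIntegral_sub_le {s α : ℝ} {h : ℂ → ℂ} (hb : DecayBound s h) (hs : 0 ≤ s)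
    (hd : DifferentiableOn ℂ h halfPlane) (hα : s < α) :
    ∃ C ε : ℝ, 0 < ε ∧ ε ≤ 1 ∧ 0 ≤ C ∧
      ∀ x y : ℝ, ‖vertIntegral α h x - vertIntegral α h y‖ ≤ C * |x - y| ^ ε := by
  have hb0 := hb
  obtain ⟨C₁, c₁, hC₁, hc₁, hb₁⟩ := hb
  obtain ⟨C₂, c₂, hC₂, hc₂, hb₂⟩ := hb0.deriv hs hd
  -- Any exponent in (0, 1] below α - s would do: t^{α-1-s-ε} has to remain integrable at 0.
  set ε := min 1 ((α - s) / 2) with hε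
  have hε0 : 0 < ε := lt_min one_pos (by linarith)
  have hε1 : ε ≤ 1 := min_le_left _ _
  have hε2 : ε ≤ (α - s) / 2 := min_le_right _ _
  set c := min c₁ c₂
  have hc : 0 < c := lt_min hc₁ hc₂
  set D := 2 * C₁ + C₂
  have hD : 0 < D := by positivity
  have hi := (integrableOn_rpow_mul_exp (p := α - 1 - s - ε) (by linarith) hc).const_mul D
  refine ⟨∫ t in Ioi (0 : ℝ), D * (t ^ (α - 1 - s - ε) * Real.exp (-c * t)), ε, hε0, hε1, ?_, ?_⟩
  · refine setIntegral_nonneg measurableSet_Ioi fun t ht => ?_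
    have : (0 : ℝ) < t := ht
    positivity
  intro x y
  rw [vertIntegral, vertIntegral, ← integral_sub (integrableOn_vert hb0 hd.continuousOn hα x)
    (integrableOn_vert hb0 hd.continuousOn hα y), ← integral_mul_const]
  refine norm_integral_le_of_norm_le (hi.mul_const _) ?_
  filter_upwards [ae_restrict_mem measurableSet_Ioi] with t ht
  have ht' : 0 < t := ht
  set P := D * (t ^ (-s) * Real.exp (-c * t)) with hP
  have hP0 : 0 < P := by positivity
  have e1 : Real.exp (-c₁ * t) ≤ Real.exp (-c * t) := by
    apply Real.exp_le_exp.2; nlinarith [min_le_left c₁ c₂]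
  have e2 : Real.exp (-c₂ * t) ≤ Real.exp (-c * t) := by
    apply Real.exp_le_exp.2; nlinarith [min_le_right c₁ c₂]
  have n1 : ‖h (x + t * Complex.I) - h (y + t * Complex.I)‖ ≤ P := by
    have h1 := hb₁ (x + t * Complex.I) (vert_mem_halfPlane x ht)
    have h2 := hb₁ (y + t * Complex.I) (vert_mem_halfPlane y ht)
    simp only [Complex.add_im, Complex.ofReal_im, Complex.mul_im, Complex.ofReal_re, Complex.I_im,
      mul_one, Complex.I_re, mul_zero, add_zero, zero_add] at h1 h2
    have h3 : C₁ * (t ^ (-s) * Real.exp (-c₁ * t)) ≤ C₁ * (t ^ (-s) * Real.exp (-c * t)) := by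
      gcongr
    have h4 : 0 < C₂ * (t ^ (-s) * Real.exp (-c * t)) := by positivity
    calc _ ≤ _ := norm_sub_le _ _
      _ ≤ P := by rw [hP]; linarith
  have n2 : ‖h (x + t * Complex.I) - h (y + t * Complex.I)‖ ≤ P * (|x - y| / t) := by
    have h1 : ∀ z ∈ {z : ℂ | z.im = t}, ‖deriv h z‖ ≤ P / t := by
      intro z hz
      have hz' : z.im = t := hz
      refine (hb₂ z (by rw [hz']; exact ht')).trans ?_
      rw [hz', neg_add, Real.rpow_add ht', Real.rpow_neg_one, hP]
      have : C₂ ≤ D := by simp only [D]; linarith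
      calc C₂ * (t ^ (-s) * t⁻¹ * Real.exp (-c₂ * t))
          ≤ D * (t ^ (-s) * t⁻¹ * Real.exp (-c * t)) := by gcongr
        _ = _ := by field_simp
    have hconv : Convex ℝ {z : ℂ | z.im = t} := convex_hyperplane Complex.imLm.isLinear t
    have h2 := hconv.norm_image_sub_le_of_norm_hasDerivWithin_le (f := h) (f' := deriv h)
      (C := P / t) (x := y + t * Complex.I) (y := x + t * Complex.I)
      (fun z hz => ((hd.differentiableAt (isOpen_halfPlane.mem_nhds (by
        have hz' : z.im = t := hz
        rw [mem_ofPred_eq, hz']; exact ht'))).hasDerivAt).hasDerivWithinAt) h1 (by simp) (by simp)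
    refine h2.trans (le_of_eq ?_)
    rw [add_sub_add_right_eq_sub, ← Complex.ofReal_sub, Complex.norm_real, Real.norm_eq_abs]
    ring
  -- Interpolation between the trivial bound P and the mean value bound P·q with q = |x-y|/t, since
  -- min(1, q) ≤ q^ε.
  have n3 : ‖h (x + t * Complex.I) - h (y + t * Complex.I)‖ ≤ P * (|x - y| / t) ^ ε := by
    have hq : 0 ≤ |x - y| / t := by positivity
    rcases le_total (|x - y| / t) 1 with h1 | h1
    · refine n2.trans ?_
      gcongr
      rcases hq.eq_or_lt with h0 | h0
      · rw [← h0, Real.zero_rpow hε0.ne']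
      · simpa using Real.rpow_le_rpow_of_exponent_ge h0 h1 hε1
    · exact n1.trans (le_mul_of_one_le_right hP0.le (Real.one_le_rpow h1 hε0.le))
  rw [← mul_sub, norm_mul, Complex.norm_real, Real.norm_eq_abs, abs_of_pos (by positivity)]
  calc t ^ (α - 1) * ‖h (x + t * Complex.I) - h (y + t * Complex.I)‖
      ≤ t ^ (α - 1) * (P * (|x - y| / t) ^ ε) := by gcongr
    _ = D * (t ^ (α - 1 - s - ε) * Real.exp (-c * t)) * |x - y| ^ ε := by
        rw [Real.div_rpow (abs_nonneg _) ht'.le, hP, sub_eq_add_neg _ ε, Real.rpow_add ht',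
          sub_eq_add_neg _ s, Real.rpow_add ht', Real.rpow_neg ht'.le ε]
        ring

lemma continuous_vertIntegral {s α : ℝ} {h : ℂ → ℂ} (hb : DecayBound s h) (hs : 0 ≤ s)
    (hd : DifferentiableOn ℂ h halfPlane) (hα : s < α) : Continuous (vertIntegral α h) := by
  obtain ⟨C, ε, hε, -, hC, H⟩ := exists_norm_vertIntegral_sub_le hb hs hd hα
  rw [continuous_iff_continuousAt]
  intro y
  rw [ContinuousAt, tendsto_iff_norm_sub_tendsto_zero]
  have h0 : Tendsto (fun x : ℝ => C * |x - y| ^ ε) (𝓝 y) (𝓝 0) := by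
    have : Continuous fun x : ℝ => C * |x - y| ^ ε :=
      continuous_const.mul ((by fun_prop : Continuous fun x : ℝ => |x - y|).rpow_const
        fun _ => Or.inr hε.le)
    have h1 := this.tendsto y
    simpa [Real.zero_rpow hε.ne'] using h1
  exact squeeze_zero (fun _ => norm_nonneg _) (fun x => H x y) h0

/-! ### Summing the fractional Fourier series -/

/-- Dini's test for one-sided Fourier series, in the form of Chernoff. -/
lemma tendsto_sum_fourier_of_holder {u : ℝ → ℂ} (hu : Continuous u) {C ε : ℝ} (hε : 0 < ε)
    (hh : ∀ s, |s| ≤ 1 / 2 → ‖u s - u 0‖ ≤ C * |s| ^ ε)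
    (hneg : ∀ n : ℤ, n < 0 →
      ∫ s in (-(1 / 2) : ℝ)..(1 / 2), u s * Complex.exp (-(2 * Real.pi * Complex.I * n * s)) = 0) :
    Tendsto (fun N : ℕ => ∑ n ∈ Finset.range N,
      ∫ s in (-(1 / 2) : ℝ)..(1 / 2), u s * Complex.exp (-(2 * Real.pi * Complex.I * n * s)))
      atTop (𝓝 (u 0)) := by
  set e : ℤ → ℝ → ℂ := fun n s => Complex.exp (-(2 * Real.pi * Complex.I * n * s)) with he
  have hec : ∀ n, Continuous (e n) := fun n => by fun_prop
  have hen : ∀ n s, ‖e n s‖ = 1 := by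
    intro n s
    have : -(2 * Real.pi * Complex.I * n * s) = ((-(2 * Real.pi * n * s) : ℝ) : ℂ) * Complex.I := by
      push_cast; ring
    simp only [he]
    rw [this, Complex.norm_exp_ofReal_mul_I]
  -- The denominator vanishes only to first order at 0, so the Hölder condition makes G =
  -- O(|s|^{ε-1}), which is integrable.
  set G : ℝ → ℂ := fun s => (u s - u 0) / (Complex.exp (2 * Real.pi * Complex.I * s) - 1) with hG
  have hlow : ∀ s : ℝ, |s| ≤ 1 / 2 → 4 * |s| ≤ ‖Complex.exp (2 * Real.pi * Complex.I * s) - 1‖ := by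
    intro s hs
    have h1 := Complex.norm_exp_I_mul_ofReal_sub_one (2 * Real.pi * s)
    have h2 : Complex.I * ((2 * Real.pi * s : ℝ) : ℂ) = 2 * Real.pi * Complex.I * s := by
      push_cast; ring
    rw [h2] at h1
    rw [h1, norm_mul, Real.norm_eq_abs, Real.norm_eq_abs, abs_two]
    have h3 : 2 * Real.pi * s / 2 = Real.pi * s := by ring
    have h4 : |Real.pi * s| ≤ Real.pi / 2 := by
      rw [abs_mul, abs_of_pos Real.pi_pos]; nlinarith [Real.pi_pos]
    have h5 := Real.mul_abs_le_abs_sin h4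
    rw [h3]
    rw [abs_mul, abs_of_pos Real.pi_pos] at h5
    have h6 : 2 / Real.pi * (Real.pi * |s|) = 2 * |s| := by field_simp
    linarith
  have hC : 0 ≤ C := by
    have h1 := (norm_nonneg _).trans (hh (1 / 2) (by rw [abs_of_pos (by norm_num)]))
    exact nonneg_of_mul_nonneg_left h1 (by positivity)
  have hGm : AEStronglyMeasurable G volume := by
    apply Measurable.aestronglyMeasurable
    simp only [hG]
    have : Continuous fun s : ℝ => Complex.exp (2 * Real.pi * Complex.I * s) - 1 := by fun_prop
    exact (hu.sub continuous_const).measurable.div this.measurable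
  have hGi : IntegrableOn G (Ioc (-(1 / 2)) (1 / 2)) := by
    rw [integrableOn_Ioc_iff_integrableOn_Ioo]
    have h1 := integrableOn_ball_of_norm_le_rpow (μ := (volume : Measure ℝ)) (E := ℝ) (f := G)
      (C := C / 4) (α := 1 - ε) (r := 1 / 2) (by simp) (by simp; linarith) ?_ hGm
    · simpa [Real.ball_eq_Ioo] using h1
    · filter_upwards [ae_restrict_mem measurableSet_ball] with s hs
      have hs' : |s| ≤ 1 / 2 := by simpa using (mem_ball.1 hs).le
      rcases eq_or_ne s 0 with rfl | hs0
      · simp only [hG, sub_self, zero_div, norm_zero]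
        positivity
      · have hs1 : 0 < |s| := abs_pos.2 hs0
        simp only [hG, norm_div]
        rw [div_le_iff₀ (lt_of_lt_of_le (by positivity) (hlow s hs'))]
        calc ‖u s - u 0‖ ≤ C * |s| ^ ε := hh s hs'
          _ = C / 4 * |s| ^ (-(1 - ε)) * (4 * |s|) := by
              have : |s| ^ ε = |s| ^ (-(1 - ε)) * |s| := by
                nth_rw 3 [← Real.rpow_one |s|]
                rw [← Real.rpow_add hs1]; congr 1; ring
              rw [this]; ring
          _ ≤ _ := by
              rw [Real.norm_eq_abs]
              gcongr
              exact hlow s hs'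
  have hab : (-(1 / 2) : ℝ) ≤ 1 / 2 := by norm_num
  have hGe : ∀ n, IntervalIntegrable (fun s => G s * e n s) volume (-(1 / 2)) (1 / 2) := by
    intro n
    rw [intervalIntegrable_iff_integrableOn_Ioc_of_le hab]
    refine Integrable.mul_bdd (c := 1) hGi (hec n).aestronglyMeasurable ?_
    exact Eventually.of_forall fun s => (hen n s).le
  set Gh : ℤ → ℂ := fun n => ∫ s in (-(1 / 2) : ℝ)..(1 / 2), G s * e n s with hGh
  have hRL : Tendsto Gh cofinite (𝓝 0) := by
    have h1 := (Real.tendsto_integral_exp_smul_cocompact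
      (indicator (Ioc (-(1 / 2)) (1 / 2)) G)).comp Int.tendsto_coe_cofinite
    refine h1.congr fun n => ?_
    simp only [Function.comp, hGh]
    rw [intervalIntegral.integral_of_le hab, ← integral_indicator measurableSet_Ioc]
    congr 1
    ext s
    by_cases hs : s ∈ Ioc (-(1 / 2) : ℝ) (1 / 2)
    · simp only [indicator_of_mem hs]
      rw [Circle.smul_def, Real.fourierChar_apply, smul_eq_mul, mul_comm, he]
      congr 2
      push_cast; ring
    · rw [indicator_of_notMem hs, indicator_of_notMem hs, smul_zero]
  have hone : ∀ n : ℤ, (∫ s in (-(1 / 2) : ℝ)..(1 / 2), e n s) = if n = 0 then 1 else 0 := by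
    intro n
    split_ifs with hn
    · subst hn
      simp [he]; norm_num
    · have hc : -(2 * Real.pi * Complex.I * n) ≠ 0 := by
        simp [Complex.I_ne_zero, Real.pi_ne_zero, hn]
      have h1 := integral_exp_mul_complex (a := -(1 / 2)) (b := 1 / 2) hc
      have h2 : ∀ s : ℝ, e n s = Complex.exp (-(2 * Real.pi * Complex.I * n) * s) := by
        intro s; simp only [he]; congr 1; ring
      simp only [h2]
      rw [h1, div_eq_zero_iff]
      left
      rw [sub_eq_zero]
      apply Complex.exp_eq_exp_iff_exists_int.2
      refine ⟨-n, ?_⟩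
      push_cast; ring
  -- Since (u - u 0) e_n = G e_{n-1} - G e_n, the coefficients of u - u 0 are differences of
  -- consecutive coefficients of G; the constant u 0 only affects n = 0.
  have hstep : ∀ n : ℤ, (∫ s in (-(1 / 2) : ℝ)..(1 / 2), u s * e n s)
      = (if n = 0 then u 0 else 0) + (Gh (n - 1) - Gh n) := by
    intro n
    have h1 : (∫ s in (-(1 / 2) : ℝ)..(1 / 2), (u s - u 0) * e n s) = Gh (n - 1) - Gh n := by
      rw [hGh]
      simp only
      rw [← intervalIntegral.integral_sub (hGe _) (hGe _)]
      apply intervalIntegral.integral_congr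
      intro s hs
      rw [uIcc_of_le hab] at hs
      simp only
      have h2 : e (n - 1) s = e n s * Complex.exp (2 * Real.pi * Complex.I * s) := by
        simp only [he]; rw [← Complex.exp_add]; congr 1; push_cast; ring
      rw [h2]
      rcases eq_or_ne s 0 with rfl | hs0
      · simp
      · have h3 : Complex.exp (2 * Real.pi * Complex.I * s) - 1 ≠ 0 := by
          rw [← norm_pos_iff]
          have := hlow s (abs_le.2 ⟨by linarith [hs.1], hs.2⟩)
          have := abs_pos.2 hs0
          linarith
        simp only [hG]
        field_simp
    have h2 : (∫ s in (-(1 / 2) : ℝ)..(1 / 2), (u s - u 0) * e n s)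
        = (∫ s in (-(1 / 2) : ℝ)..(1 / 2), u s * e n s)
          - u 0 * ∫ s in (-(1 / 2) : ℝ)..(1 / 2), e n s := by
      have i1 : IntervalIntegrable (fun s => u s * e n s) volume (-(1 / 2)) (1 / 2) :=
        (hu.mul (hec n)).intervalIntegrable _ _
      have i2 : IntervalIntegrable (fun s => u 0 * e n s) volume (-(1 / 2)) (1 / 2) :=
        (continuous_const.mul (hec n)).intervalIntegrable _ _
      rw [← intervalIntegral.integral_const_mul, ← intervalIntegral.integral_sub i1 i2]
      congr 1; ext s; ring
    rw [h1, hone] at h2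
    rw [h2]
    split_ifs <;> ring
  -- Vanishing of the negative coefficients of u makes those of G constant for n ≤ -1, and
  -- Riemann–Lebesgue forces that constant to be 0. The one-sided sums then telescope to u 0 - Gh N.
  have hconst : ∀ m : ℕ, Gh (-1 - m) = Gh (-1) := by
    intro m
    induction m with
    | zero => simp
    | succ m ih =>
      have h1 := hneg (-1 - m) (by omega)
      have h2 := hstep (-1 - m)
      rw [if_neg (by omega)] at h2
      have h3 : (0 : ℂ) = 0 + (Gh (-1 - m - 1) - Gh (-1 - m)) := h1.symm.trans h2
      have h4 : (-1 - ((m + 1 : ℕ) : ℤ)) = -1 - m - 1 := by push_cast; ring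
      rw [h4, ← ih]
      linear_combination -h3
  have hG1 : Gh (-1) = 0 := by
    have h1 : Tendsto (fun m : ℕ => (-1 - m : ℤ)) atTop cofinite := by
      rw [← Nat.cofinite_eq_atTop]
      exact Function.Injective.tendsto_cofinite fun a b h => by simpa using h
    have h2 := hRL.comp h1
    refine tendsto_nhds_unique (f := fun _ : ℕ => Gh (-1)) tendsto_const_nhds (h2.congr fun m => ?_)
    exact hconst m
  have hsum : ∀ N : ℕ, ∑ n ∈ Finset.range (N + 1),
      (∫ s in (-(1 / 2) : ℝ)..(1 / 2), u s * e (n : ℤ) s) = u 0 - Gh N := by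
    intro N
    induction N with
    | zero =>
      rw [Finset.sum_range_one, hstep]
      simp [hG1]; ring
    | succ N ih =>
      rw [Finset.sum_range_succ, ih, hstep, if_neg (by omega)]
      have : ((N + 1 : ℕ) : ℤ) - 1 = N := by push_cast; ring
      rw [this]; ring
  rw [← tendsto_add_atTop_iff_nat 1]
  have h1 : Tendsto (fun N : ℕ => (N : ℤ)) atTop cofinite := by
    rw [← Nat.cofinite_eq_atTop]
    exact Function.Injective.tendsto_cofinite Nat.cast_injective
  have h2 : Tendsto (fun N : ℕ => u 0 - Gh N) atTop (𝓝 (u 0)) := by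
    simpa using (hRL.comp h1).const_sub (u 0)
  refine h2.congr fun N => ?_
  rw [← hsum N]
  simp [he]

/-- Cauchy's theorem on a rectangle of width one; the two vertical sides cancel by periodicity. -/
lemma integral_horizontal_eq {p : ℂ → ℂ} (hp : DifferentiableOn ℂ p halfPlane)
    (hper : ∀ z ∈ halfPlane, p (z + 1) = p z) {t₁ t₂ : ℝ} (h₁ : 0 < t₁) (h₂ : 0 < t₂) :
    ∫ x in (0 : ℝ)..1, p (x + t₁ * Complex.I) = ∫ x in (0 : ℝ)..1, p (x + t₂ * Complex.I) := by
  have key := Complex.integral_boundary_rect_eq_zero_of_differentiableOn p (t₁ * Complex.I)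
    (1 + t₂ * Complex.I) (hp.mono fun z hz => by
      have := hz.2
      simp at this
      exact lt_of_lt_of_le (lt_min h₁ h₂) this.1)
  simp only [Complex.mul_re, Complex.ofReal_re, Complex.I_re, mul_zero, Complex.ofReal_im,
    Complex.I_im, mul_one, sub_self, Complex.add_re, Complex.one_re, add_zero, Complex.mul_im,
    zero_add, Complex.add_im, Complex.one_im, Complex.ofReal_one, Complex.ofReal_zero] at key
  have h3 : (∫ y in t₁..t₂, p (1 + y * Complex.I)) = ∫ y in t₁..t₂, p (y * Complex.I) := by
    apply intervalIntegral.integral_congr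
    intro y hy
    have hy0 : 0 < y := lt_of_lt_of_le (lt_min h₁ h₂) hy.1
    simp only
    rw [add_comm, hper _ (by simpa using hy0)]
  rw [h3] at key
  have := sub_eq_zero.1 (by linear_combination key :
    (∫ x in (0 : ℝ)..1, p (x + t₁ * Complex.I)) -
      ∫ x in (0 : ℝ)..1, p (x + t₂ * Complex.I) = 0)
  exact this

lemma integral_horizontal_shift {p : ℂ → ℂ} (hper : ∀ z ∈ halfPlane, p (z + 1) = p z)
    (x : ℝ) {t : ℝ} (ht : 0 < t) :
    ∫ s in (-(1 / 2) : ℝ)..(1 / 2), p ((x + s : ℝ) + t * Complex.I) =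
      ∫ s in (0 : ℝ)..1, p (s + t * Complex.I) := by
  have hP : Function.Periodic (fun s : ℝ => p (s + t * Complex.I)) 1 := by
    intro s
    simp only
    rw [← hper _ (vert_mem_halfPlane s ht)]
    congr 1; push_cast; ring
  have h1 := intervalIntegral.integral_comp_add_left (a := -(1 / 2)) (b := 1 / 2)
    (fun s : ℝ => p (s + t * Complex.I)) x
  rw [h1]
  have h2 := hP.intervalIntegral_add_eq (x + -(1 / 2)) 0
  rw [zero_add] at h2
  rw [← h2]
  congr 1; ring

lemma norm_exp_twist (l : ℝ) (z : ℂ) :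
    ‖Complex.exp (-(2 * Real.pi * Complex.I * l * z))‖ = Real.exp (2 * Real.pi * l * z.im) := by
  rw [Complex.norm_exp]
  congr 1
  simp

/-- Fourier coefficients of nonpositive frequency vanish. -/
lemma integral_horizontal_eq_zero {s l : ℝ} {h : ℂ → ℂ} (hd : DifferentiableOn ℂ h halfPlane)
    (hb : DecayBound s h) (hl : l ≤ 0)
    (hper : ∀ z ∈ halfPlane, h (z + 1) * Complex.exp (-(2 * Real.pi * Complex.I * l * (z + 1))) =
      h z * Complex.exp (-(2 * Real.pi * Complex.I * l * z))) {t : ℝ} (ht : 0 < t) :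
    ∫ x in (0 : ℝ)..1, h (x + t * Complex.I) *
      Complex.exp (-(2 * Real.pi * Complex.I * l * (x + t * Complex.I))) = 0 := by
  set p : ℂ → ℂ := fun z => h z * Complex.exp (-(2 * Real.pi * Complex.I * l * z)) with hp
  have hpd : DifferentiableOn ℂ p halfPlane := hd.mul (by fun_prop)
  obtain ⟨C, c, hC, hc, hb⟩ := hb
  -- The integral does not depend on the height. For l ≤ 0 the exponential has modulus at most one,
  -- so the decay of h kills the integral as the height goes to infinity.
  have h1 : ∀ y : ℝ, 0 < y → ‖∫ x in (0 : ℝ)..1, p (x + t * Complex.I)‖ ≤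
      C * (y ^ (-s) * Real.exp (-c * y)) := by
    intro y hy
    rw [integral_horizontal_eq hpd hper ht hy]
    have := intervalIntegral.norm_integral_le_of_norm_le_const (a := 0) (b := 1)
      (f := fun x : ℝ => p (x + y * Complex.I)) (C := C * (y ^ (-s) * Real.exp (-c * y))) ?_
    · simpa using this
    intro x _
    simp only [hp, norm_mul]
    have h2 := hb (x + y * Complex.I) (vert_mem_halfPlane x hy)
    rw [norm_exp_twist]
    simp only [Complex.add_im, Complex.ofReal_im, Complex.mul_im, Complex.ofReal_re, Complex.I_im,
      mul_one, Complex.I_re, mul_zero, add_zero, zero_add] at h2 ⊢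
    refine (mul_le_of_le_one_right (norm_nonneg _) ?_).trans h2
    rw [Real.exp_le_one_iff]
    have := mul_nonneg Real.pi_pos.le hy.le
    nlinarith
  have h2 : Tendsto (fun y : ℝ => C * (y ^ (-s) * Real.exp (-c * y))) atTop (𝓝 0) := by
    simpa using (tendsto_rpow_mul_exp_neg_mul_atTop_nhds_zero (-s) c hc).const_mul C
  have h3 : ‖∫ x in (0 : ℝ)..1, p (x + t * Complex.I)‖ ≤ 0 :=
    ge_of_tendsto h2 (by filter_upwards [Ioi_mem_atTop 0] with y hy using h1 y hy)
  exact norm_le_zero_iff.1 h3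

/-- The Fourier coefficients of `vertIntegral α h`. -/
lemma integral_vertIntegral_mul_exp {s α l : ℝ} {h : ℂ → ℂ} (hd : DifferentiableOn ℂ h halfPlane)
    (hb : DecayBound s h) (hα : s < α)
    (hper : ∀ z ∈ halfPlane, h (z + 1) * Complex.exp (-(2 * Real.pi * Complex.I * l * (z + 1))) =
      h z * Complex.exp (-(2 * Real.pi * Complex.I * l * z))) (x : ℝ) :
    ∫ u in (-(1 / 2) : ℝ)..(1 / 2), vertIntegral α h (x + u) *
        Complex.exp (-(2 * Real.pi * Complex.I * l * u)) =
      Complex.exp (2 * Real.pi * Complex.I * l * x) *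
      (∫ y in (0 : ℝ)..1, h (y + Complex.I) *
        Complex.exp (-(2 * Real.pi * Complex.I * l * (y + Complex.I)))) *
      ((∫ t in Ioi (0 : ℝ), t ^ (α - 1) * Real.exp (-(2 * Real.pi * l * t)) : ℝ) : ℂ) := by
  set p : ℂ → ℂ := fun z => h z * Complex.exp (-(2 * Real.pi * Complex.I * l * z)) with hp
  have hpd : DifferentiableOn ℂ p halfPlane := hd.mul (by fun_prop)
  set Ψ : ℝ → ℝ → ℂ := fun u t => ((t ^ (α - 1) : ℝ) : ℂ) * h ((x + u : ℝ) + t * Complex.I) *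
    Complex.exp (-(2 * Real.pi * Complex.I * l * u)) with hΨ
  have hab : (-(1 / 2) : ℝ) ≤ 1 / 2 := by norm_num
  have hint : Integrable (Function.uncurry Ψ)
      ((volume.restrict (uIoc (-(1 / 2) : ℝ) (1 / 2))).prod (volume.restrict (Ioi (0 : ℝ)))) := by
    obtain ⟨C, c, hC, hc, hb⟩ := hb
    have hi : Integrable (fun t : ℝ => C * (t ^ (α - 1 - s) * Real.exp (-c * t)))
      (volume.restrict (Ioi (0 : ℝ))) :=
      (integrableOn_rpow_mul_exp (p := α - 1 - s) (by linarith) hc).const_mul C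
    have hfin : IsFiniteMeasure (volume.restrict (uIoc (-(1 / 2) : ℝ) (1 / 2))) := by
      rw [uIoc_of_le hab]; infer_instance
    refine Integrable.mono' (hi.comp_snd (volume.restrict (uIoc (-(1 / 2) : ℝ) (1 / 2)))) ?_ ?_
    · rw [Measure.prod_restrict]
      refine ContinuousOn.aestronglyMeasurable ?_ (measurableSet_uIoc.prod measurableSet_Ioi)
      refine ContinuousOn.mul (ContinuousOn.mul ?_ ?_) (by fun_prop)
      · exact (continuousOn_ofReal_rpow (α - 1)).comp continuousOn_snd fun q hq => hq.2
      · refine hd.continuousOn.comp (by fun_prop) fun q hq => ?_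
        exact vert_mem_halfPlane (x + q.1) hq.2
    · rw [Measure.prod_restrict]
      filter_upwards [ae_restrict_mem (measurableSet_uIoc.prod measurableSet_Ioi)] with q hq
      have ht' : 0 < q.2 := hq.2
      have h1 := hb ((x + q.1 : ℝ) + q.2 * Complex.I) (vert_mem_halfPlane _ ht')
      simp only [Complex.add_im, Complex.ofReal_im, Complex.mul_im, Complex.ofReal_re,
        Complex.I_im, mul_one, Complex.I_re, mul_zero, add_zero, zero_add] at h1
      have h2 := norm_exp_twist l q.1
      simp only [Complex.ofReal_im, mul_zero, Real.exp_zero] at h2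
      simp only [Function.uncurry, hΨ, norm_mul]
      rw [h2, mul_one, Complex.norm_real, Real.norm_eq_abs, abs_of_pos (by positivity)]
      calc q.2 ^ (α - 1) * ‖h ((x + q.1 : ℝ) + q.2 * Complex.I)‖
          ≤ q.2 ^ (α - 1) * (C * (q.2 ^ (-s) * Real.exp (-c * q.2))) := by gcongr
        _ = C * (q.2 ^ (α - 1 - s) * Real.exp (-c * q.2)) := by
            rw [sub_eq_add_neg (α - 1) s, Real.rpow_add ht']; ring
  have h1 : ∀ u : ℝ, vertIntegral α h (x + u) * Complex.exp (-(2 * Real.pi * Complex.I * l * u))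
      = ∫ t in Ioi (0 : ℝ), Ψ u t := by
    intro u
    rw [vertIntegral, ← integral_mul_const]
  simp only [h1]
  rw [intervalIntegral_integral_swap hint]
  set J := ∫ y in (0 : ℝ)..1, p (y + Complex.I) with hJ
  -- The mean over a period at height t equals that at height one up to the factor e^{-2πlt}, which
  -- leaves a Gamma-type integral in t.
  have h2 : ∀ t ∈ Ioi (0 : ℝ), ∫ u in (-(1 / 2) : ℝ)..(1 / 2), Ψ u t =
      (Complex.exp (2 * Real.pi * Complex.I * l * x) * J) *
      ((t ^ (α - 1) * Real.exp (-(2 * Real.pi * l * t)) : ℝ) : ℂ) := by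
    intro t ht
    have h3 : ∀ u : ℝ, Ψ u t = (Complex.exp (2 * Real.pi * Complex.I * l * x) *
        ((t ^ (α - 1) * Real.exp (-(2 * Real.pi * l * t)) : ℝ) : ℂ)) *
        p ((x + u : ℝ) + t * Complex.I) := by
      intro u
      simp only [hΨ, hp]
      have h4 : Complex.exp (-(2 * Real.pi * Complex.I * l * u)) =
          Complex.exp (2 * Real.pi * Complex.I * l * x) *
          Complex.exp (-(2 * Real.pi * l * t)) *
          Complex.exp (-(2 * Real.pi * Complex.I * l * ((x + u : ℝ) + t * Complex.I))) := by
        rw [← Complex.exp_add, ← Complex.exp_add]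
        congr 1
        push_cast
        linear_combination (2 * Real.pi * l * t) * Complex.I_sq
      rw [h4]
      push_cast
      ring
    simp only [h3]
    rw [intervalIntegral.integral_const_mul, integral_horizontal_shift hper x ht,
      integral_horizontal_eq hpd hper ht one_pos, hJ]
    simp only [Complex.ofReal_one, one_mul]
    ring
  rw [setIntegral_congr_fun measurableSet_Ioi h2, integral_const_mul, integral_complex_ofReal]

/-- The fractional Fourier series is given by a vertical Mellin-type integral. -/
theorem tendsto_fracPartialSum {g : ℂ → ℂ} {b : ℂ} {s α : ℝ}
    (hg : DifferentiableOn ℂ g halfPlane) (hκ0 : 0 ≤ cuspParameter g) (hκ1 : cuspParameter g < 1)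
    (hper : ∀ z ∈ halfPlane,
      g (z + 1) = Complex.exp (2 * Real.pi * Complex.I * cuspParameter g) * g z)
    (hb : DecayBound s (fun z => g z - b)) (hbκ : b ≠ 0 → cuspParameter g = 0)
    (hs : 0 < s) (hα : s < α) (x : ℝ) :
    Tendsto (fracPartialSum g α x) atTop
      (𝓝 ((((2 * Real.pi) ^ α / Real.Gamma α : ℝ) : ℂ) *
        vertIntegral α (fun z => g z - b) x)) := by
  set κ := cuspParameter g with hκ
  set h : ℂ → ℂ := fun z => g z - b with hh
  have hd : DifferentiableOn ℂ h halfPlane := hg.sub_const b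
  have hα0 : 0 < α := hs.trans hα
  -- The constant b is non-zero only when κ = 0, so g - b has the same multiplier under z ↦ z + 1 as
  -- g.
  have hbκ' : b * Complex.exp (2 * Real.pi * Complex.I * κ) = b := by
    rcases eq_or_ne b 0 with h0 | h0
    · simp [h0]
    · simp [hbκ h0]
  have hperh : ∀ z ∈ halfPlane, h (z + 1) = Complex.exp (2 * Real.pi * Complex.I * κ) * h z := by
    intro z hz
    simp only [hh]
    rw [hper z hz]
    linear_combination hbκ'
  have hperl : ∀ n : ℤ, ∀ z ∈ halfPlane,
      h (z + 1) * Complex.exp (-(2 * Real.pi * Complex.I * ((n + κ : ℝ) : ℂ) * (z + 1))) =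
      h z * Complex.exp (-(2 * Real.pi * Complex.I * ((n + κ : ℝ) : ℂ) * z)) := by
    intro n z hz
    rw [hperh z hz]
    have e1 : Complex.exp (-(2 * Real.pi * Complex.I * ((n + κ : ℝ) : ℂ) * (z + 1))) =
        Complex.exp (-(2 * Real.pi * Complex.I * ((n + κ : ℝ) : ℂ) * z)) *
        Complex.exp (-(2 * Real.pi * Complex.I * κ)) := by
      rw [← Complex.exp_add]
      apply Complex.exp_eq_exp_iff_exists_int.2
      refine ⟨-n, ?_⟩
      push_cast
      ring
    rw [e1]
    have e2 : Complex.exp (2 * Real.pi * Complex.I * κ) *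
        Complex.exp (-(2 * Real.pi * Complex.I * κ)) = 1 := by
      rw [← Complex.exp_add]; simp
    linear_combination (h z * Complex.exp (-(2 * Real.pi * Complex.I * ((n + κ : ℝ) : ℂ) * z))) * e2
  set V := vertIntegral α h with hV
  have hVc : Continuous V := continuous_vertIntegral hb hs.le hd hα
  obtain ⟨M, hM⟩ := exists_norm_vertIntegral_le hb hα
  obtain ⟨C, ε, hε0, hε1, hC, hH⟩ := exists_norm_vertIntegral_sub_le hb hs.le hd hα
  -- The twist moves the frequencies n + κ to the integers n, so that the Dini test applies at t =
  -- 0, where u 0 = V x.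
  set u : ℝ → ℂ := fun t => V (x + t) * Complex.exp (-(2 * Real.pi * Complex.I * κ * t)) with hu
  have huc : Continuous u := (hVc.comp (continuous_const.add continuous_id)).mul (by fun_prop)
  have hM0 : 0 ≤ M := (norm_nonneg _).trans (hM 0)
  have key := tendsto_sum_fourier_of_holder (u := u) huc (C := C + M * (2 * Real.pi * κ)) hε0
    (fun t ht => by
      simp only [hu]
      have h0 : V (x + (0 : ℝ)) * Complex.exp (-(2 * Real.pi * Complex.I * κ * (0 : ℝ))) = V x := by
        simp
      rw [h0]
      have h1 : V (x + t) * Complex.exp (-(2 * Real.pi * Complex.I * κ * t)) - V x =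
          (V (x + t) - V x) +
          V (x + t) * (Complex.exp (Complex.I * ((-(2 * Real.pi * κ * t) : ℝ) : ℂ)) - 1) := by
        have : -(2 * Real.pi * Complex.I * κ * t) =
            Complex.I * ((-(2 * Real.pi * κ * t) : ℝ) : ℂ) := by push_cast; ring
        rw [this]; ring
      rw [h1]
      have h2 : ‖V (x + t) - V x‖ ≤ C * |t| ^ ε := by simpa using hH (x + t) x
      have h3 := Real.norm_exp_I_mul_ofReal_sub_one_le (x := -(2 * Real.pi * κ * t))
      have h4 : ‖(-(2 * Real.pi * κ * t) : ℝ)‖ = 2 * Real.pi * κ * |t| := by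
        rw [norm_neg, Real.norm_eq_abs, abs_mul, abs_of_nonneg (by positivity)]
      have h5 : |t| ≤ |t| ^ ε := by
        rcases (abs_nonneg t).eq_or_lt with h0 | h0
        · rw [← h0, Real.zero_rpow hε0.ne']
        · simpa using Real.rpow_le_rpow_of_exponent_ge h0 (ht.trans (by norm_num)) hε1
      calc _ ≤ ‖V (x + t) - V x‖ + ‖V (x + t) *
            (Complex.exp (Complex.I * ((-(2 * Real.pi * κ * t) : ℝ) : ℂ)) - 1)‖ := norm_add_le _ _
        _ ≤ C * |t| ^ ε + M * (2 * Real.pi * κ * |t| ^ ε) := by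
            rw [norm_mul]
            gcongr
            · exact hM _
            · rw [h4] at h3
              exact h3.trans (by gcongr)
        _ = _ := by ring)
  have hcoef : ∀ n : ℤ, ∫ t in (-(1 / 2) : ℝ)..(1 / 2), u t *
      Complex.exp (-(2 * Real.pi * Complex.I * n * t)) =
      Complex.exp (2 * Real.pi * Complex.I * ((n + κ : ℝ) : ℂ) * x) *
      (∫ y in (0 : ℝ)..1, h (y + Complex.I) *
        Complex.exp (-(2 * Real.pi * Complex.I * ((n + κ : ℝ) : ℂ) * (y + Complex.I)))) *
      ((∫ t in Ioi (0 : ℝ), t ^ (α - 1) * Real.exp (-(2 * Real.pi * (n + κ) * t)) : ℝ) : ℂ) := by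
    intro n
    rw [← integral_vertIntegral_mul_exp hd hb hα (hperl n) x]
    apply intervalIntegral.integral_congr
    intro t _
    simp only [hu]
    rw [mul_assoc, ← Complex.exp_add]
    congr 2
    push_cast; ring
  have hzero : ∀ n : ℤ, (n : ℝ) + κ ≤ 0 → ∫ y in (0 : ℝ)..1, h (y + Complex.I) *
        Complex.exp (-(2 * Real.pi * Complex.I * ((n + κ : ℝ) : ℂ) * (y + Complex.I))) = 0 := by
    intro n hn
    simpa using integral_horizontal_eq_zero hd hb hn (hperl n) one_pos
  have hlim := (key fun n hn => by
    rw [hcoef, hzero n, mul_zero, zero_mul]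
    have : (n : ℝ) ≤ -1 := by exact_mod_cast (by omega : n ≤ -1)
    linarith).const_mul (((2 * Real.pi) ^ α / Real.Gamma α : ℝ) : ℂ)
  have hu0 : u 0 = V x := by simp [hu]
  rw [hu0] at hlim
  refine hlim.congr fun N => ?_
  rw [fracPartialSum, Finset.mul_sum]
  refine Finset.sum_congr rfl fun n _ => ?_
  have hc := hcoef n
  simp only [Int.cast_natCast] at hc
  rw [hc]
  split_ifs with hpos
  · have hpos' : 0 < (n : ℝ) + κ := hpos
    have e1 : ∫ t in Ioi (0 : ℝ), t ^ (α - 1) * Real.exp (-(2 * Real.pi * (n + κ) * t)) =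
        (1 / (2 * Real.pi * (n + κ))) ^ α * Real.Gamma α :=
      Real.integral_rpow_mul_exp_neg_mul_Ioi hα0 (by positivity)
    -- Subtracting b does not change a coefficient of positive frequency: if b ≠ 0 then κ = 0 and n
    -- ≠ 0, and a constant has no such component.
    have e2 : fourierCoeff g n = ∫ y in (0 : ℝ)..1, h (y + Complex.I) *
        Complex.exp (-(2 * Real.pi * Complex.I * ((n + κ : ℝ) : ℂ) * (y + Complex.I))) := by
      have e3 : (∫ y in (0 : ℝ)..1, b *
          Complex.exp (-(2 * Real.pi * Complex.I * ((n + κ : ℝ) : ℂ) * (y + Complex.I)))) = 0 := by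
        rcases eq_or_ne b 0 with h0 | h0
        · simp [h0]
        · rw [intervalIntegral.integral_const_mul]
          have hκ0 := hbκ h0
          have hn : (n : ℂ) ≠ 0 := by
            rintro h1
            rw [Nat.cast_eq_zero] at h1
            simp [h1, hκ0] at hpos'
          have hne : -(2 * Real.pi * Complex.I * n) ≠ 0 := by
            simp [Complex.I_ne_zero, Real.pi_ne_zero, hn]
          have e4 : ∀ y : ℝ,
              Complex.exp (-(2 * Real.pi * Complex.I * ((n + κ : ℝ) : ℂ) * (y + Complex.I))) =
              Complex.exp (-(2 * Real.pi * Complex.I * n * Complex.I)) *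
                Complex.exp (-(2 * Real.pi * Complex.I * n) * y) := by
            intro y
            rw [← Complex.exp_add, hκ0]
            congr 1; push_cast; ring
          simp only [e4]
          rw [intervalIntegral.integral_const_mul, integral_exp_mul_complex hne]
          have e5 : Complex.exp (-(2 * Real.pi * Complex.I * n) * (1 : ℝ)) =
              Complex.exp (-(2 * Real.pi * Complex.I * n) * (0 : ℝ)) := by
            apply Complex.exp_eq_exp_iff_exists_int.2
            refine ⟨-n, ?_⟩
            push_cast; ring
          rw [e5]; simp
      have i0 : ContinuousOn (fun y : ℝ => g (y + Complex.I)) (uIcc 0 1) :=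
        (hg.continuousOn.comp (by fun_prop) fun y _ => by simp :
          ContinuousOn (fun y : ℝ => g (y + Complex.I)) univ).mono (subset_univ _)
      have i1 : IntervalIntegrable (fun y : ℝ => g (y + Complex.I) *
          Complex.exp (-(2 * Real.pi * Complex.I * ((n + κ : ℝ) : ℂ) * (y + Complex.I))))
          volume 0 1 := (i0.mul (by fun_prop)).intervalIntegrable
      have i2 : IntervalIntegrable (fun y : ℝ => b *
          Complex.exp (-(2 * Real.pi * Complex.I * ((n + κ : ℝ) : ℂ) * (y + Complex.I))))
          volume 0 1 := (by fun_prop : Continuous (fun y : ℝ => b *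
          Complex.exp (-(2 * Real.pi * Complex.I * ((n + κ : ℝ) : ℂ) *
            (y + Complex.I))))).intervalIntegrable _ _
      rw [fourierCoeff]
      simp only [hh, sub_mul]
      rw [intervalIntegral.integral_sub i1 i2, e3, sub_zero]
      push_cast
      rfl
    rw [e1, ← e2, one_div, Real.inv_rpow (by positivity), Real.mul_rpow (by positivity) hpos'.le]
    have hG := Real.Gamma_pos_of_pos hα0
    have h2π : (0 : ℝ) < (2 * Real.pi) ^ α := by positivity
    have hlam : (0 : ℝ) < ((n : ℝ) + κ) ^ α := by positivity
    have hG' : ((Real.Gamma α : ℝ) : ℂ) ≠ 0 := by exact_mod_cast hG.ne'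
    have h2π' : (((2 * Real.pi) ^ α : ℝ) : ℂ) ≠ 0 := by exact_mod_cast h2π.ne'
    have hlam' : ((((n : ℝ) + κ) ^ α : ℝ) : ℂ) ≠ 0 := by exact_mod_cast hlam.ne'
    rw [Complex.ofReal_div, Complex.ofReal_mul, Complex.ofReal_inv, Complex.ofReal_mul]
    rw [show ((n : ℂ) + (κ : ℂ)) = (((n : ℝ) + κ : ℝ) : ℂ) by push_cast; rfl]
    rw [← hκ]
    field_simp
  -- An index with n + κ ≤ 0 is left out of the series, and its coefficient in the integral vanishes
  -- as well.
  · have := hzero n (by simpa using hpos)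
    simp only [Int.cast_natCast] at this
    rw [this]; simp

/-! ### The beta-type kernel and its singularity at the origin -/

lemma add_ofReal_mem_slitPlane {s : ℂ} (hs : s ∈ Complex.slitPlane) {t : ℝ} (ht : 0 ≤ t) :
    s + t ∈ Complex.slitPlane := by
  rw [Complex.mem_slitPlane_iff] at hs ⊢
  simp only [Complex.add_re, Complex.ofReal_re, Complex.add_im, Complex.ofReal_im, add_zero]
  rcases hs with h | h
  · left; linarith
  · right; exact h

/-- Locally uniformly on the slit plane, `‖s + t‖` is at least a multiple of `1 + t`. -/
lemma exists_mul_one_add_le_norm_add {s₀ : ℂ} (hs₀ : s₀ ∈ Complex.slitPlane) :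
    ∃ ε > 0, ∃ δ > 0, ball s₀ ε ⊆ Complex.slitPlane ∧
      ∀ s ∈ ball s₀ ε, ∀ t : ℝ, 0 ≤ t → δ * (1 + t) ≤ ‖s + t‖ := by
  obtain ⟨η, hη, hsub⟩ := Metric.isOpen_iff.1 Complex.isOpen_slitPlane s₀ hs₀
  set ρ := η / 2 with hρ
  set M := ‖s₀‖ + ρ with hM
  have hρ0 : 0 < ρ := by positivity
  have hM0 : 0 < M := by positivity
  refine ⟨ρ, hρ0, min (1 / 2) (ρ / (2 * M + 2)), by positivity,
    (ball_subset_ball (by linarith)).trans hsub, fun s hs t ht => ?_⟩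
  -- Otherwise -t would lie within 2ρ = η of s₀, hence in the slit plane, which is impossible for t
  -- ≥ 0.
  have h1 : ρ ≤ ‖s + t‖ := by
    by_contra! h
    have h2 : (-(t : ℂ)) ∈ Complex.slitPlane := by
      refine hsub ?_
      have h3 : dist (-(t : ℂ)) s = ‖s + t‖ := by
        rw [dist_eq_norm, ← norm_neg]; congr 1; ring
      have h4 := dist_triangle (-(t : ℂ)) s s₀
      rw [mem_ball] at hs ⊢
      linarith
    rw [Complex.mem_slitPlane_iff] at h2
    simp at h2
    linarith
  have h2 : t - M ≤ ‖s + t‖ := by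
    have h3 : ‖s‖ ≤ M := by
      have := norm_le_norm_add_norm_sub' s s₀
      rw [mem_ball, dist_eq_norm] at hs
      linarith
    have h4 := norm_sub_le (s + t) s
    rw [add_sub_cancel_left, Complex.norm_real, Real.norm_eq_abs, abs_of_nonneg ht] at h4
    linarith
  -- From t ≥ 2M + 1 on, t - M is at least (1 + t)/2; for smaller t the lower bound ρ suffices.
  rcases le_total (2 * M + 1) t with h | h
  · have : min (1 / 2) (ρ / (2 * M + 2)) * (1 + t) ≤ 1 / 2 * (1 + t) := by
      gcongr; exact min_le_left _ _
    linarith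
  · have h5 : min (1 / 2) (ρ / (2 * M + 2)) * (1 + t) ≤ ρ / (2 * M + 2) * (2 * M + 2) := by
      refine mul_le_mul (min_le_right _ _) (by linarith) (by linarith) (by positivity)
    rw [div_mul_cancel₀ _ (by positivity)] at h5
    linarith

/-- The integral `∫_D t^{α-1} (s + t)^{-r} dt`. -/
noncomputable def betaKernel (D : Set ℝ) (α r : ℝ) (s : ℂ) : ℂ :=
  ∫ t in D, ((t ^ (α - 1) : ℝ) : ℂ) * (s + t) ^ ((-r : ℝ) : ℂ)

lemma norm_betaKernel_integrand_le {α r δ t : ℝ} {s : ℂ} (hr : 0 ≤ r) (hδ : 0 < δ) (ht : 0 < t)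
    (h : δ * (1 + t) ≤ ‖s + t‖) :
    ‖((t ^ (α - 1) : ℝ) : ℂ) * (s + t) ^ ((-r : ℝ) : ℂ)‖ ≤
      δ ^ (-r) * (t ^ (α - 1) * (1 + t) ^ (-r)) := by
  rw [norm_mul, Complex.norm_real, Real.norm_eq_abs, abs_of_pos (by positivity),
    Complex.norm_cpow_real]
  have : ‖s + t‖ ^ (-r) ≤ δ ^ (-r) * (1 + t) ^ (-r) := by
    rw [← Real.mul_rpow (by positivity) (by positivity)]
    exact Real.rpow_le_rpow_of_nonpos (by positivity) h (by linarith)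
  calc _ ≤ t ^ (α - 1) * (δ ^ (-r) * (1 + t) ^ (-r)) := by gcongr
    _ = _ := by ring

lemma continuousOn_betaKernel_integrand (α r : ℝ) {D : Set ℝ} (hD : D ⊆ Ioi 0) {s : ℂ}
    (hs : ∀ t ∈ D, s + (t : ℂ) ∈ Complex.slitPlane) :
    ContinuousOn (fun t : ℝ => ((t ^ (α - 1) : ℝ) : ℂ) * (s + t) ^ ((-r : ℝ) : ℂ)) D := by
  refine ((continuousOn_ofReal_rpow _).mono hD).mul ?_
  exact ContinuousOn.cpow_const (by fun_prop) hs

lemma integrableOn_betaKernel {D : Set ℝ} (hDm : MeasurableSet D) (hD : D ⊆ Ioi 0) {α r : ℝ}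
    (hr : 0 ≤ r) (hi : IntegrableOn (fun t : ℝ => t ^ (α - 1) * (1 + t) ^ (-r)) D) {s : ℂ}
    (hs : s ∈ Complex.slitPlane) :
    IntegrableOn (fun t : ℝ => ((t ^ (α - 1) : ℝ) : ℂ) * (s + t) ^ ((-r : ℝ) : ℂ)) D := by
  obtain ⟨ε, hε, δ, hδ, -, h⟩ := exists_mul_one_add_le_norm_add hs
  refine Integrable.mono' (hi.const_mul (δ ^ (-r))) ((continuousOn_betaKernel_integrand α r hD
    fun t ht => add_ofReal_mem_slitPlane hs (le_of_lt (hD ht))).aestronglyMeasurable hDm) ?_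
  filter_upwards [ae_restrict_mem hDm] with t ht
  exact norm_betaKernel_integrand_le hr hδ (hD ht) (h s (mem_ball_self hε) t (le_of_lt (hD ht)))

lemma hasDerivAt_betaKernel {D : Set ℝ} (hDm : MeasurableSet D) (hD : D ⊆ Ioi 0) {α r : ℝ}
    (hr : 0 ≤ r) (hi : IntegrableOn (fun t : ℝ => t ^ (α - 1) * (1 + t) ^ (-r)) D) {s : ℂ}
    (hs : s ∈ Complex.slitPlane) :
    HasDerivAt (betaKernel D α r) (-r * betaKernel D α (r + 1) s) s := by
  have hder : ∀ t ∈ D, ∀ s ∈ Complex.slitPlane, HasDerivAt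
      (fun s : ℂ => ((t ^ (α - 1) : ℝ) : ℂ) * (s + t) ^ ((-r : ℝ) : ℂ))
      (-r * (((t ^ (α - 1) : ℝ) : ℂ) * (s + t) ^ ((-(r + 1) : ℝ) : ℂ))) s := by
    intro t ht s hs
    have h1 := (((hasDerivAt_id s).add_const (t : ℂ)).cpow_const (c := ((-r : ℝ) : ℂ))
      (add_ofReal_mem_slitPlane hs (le_of_lt (hD ht)))).const_mul ((t ^ (α - 1) : ℝ) : ℂ)
    refine h1.congr_deriv ?_
    have : ((-(r + 1) : ℝ) : ℂ) = ((-r : ℝ) : ℂ) - 1 := by push_cast; ring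
    rw [this]
    simp only [id]
    push_cast; ring
  have key := hasDerivAt_integral_of_dominated (μ := volume.restrict D) Complex.isOpen_slitPlane
    (Φ := fun (s : ℂ) (t : ℝ) => ((t ^ (α - 1) : ℝ) : ℂ) * (s + t) ^ ((-r : ℝ) : ℂ))
    (fun s hs => (integrableOn_betaKernel hDm hD hr hi hs).aestronglyMeasurable) ?_ ?_ s hs
  · refine key.congr_deriv ?_
    rw [betaKernel, ← integral_const_mul]
    refine setIntegral_congr_fun hDm fun t ht => ?_
    exact (hder t ht s hs).deriv
  · filter_upwards [ae_restrict_mem hDm] with t ht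
    exact fun s hs => (hder t ht s hs).differentiableAt.differentiableWithinAt
  · intro s₀ hs₀
    obtain ⟨ε, hε, δ, hδ, -, h⟩ := exists_mul_one_add_le_norm_add hs₀
    refine ⟨ε, hε, _, hi.const_mul (δ ^ (-r)), ?_⟩
    filter_upwards [ae_restrict_mem hDm] with t ht s' hs'
    exact norm_betaKernel_integrand_le hr hδ (hD ht) (h s' hs'.1 t (le_of_lt (hD ht)))

lemma hasDerivAt_rpow_mul_cpow (α r : ℝ) {s : ℂ} (hs : s ∈ Complex.slitPlane) {t : ℝ}
    (ht : 0 < t) :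
    HasDerivAt (fun t : ℝ => ((t ^ α : ℝ) : ℂ) * (s + t) ^ ((-r : ℝ) : ℂ))
      ((α - r) * (((t ^ (α - 1) : ℝ) : ℂ) * (s + t) ^ ((-r : ℝ) : ℂ)) +
        r * s * (((t ^ (α - 1) : ℝ) : ℂ) * (s + t) ^ ((-(r + 1) : ℝ) : ℂ))) t := by
  have hst := add_ofReal_mem_slitPlane hs ht.le
  have h1 : HasDerivAt (fun t : ℝ => ((t ^ α : ℝ) : ℂ)) ((α * t ^ (α - 1) : ℝ) : ℂ) t :=
    (Real.hasDerivAt_rpow_const (Or.inl ht.ne')).ofReal_comp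
  have h2 : HasDerivAt (fun t : ℝ => (s + t) ^ ((-r : ℝ) : ℂ))
      (((-r : ℝ) : ℂ) * (s + t) ^ (((-r : ℝ) : ℂ) - 1) * 1) t := by
    have h3 : HasDerivAt (fun t : ℝ => s + (t : ℂ)) 1 t :=
      (Complex.ofRealCLM.hasDerivAt (x := t)).const_add s
    have h4 := HasDerivAt.cpow_const (c := ((-r : ℝ) : ℂ)) (hasDerivAt_id (s + (t : ℂ))) hst
    have h5 := HasDerivAt.comp t h4 h3
    simp only [id, mul_one] at h5 ⊢
    exact h5
  refine (h1.mul h2).congr_deriv ?_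
  have e1 : ((-(r + 1) : ℝ) : ℂ) = ((-r : ℝ) : ℂ) - 1 := by push_cast; ring
  have hne : s + (t : ℂ) ≠ 0 := Complex.slitPlane_ne_zero hst
  have e2 : (s + t) ^ ((-r : ℝ) : ℂ) = (s + t) ^ (((-r : ℝ) : ℂ) - 1) * (s + t) := by
    rw [Complex.cpow_sub _ _ hne, Complex.cpow_one, div_mul_cancel₀ _ hne]
  have e3 : t ^ α = t ^ (α - 1) * t := by
    rw [Real.rpow_sub_one ht.ne', div_mul_cancel₀ _ ht.ne']
  rw [e1, e2, e3]
  push_cast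
  ring

lemma integrableOn_rpow_mul_one_add_Ioc {α : ℝ} (hα : 0 < α) {r : ℝ} (hr : 0 ≤ r) :
    IntegrableOn (fun t : ℝ => t ^ (α - 1) * (1 + t) ^ (-r)) (Ioc 0 1) := by
  have h1 : IntegrableOn (fun t : ℝ => t ^ (α - 1)) (Ioc 0 1) := by
    have := intervalIntegral.intervalIntegrable_rpow' (a := 0) (b := 1)
      (by linarith : -1 < α - 1)
    rwa [intervalIntegrable_iff_integrableOn_Ioc_of_le zero_le_one] at this
  refine Integrable.mono' h1 ?_ ?_
  · refine ContinuousOn.aestronglyMeasurable ?_ measurableSet_Ioc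
    intro t ht
    have h0 : (0 : ℝ) < t := ht.1
    exact ((Real.continuousAt_rpow_const t _ (Or.inl h0.ne')).mul
      (ContinuousAt.rpow_const (by fun_prop) (Or.inl (by positivity)))).continuousWithinAt
  · filter_upwards [ae_restrict_mem measurableSet_Ioc] with t ht
    have h0 : (0 : ℝ) < t := ht.1
    rw [Real.norm_eq_abs, abs_of_pos (by positivity)]
    exact mul_le_of_le_one_right (by positivity)
      (Real.rpow_le_one_of_one_le_of_nonpos (by linarith) (by linarith))

lemma integrableOn_rpow_mul_one_add_Ioi {α r : ℝ} (hα : 0 < α) (hr : α < r) :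
    IntegrableOn (fun t : ℝ => t ^ (α - 1) * (1 + t) ^ (-r)) (Ioi 0) := by
  rw [← Ioc_union_Ioi_eq_Ioi zero_le_one]
  refine (integrableOn_rpow_mul_one_add_Ioc hα (by linarith)).union ?_
  have h1 := integrableOn_Ioi_rpow_of_lt (a := α - 1 - r) (by linarith) one_pos
  refine Integrable.mono' h1 ?_ ?_
  · refine ContinuousOn.aestronglyMeasurable ?_ measurableSet_Ioi
    intro t ht
    have h0 : (0 : ℝ) < t := lt_trans one_pos ht
    exact ((Real.continuousAt_rpow_const t _ (Or.inl h0.ne')).mul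
      (ContinuousAt.rpow_const (by fun_prop) (Or.inl (by positivity)))).continuousWithinAt
  · filter_upwards [ae_restrict_mem measurableSet_Ioi] with t ht
    have h0 : (0 : ℝ) < t := lt_trans one_pos ht
    rw [Real.norm_eq_abs, abs_of_pos (by positivity), sub_eq_add_neg _ r, Real.rpow_add h0]
    gcongr ?_ * ?_
    exact Real.rpow_le_rpow_of_nonpos h0 (by linarith) (by linarith)

lemma continuousOn_rpow_mul_cpow {α : ℝ} (hα : 0 < α) (r : ℝ) {s : ℂ}
    (hs : s ∈ Complex.slitPlane) :
    ContinuousOn (fun t : ℝ => ((t ^ α : ℝ) : ℂ) * (s + t) ^ ((-r : ℝ) : ℂ)) (Ici 0) := by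
  refine ContinuousOn.mul ?_ (ContinuousOn.cpow_const (by fun_prop)
    fun t ht => add_ofReal_mem_slitPlane hs ht)
  exact (Complex.continuous_ofReal.comp (Real.continuous_rpow_const hα.le)).continuousOn

/-- Integrate the derivative of t^α (s+t)^{-r} over [0, 1]; only t = 1 contributes, as α > 0. This
relation between r and r + 1 drives the inductions that isolate the singularity at s = 0. -/
lemma betaKernel_Ioc_rec {α r : ℝ} (hα : 0 < α) (hr : 0 ≤ r) {s : ℂ}
    (hs : s ∈ Complex.slitPlane) :
    (α - r) * betaKernel (Ioc 0 1) α r s + r * s * betaKernel (Ioc 0 1) α (r + 1) s =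
      (s + 1) ^ ((-r : ℝ) : ℂ) := by
  have hsub : Ioc (0 : ℝ) 1 ⊆ Ioi 0 := fun t ht => ht.1
  have i1 := integrableOn_betaKernel measurableSet_Ioc hsub hr
    (integrableOn_rpow_mul_one_add_Ioc hα hr) hs
  have i2 := integrableOn_betaKernel measurableSet_Ioc hsub (by linarith : 0 ≤ r + 1)
    (integrableOn_rpow_mul_one_add_Ioc hα (by linarith)) hs
  have h := intervalIntegral.integral_eq_sub_of_hasDerivAt_of_le zero_le_one
    ((continuousOn_rpow_mul_cpow hα r hs).mono fun t ht => ht.1)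
    (fun t ht => hasDerivAt_rpow_mul_cpow α r hs ht.1)
    (by
      rw [intervalIntegrable_iff_integrableOn_Ioc_of_le zero_le_one]
      exact (i1.const_mul _).add (i2.const_mul _))
  rw [intervalIntegral.integral_of_le zero_le_one, integral_add (i1.const_mul _) (i2.const_mul _),
    integral_const_mul, integral_const_mul] at h
  rw [betaKernel, betaKernel, h]
  simp [Real.zero_rpow hα.ne']

/-- The same integration by parts, where the boundary term at infinity vanishes because α < r. -/
lemma betaKernel_Ioi_rec {α r : ℝ} (hα : 0 < α) (hr : α < r) {s : ℂ}
    (hs : s ∈ Complex.slitPlane) :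
    (α - r) * betaKernel (Ioi 0) α r s + r * s * betaKernel (Ioi 0) α (r + 1) s = 0 := by
  have i1 := integrableOn_betaKernel measurableSet_Ioi subset_rfl (by linarith : 0 ≤ r)
    (integrableOn_rpow_mul_one_add_Ioi hα hr) hs
  have i2 := integrableOn_betaKernel measurableSet_Ioi subset_rfl (by linarith : 0 ≤ r + 1)
    (integrableOn_rpow_mul_one_add_Ioi hα (by linarith)) hs
  have hlim : Tendsto (fun t : ℝ => ((t ^ α : ℝ) : ℂ) * (s + t) ^ ((-r : ℝ) : ℂ)) atTop (𝓝 0) := by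
    obtain ⟨ε, hε, δ, hδ, -, h⟩ := exists_mul_one_add_le_norm_add hs
    have h0 : Tendsto (fun t : ℝ => δ ^ (-r) * t ^ (-(r - α))) atTop (𝓝 0) := by
      simpa using (tendsto_rpow_neg_atTop (by linarith : 0 < r - α)).const_mul (δ ^ (-r))
    refine squeeze_zero_norm' ?_ h0
    filter_upwards [Ioi_mem_atTop 0] with t ht
    have ht0 : (0 : ℝ) < t := ht
    have h2 := h s (mem_ball_self hε) t ht0.le
    have h1 := norm_betaKernel_integrand_le (α := α + 1) (by linarith : 0 ≤ r) hδ ht0 h2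
    rw [add_sub_cancel_right] at h1
    refine h1.trans ?_
    have h3 : t ^ (-(r - α)) = t ^ α * t ^ (-r) := by rw [← Real.rpow_add ht0]; congr 1; ring
    rw [h3]
    gcongr ?_ * (?_ * ?_)
    exact Real.rpow_le_rpow_of_nonpos ht0 (by linarith) (by linarith)
  have h := integral_Ioi_of_hasDerivAt_of_tendsto
    (continuousOn_rpow_mul_cpow hα r hs 0 (by simp))
    (fun t ht => hasDerivAt_rpow_mul_cpow α r hs ht)
    ((i1.const_mul _).add (i2.const_mul _)) hlim
  rw [integral_add (i1.const_mul _) (i2.const_mul _), integral_const_mul, integral_const_mul] at h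
  rw [betaKernel, betaKernel, h]
  simp [Real.zero_rpow hα.ne']

lemma isPreconnected_slitPlane_inter_ball : IsPreconnected (Complex.slitPlane ∩ ball (0 : ℂ) 1) := by
  have h : StarConvex ℝ ((1 / 2 : ℝ) : ℂ) (Complex.slitPlane ∩ ball (0 : ℂ) 1) := by
    refine StarConvex.inter ?_ ((convex_ball _ _).starConvex (by
      rw [mem_ball_zero_iff, Complex.norm_real]; norm_num))
    exact Complex.starConvex_ofReal_slitPlane (by norm_num)
  refine (h.isPathConnected ⟨?_, ?_⟩).isConnected.isPreconnected
  · exact Complex.ofReal_mem_slitPlane.2 (by norm_num)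
  · rw [mem_ball_zero_iff, Complex.norm_real]; norm_num

/-- The full kernel is homogeneous of degree α - r: by the recursion, its product with s^{r-α} has
derivative zero on the connected slit plane. The constant is its value at s = 1, a positive beta
integral. -/
lemma betaKernel_Ioi_eq {α r : ℝ} (hα : 0 < α) (hr : α < r) :
    ∃ A : ℝ, 0 < A ∧ ∀ s ∈ Complex.slitPlane,
      betaKernel (Ioi 0) α r s = A * s ^ ((α - r : ℝ) : ℂ) := by
  have hi := integrableOn_rpow_mul_one_add_Ioi hα hr
  have hd : ∀ s ∈ Complex.slitPlane, HasDerivAt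
      (fun s => betaKernel (Ioi 0) α r s * s ^ ((r - α : ℝ) : ℂ)) 0 s := by
    intro s hs
    have h1 := hasDerivAt_betaKernel measurableSet_Ioi subset_rfl (by linarith : 0 ≤ r) hi hs
    have h2 := HasDerivAt.cpow_const (c := ((r - α : ℝ) : ℂ)) (hasDerivAt_id s) hs
    refine (h1.mul h2).congr_deriv ?_
    have h3 := betaKernel_Ioi_rec hα hr hs
    have hne := Complex.slitPlane_ne_zero hs
    have e2 : s ^ ((r - α : ℝ) : ℂ) = s ^ (((r - α : ℝ) : ℂ) - 1) * s := by
      rw [Complex.cpow_sub _ _ hne, Complex.cpow_one, div_mul_cancel₀ _ hne]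
    simp only [id]
    rw [e2]
    push_cast
    linear_combination (-s ^ ((r : ℂ) - α - 1)) * h3
  have hpre : IsPreconnected Complex.slitPlane :=
    (Complex.starConvex_one_slitPlane.isPathConnected
      Complex.one_mem_slitPlane).isConnected.isPreconnected
  refine ⟨∫ t in Ioi (0 : ℝ), t ^ (α - 1) * (1 + t) ^ (-r), ?_, fun s hs => ?_⟩
  · rw [setIntegral_pos_iff_support_of_nonneg_ae]
    · have : Function.support (fun t : ℝ => t ^ (α - 1) * (1 + t) ^ (-r)) ∩ Ioi 0 = Ioi 0 := by
        refine inter_eq_right.2 fun t ht => ?_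
        have h0 : (0 : ℝ) < t := ht
        exact (by positivity : 0 < t ^ (α - 1) * (1 + t) ^ (-r)).ne'
      rw [this]; simp
    · filter_upwards [ae_restrict_mem measurableSet_Ioi] with t ht
      have h0 : (0 : ℝ) < t := ht
      simp only [Pi.zero_apply]
      positivity
    · exact hi
  · have h1 := Complex.isOpen_slitPlane.is_const_of_deriv_eq_zero hpre
      (fun s hs => (hd s hs).differentiableAt.differentiableWithinAt)
      (fun s hs => (hd s hs).deriv) hs Complex.one_mem_slitPlane
    simp only [Complex.one_cpow, mul_one] at h1
    have h2 : betaKernel (Ioi 0) α r 1 =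
        ((∫ t in Ioi (0 : ℝ), t ^ (α - 1) * (1 + t) ^ (-r) : ℝ) : ℂ) := by
      rw [betaKernel, ← integral_complex_ofReal]
      refine setIntegral_congr_fun measurableSet_Ioi fun t ht => ?_
      have h0 : (0 : ℝ) < t := ht
      rw [Complex.ofReal_mul, Complex.ofReal_cpow (by positivity : 0 ≤ 1 + t)]
      push_cast; rfl
    rw [← h2, ← h1, mul_assoc, ← Complex.cpow_add _ _ (Complex.slitPlane_ne_zero hs)]
    have : ((r - α : ℝ) : ℂ) + ((α - r : ℝ) : ℂ) = 0 := by push_cast; ring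
    rw [this, Complex.cpow_zero, mul_one]

/-- For t > 1 and |s| < 1/2 the sum s + t has positive real part and modulus comparable with 1 + t,
so the tail has no singularity at s = 0. -/
lemma analyticAt_betaKernel_Ioi_one {α r : ℝ} (hα : 0 < α) (hr : α < r) :
    AnalyticAt ℂ (betaKernel (Ioi 1) α r) 0 := by
  have hi := (integrableOn_rpow_mul_one_add_Ioi hα hr).mono_set
    (Ioi_subset_Ioi (zero_le_one : (0 : ℝ) ≤ 1))
  have hsub : Ioi (1 : ℝ) ⊆ Ioi 0 := Ioi_subset_Ioi zero_le_one
  have hslit : ∀ s ∈ ball (0 : ℂ) (1 / 2), ∀ t ∈ Ioi (1 : ℝ), s + (t : ℂ) ∈ Complex.slitPlane := by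
    intro s hs t ht
    rw [mem_ball_zero_iff] at hs
    have h1 := abs_le.1 (Complex.abs_re_le_norm s)
    have h2 : (1 : ℝ) < t := ht
    refine Complex.mem_slitPlane_iff.2 (Or.inl ?_)
    simp only [Complex.add_re, Complex.ofReal_re]
    linarith
  have hlow : ∀ s ∈ ball (0 : ℂ) (1 / 2), ∀ t ∈ Ioi (1 : ℝ), 1 / 4 * (1 + t) ≤ ‖s + t‖ := by
    intro s hs t ht
    rw [mem_ball_zero_iff] at hs
    have h2 : (1 : ℝ) < t := ht
    have h4 := norm_sub_le (s + t) s
    rw [add_sub_cancel_left, Complex.norm_real, Real.norm_eq_abs, abs_of_nonneg (by linarith)] at h4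
    linarith
  have key := hasDerivAt_integral_of_dominated (μ := volume.restrict (Ioi (1 : ℝ)))
    (isOpen_ball (x := (0 : ℂ)) (ε := 1 / 2))
    (Φ := fun (s : ℂ) (t : ℝ) => ((t ^ (α - 1) : ℝ) : ℂ) * (s + t) ^ ((-r : ℝ) : ℂ))
    (fun s hs => (continuousOn_betaKernel_integrand α r hsub (hslit s hs)).aestronglyMeasurable
      measurableSet_Ioi) ?_ ?_
  · have hd : DifferentiableOn ℂ (betaKernel (Ioi 1) α r) (ball 0 (1 / 2)) :=
      fun s hs => (key s hs).differentiableAt.differentiableWithinAt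
    exact hd.analyticAt (ball_mem_nhds _ (by norm_num))
  · filter_upwards [ae_restrict_mem measurableSet_Ioi] with t ht
    refine DifferentiableOn.const_mul ?_ _
    exact DifferentiableOn.cpow_const (by fun_prop) fun s hs => hslit s hs t ht
  · intro s₀ hs₀
    refine ⟨1 / 2, by norm_num, _, hi.const_mul ((1 / 4) ^ (-r)), ?_⟩
    filter_upwards [ae_restrict_mem measurableSet_Ioi] with t ht s hs
    exact norm_betaKernel_integrand_le (by linarith) (by norm_num) (hsub ht) (hlow s hs.2 t ht)

lemma analyticAt_add_one_cpow (c : ℂ) : AnalyticAt ℂ (fun s : ℂ => (s + 1) ^ c) 0 :=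
  AnalyticAt.cpow (analyticAt_id.add analyticAt_const) analyticAt_const (by simp)

/-- Behaviour of `∫₀¹ t^{α-1} (s + t)^{-r} dt` at `s = 0` for non-integral `α - r`. -/
theorem betaKernel_expansion_of_nonint (n : ℕ) : ∀ α r : ℝ, 0 < α → 0 < r → α - r < n →
    (∀ k : ℤ, α - r ≠ k) → ∃ A : ℝ, A ≠ 0 ∧ ∃ a : ℂ → ℂ, AnalyticAt ℂ a 0 ∧
      ∀ᶠ s in 𝓝 (0 : ℂ), s ∈ Complex.slitPlane →
        betaKernel (Ioc 0 1) α r s = A * s ^ ((α - r : ℝ) : ℂ) + a s := by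
  induction n with
  | zero =>
    intro α r hα hr hlt _
    have hlt' : α < r := by simpa using hlt
    -- When α < r the integral up to infinity converges and is an exact power of s; subtracting the
    -- tail over (1, ∞) costs only an analytic function.
    obtain ⟨A, hA, h⟩ := betaKernel_Ioi_eq hα hlt'
    refine ⟨A, hA.ne', fun s => -betaKernel (Ioi 1) α r s,
      (analyticAt_betaKernel_Ioi_one hα hlt').neg, Eventually.of_forall fun s hs => ?_⟩
    have hi := integrableOn_betaKernel measurableSet_Ioi subset_rfl hr.le
      (integrableOn_rpow_mul_one_add_Ioi hα hlt') hs
    rw [← h s hs]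
    simp only [betaKernel]
    rw [← Ioc_union_Ioi_eq_Ioi (zero_le_one : (0 : ℝ) ≤ 1),
      setIntegral_union (Ioc_disjoint_Ioi le_rfl) measurableSet_Ioi
        (hi.mono_set fun t ht => ht.1) (hi.mono_set (Ioi_subset_Ioi zero_le_one))]
    ring
  | succ n ih =>
    intro α r hα hr hlt hk
    have hne : α - r ≠ 0 := by simpa using hk 0
    -- Passing to r + 1 lowers α - r by one. The recursion returns to r after division by α - r,
    -- which is non-zero because it is not an integer.
    obtain ⟨A, hA, a, ha, h⟩ := ih α (r + 1) hα (by linarith) (by push_cast at hlt; linarith)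
      (fun k hk' => hk (k + 1) (by push_cast; linarith))
    refine ⟨-r * A / (α - r), div_ne_zero (mul_ne_zero (neg_ne_zero.2 hr.ne') hA) hne,
      fun s => ((s + 1) ^ ((-r : ℝ) : ℂ) - r * s * a s) / ((α - r : ℝ) : ℂ), ?_, ?_⟩
    · exact ((analyticAt_add_one_cpow _).sub
        ((analyticAt_const.mul analyticAt_id).mul ha)).div_const
    · filter_upwards [h] with s hs hsl
      have h1 := betaKernel_Ioc_rec hα hr.le hsl
      rw [hs hsl] at h1
      have hne' : ((α - r : ℝ) : ℂ) ≠ 0 := by exact_mod_cast hne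
      have hne'' : (α : ℂ) - r ≠ 0 := by exact_mod_cast hne
      have e1 : s ^ ((α - r : ℝ) : ℂ) = s ^ ((α - (r + 1) : ℝ) : ℂ) * s := by
        have : ((α - (r + 1) : ℝ) : ℂ) = ((α - r : ℝ) : ℂ) - 1 := by push_cast; ring
        rw [this, Complex.cpow_sub _ _ (Complex.slitPlane_ne_zero hsl), Complex.cpow_one,
          div_mul_cancel₀ _ (Complex.slitPlane_ne_zero hsl)]
      rw [e1, ← h1]
      push_cast
      field_simp
      ring

/-- Behaviour of `∫₀¹ t^{α-1} (s + t)^{-r} dt` at `s = 0` for integral `α - r`. -/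
theorem betaKernel_expansion_of_int (n : ℕ) : ∀ α r : ℝ, 0 < α → 0 < r → α - r = n →
    ∃ A : ℝ, A ≠ 0 ∧ ∃ a : ℂ → ℂ, AnalyticAt ℂ a 0 ∧
      ∀ᶠ s in 𝓝 (0 : ℂ), s ∈ Complex.slitPlane →
        betaKernel (Ioc 0 1) α r s = A * (s ^ n * Complex.log s) + a s := by
  induction n with
  | zero =>
    intro α r hα hr heq
    have heq' : α = r := by simpa [sub_eq_zero] using heq
    subst heq'
    -- For α = r the recursion says that the kernel has derivative -φ(s)/s. Since φ(0) = 1, this is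
    -- -1/s minus the divided difference of φ at 0, which is holomorphic with primitive P. Hence
    -- kernel + log + P is constant on the slit disc; the base point 1/2 used below is arbitrary.
    set φ : ℂ → ℂ := fun s => (s + 1) ^ ((-α : ℝ) : ℂ) with hφ
    have hφd : DifferentiableOn ℂ φ (ball 0 1) := by
      refine DifferentiableOn.cpow_const (by fun_prop) fun s hs => ?_
      rw [mem_ball_zero_iff] at hs
      have h1 := abs_le.1 (Complex.abs_re_le_norm s)
      refine Complex.mem_slitPlane_iff.2 (Or.inl ?_)
      simp only [Complex.add_re, Complex.one_re]
      linarith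
    have hD : DifferentiableOn ℂ (dslope φ 0) (ball 0 1) :=
      (Complex.differentiableOn_dslope (ball_mem_nhds _ one_pos)).2 hφd
    obtain ⟨P, hP⟩ := hD.isExactOn_ball
    have hder : ∀ s ∈ Complex.slitPlane ∩ ball (0 : ℂ) 1, HasDerivAt
        (fun s => betaKernel (Ioc 0 1) α α s + Complex.log s + P s) 0 s := by
      intro s hs
      have h1 := hasDerivAt_betaKernel measurableSet_Ioc (fun t ht => ht.1) hα.le
        (integrableOn_rpow_mul_one_add_Ioc hα hα.le) hs.1
      refine ((h1.add (Complex.hasDerivAt_log hs.1)).add (hP s hs.2)).congr_deriv ?_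
      have hne := Complex.slitPlane_ne_zero hs.1
      have h2 := betaKernel_Ioc_rec hα hα.le hs.1
      rw [dslope_of_ne _ hne, slope_def_field]
      have h3 : φ s = α * s * betaKernel (Ioc 0 1) α (α + 1) s := by
        rw [hφ]; simp only; rw [← h2]; ring
      have h4 : φ 0 = 1 := by simp [hφ]
      rw [h3, h4]
      field_simp
      ring
    have hhalf : ((1 / 2 : ℝ) : ℂ) ∈ Complex.slitPlane ∩ ball (0 : ℂ) 1 := by
      refine ⟨Complex.ofReal_mem_slitPlane.2 (by norm_num), ?_⟩
      rw [mem_ball_zero_iff, Complex.norm_real]; norm_num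
    refine ⟨-1, by norm_num, fun s => (betaKernel (Ioc 0 1) α α ((1 / 2 : ℝ) : ℂ) +
      Complex.log ((1 / 2 : ℝ) : ℂ) + P ((1 / 2 : ℝ) : ℂ)) - P s, ?_, ?_⟩
    · refine analyticAt_const.sub ?_
      have : DifferentiableOn ℂ P (ball 0 1) :=
        fun s hs => (hP s hs).differentiableAt.differentiableWithinAt
      exact this.analyticAt (ball_mem_nhds _ one_pos)
    · filter_upwards [ball_mem_nhds (0 : ℂ) one_pos] with s hs hsl
      have := (Complex.isOpen_slitPlane.inter isOpen_ball).is_const_of_deriv_eq_zero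
        isPreconnected_slitPlane_inter_ball
        (fun s hs => (hder s hs).differentiableAt.differentiableWithinAt)
        (fun s hs => (hder s hs).deriv) ⟨hsl, hs⟩ hhalf
      rw [← this]
      push_cast
      ring
  | succ n ih =>
    intro α r hα hr heq
    have hne : α - r ≠ 0 := by rw [heq]; positivity
    obtain ⟨A, hA, a, ha, h⟩ := ih α (r + 1) hα (by linarith) (by push_cast at heq; linarith)
    refine ⟨-r * A / (α - r), div_ne_zero (mul_ne_zero (neg_ne_zero.2 hr.ne') hA) hne,
      fun s => ((s + 1) ^ ((-r : ℝ) : ℂ) - r * s * a s) / ((α - r : ℝ) : ℂ), ?_, ?_⟩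
    · exact ((analyticAt_add_one_cpow _).sub
        ((analyticAt_const.mul analyticAt_id).mul ha)).div_const
    · filter_upwards [h] with s hs hsl
      have h1 := betaKernel_Ioc_rec hα hr.le hsl
      rw [hs hsl] at h1
      have hne'' : (α : ℂ) - r ≠ 0 := by exact_mod_cast hne
      rw [← h1]
      push_cast
      field_simp
      ring

/-! ### Branches of powers and the inversion of a function -/

lemma mul_cpow_of_arg {x y : ℂ} (hx : x ≠ 0) (hy : y ≠ 0)
    (h : x.arg + y.arg ∈ Ioc (-Real.pi) Real.pi) (c : ℂ) : (x * y) ^ c = x ^ c * y ^ c := by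
  rw [Complex.cpow_def_of_ne_zero (mul_ne_zero hx hy), Complex.cpow_def_of_ne_zero hx,
    Complex.cpow_def_of_ne_zero hy, (Complex.log_mul_eq_add_log_iff hx hy).2 h, add_mul,
    Complex.exp_add]

lemma ofReal_mul_cpow {x : ℝ} (hx : 0 < x) {y : ℂ} (hy : y ≠ 0) (c : ℝ) :
    ((x : ℂ) * y) ^ (c : ℂ) = ((x ^ c : ℝ) : ℂ) * y ^ (c : ℂ) := by
  rw [mul_cpow_of_arg (by exact_mod_cast hx.ne') hy, Complex.ofReal_cpow hx.le]
  rw [Complex.arg_ofReal_of_nonneg hx.le, zero_add]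
  exact ⟨Complex.neg_pi_lt_arg y, Complex.arg_le_pi y⟩

lemma I_mul_cpow {v : ℂ} (hv : 0 < v.re) (c : ℂ) :
    (Complex.I * v) ^ c = Complex.I ^ c * v ^ c := by
  have hv0 : v ≠ 0 := by rintro rfl; simp at hv
  refine mul_cpow_of_arg Complex.I_ne_zero hv0 ?_ c
  have := abs_lt.1 (Complex.abs_arg_lt_pi_div_two_iff.2 (Or.inl hv))
  rw [Complex.arg_I]
  constructor <;> linarith [Real.pi_pos]

/-- `x v` with `x` real and `v` in the quadrant making `x v` lie in the upper half-plane. -/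
lemma real_mul_cpow {x : ℝ} (hx : x ≠ 0) {v : ℂ} (hv : 0 < v.re) (hxv : 0 < x * v.im) (c : ℂ) :
    ((x : ℂ) * v) ^ c = (x : ℂ) ^ c * v ^ c := by
  have hv0 : v ≠ 0 := by rintro rfl; simp at hv
  refine mul_cpow_of_arg (by exact_mod_cast hx) hv0 ?_ c
  have h1 := abs_lt.1 (Complex.abs_arg_lt_pi_div_two_iff.2 (Or.inl hv))
  rcases hx.lt_or_gt with h | h
  · rw [Complex.arg_ofReal_of_neg h]
    have h2 : v.im < 0 := by
      by_contra! h3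
      nlinarith
    have := Complex.arg_neg_iff.2 h2
    constructor <;> linarith
  · rw [Complex.arg_ofReal_of_nonneg h.le]
    constructor <;> linarith [Real.pi_pos]

/-- A power is monotone in one direction or the other, so it is bounded by one of its endpoint
values; taking their sum avoids any case distinction on the sign of p. -/
lemma rpow_le_rpow_add_rpow {a b u : ℝ} (ha : 0 < a) (h1 : a ≤ u) (h2 : u ≤ b) (p : ℝ) :
    u ^ p ≤ a ^ p + b ^ p := by
  have hu : 0 < u := ha.trans_le h1
  have hb : 0 < b := hu.trans_le h2
  rcases le_total 0 p with hp | hp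
  · have := Real.rpow_le_rpow hu.le h2 hp
    have := Real.rpow_nonneg ha.le p
    linarith
  · have := Real.rpow_le_rpow_of_nonpos ha h1 hp
    have := Real.rpow_nonneg hb.le p
    linarith

/-- The function `z ↦ z^{-r} h(-1/z)`. -/
noncomputable def inversion (r : ℝ) (h : ℂ → ℂ) (z : ℂ) : ℂ := z ^ ((-r : ℝ) : ℂ) * h (-1 / z)

lemma im_neg_one_div (z : ℂ) : (-1 / z).im = z.im / ‖z‖ ^ 2 := by
  rw [← Complex.normSq_eq_norm_sq, neg_div, one_div, Complex.neg_im, Complex.inv_im]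
  ring

lemma neg_one_div_mem_halfPlane {z : ℂ} (hz : z ∈ halfPlane) : -1 / z ∈ halfPlane := by
  have hz' : 0 < z.im := hz
  have hz0 : z ≠ 0 := by rintro rfl; simp at hz'
  rw [mem_ofPred_eq, im_neg_one_div]
  positivity

lemma halfPlane_subset_slitPlane : halfPlane ⊆ Complex.slitPlane := fun _ hz =>
  Complex.mem_slitPlane_iff.2 (Or.inr (ne_of_gt hz))

lemma differentiableOn_inversion {r : ℝ} {h : ℂ → ℂ} (hd : DifferentiableOn ℂ h halfPlane) :
    DifferentiableOn ℂ (inversion r h) halfPlane := by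
  refine DifferentiableOn.mul ?_ ?_
  · exact DifferentiableOn.cpow_const (by fun_prop) halfPlane_subset_slitPlane
  · refine hd.comp ?_ fun _ hz => neg_one_div_mem_halfPlane hz
    exact DifferentiableOn.div (by fun_prop) (by fun_prop)
      fun _ hz => Complex.slitPlane_ne_zero (halfPlane_subset_slitPlane hz)

lemma exists_norm_inversion_le {r s : ℝ} {h : ℂ → ℂ} (hb : DecayBound s h) :
    ∃ C c : ℝ, 0 < C ∧ 0 < c ∧ ∀ z ∈ halfPlane, ‖inversion r h z‖ ≤
      C * (‖z‖ ^ (2 * s - r) * z.im ^ (-s) * Real.exp (-c * (z.im / ‖z‖ ^ 2))) := by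
  obtain ⟨C, c, hC, hc, hb⟩ := hb
  refine ⟨C, c, hC, hc, fun z hz => ?_⟩
  have hz' : 0 < z.im := hz
  have hz0 : z ≠ 0 := by rintro rfl; simp at hz'
  have hn : 0 < ‖z‖ := norm_pos_iff.2 hz0
  have h1 := hb (-1 / z) (neg_one_div_mem_halfPlane hz)
  rw [im_neg_one_div] at h1
  rw [inversion, norm_mul, Complex.norm_cpow_real]
  calc ‖z‖ ^ (-r) * ‖h (-1 / z)‖
      ≤ ‖z‖ ^ (-r) * (C * ((z.im / ‖z‖ ^ 2) ^ (-s) * Real.exp (-c * (z.im / ‖z‖ ^ 2)))) := by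
        gcongr
    _ = _ := by
        have : (z.im / ‖z‖ ^ 2) ^ (-s) = z.im ^ (-s) * ‖z‖ ^ (2 * s) := by
          rw [Real.div_rpow hz'.le (by positivity), ← Real.rpow_natCast, ← Real.rpow_mul hn.le,
            div_eq_mul_inv, ← Real.rpow_neg hn.le]
          congr 2
          push_cast; ring
        rw [this, sub_eq_add_neg, Real.rpow_add hn]
        ring

/-! ### Contour deformation through a primitive -/

/-- Integrability of F' up to 0 forces F to have a limit there. This supplies boundary values, along
paths ending on the real axis, for a primitive known only inside the half-plane. -/
lemma tendsto_nhdsGT_of_hasDerivAt {F F' : ℝ → ℂ} (hd : ∀ t ∈ Ioc (0 : ℝ) 1, HasDerivAt F (F' t) t)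
    (hi : IntegrableOn F' (Ioc 0 1)) :
    Tendsto F (𝓝[>] 0) (𝓝 (F 1 - ∫ t in Ioc (0 : ℝ) 1, F' t)) := by
  have h1 : IntegrableOn F' (uIcc 0 1) := by
    rw [uIcc_of_le zero_le_one, integrableOn_Icc_iff_integrableOn_Ioc]
    exact hi
  have h2 := intervalIntegral.continuousOn_primitive_interval_left h1 0 left_mem_uIcc
  rw [uIcc_of_le zero_le_one, ContinuousWithinAt, intervalIntegral.integral_of_le zero_le_one] at h2
  have h3 : Tendsto (fun x => F 1 - ∫ t in x..1, F' t) (𝓝[>] 0)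
      (𝓝 (F 1 - ∫ t in Ioc (0 : ℝ) 1, F' t)) := by
    have h4 := h2.mono_left (nhdsWithin_mono 0 Ioc_subset_Icc_self)
    rw [nhdsWithin_Ioc_eq_nhdsGT one_pos] at h4
    exact h4.const_sub _
  refine h3.congr' ?_
  filter_upwards [Ioc_mem_nhdsGT one_pos] with x hx
  rw [intervalIntegral.integral_eq_sub_of_hasDerivAt]
  · ring
  · intro t ht
    rw [uIcc_of_le hx.2] at ht
    exact hd t ⟨hx.1.trans_le ht.1, ht.2⟩
  · rw [intervalIntegrable_iff_integrableOn_Ioc_of_le hx.2]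
    exact hi.mono_set (Ioc_subset_Ioc_left hx.1.le)

lemma integral_Ioi_of_hasDerivAt_of_tendsto_both {F F' : ℝ → ℂ} {l m : ℂ}
    (hd : ∀ t ∈ Ioi (0 : ℝ), HasDerivAt F (F' t) t) (hi : IntegrableOn F' (Ioi 0))
    (hl : Tendsto F (𝓝[>] 0) (𝓝 l)) (hm : Tendsto F atTop (𝓝 m)) :
    ∫ t in Ioi (0 : ℝ), F' t = m - l := by
  have h1 := tendsto_nhdsGT_of_hasDerivAt (fun t ht => hd t ht.1) (hi.mono_set fun t ht => ht.1)
  have h2 := tendsto_nhds_unique hl h1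
  have h3 := integral_Ioi_of_hasDerivAt_of_tendsto' (a := (1 : ℝ))
    (fun t ht => hd t (mem_Ioi.2 (lt_of_lt_of_le one_pos (mem_Ici.1 ht))))
    (hi.mono_set (Ioi_subset_Ioi zero_le_one)) hm
  rw [← Ioc_union_Ioi_eq_Ioi (zero_le_one : (0 : ℝ) ≤ 1),
    setIntegral_union (Ioc_disjoint_Ioi le_rfl) measurableSet_Ioi
      (hi.mono_set fun t ht => ht.1) (hi.mono_set (Ioi_subset_Ioi zero_le_one)), h3, h2]
  ring

/-- A primitive varies little along a short horizontal segment. -/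
lemma norm_sub_le_of_horizontal {G φ : ℂ → ℂ} (hG : ∀ z ∈ halfPlane, HasDerivAt G (φ z) z)
    {x ξ η M : ℝ} (hη : 0 < η)
    (hM : ∀ z : ℂ, z.im = η → |z.re - x| ≤ |ξ - x| → ‖φ z‖ ≤ M) :
    ‖G (ξ + η * Complex.I) - G (x + η * Complex.I)‖ ≤ M * |ξ - x| := by
  have hconv : Convex ℝ ({z : ℂ | z.im = η} ∩ {z : ℂ | |z.re - x| ≤ |ξ - x|}) := by
    refine (convex_hyperplane Complex.imLm.isLinear η).inter ?_
    have h1 : Convex ℝ (closedBall x |ξ - x|) := convex_closedBall _ _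
    exact h1.linear_preimage Complex.reLm
  have h2 := hconv.norm_image_sub_le_of_norm_hasDerivWithin_le (f := G) (f' := φ) (C := M)
    (x := x + η * Complex.I) (y := ξ + η * Complex.I)
    (fun z hz => (hG z (by
      have hz' : z.im = η := hz.1
      rw [mem_ofPred_eq, hz']; exact hη)).hasDerivWithinAt)
    (fun z hz => hM z hz.1 hz.2) (by simp) (by simp)
  refine h2.trans (le_of_eq ?_)
  rw [add_sub_add_right_eq_sub, ← Complex.ofReal_sub, Complex.norm_real, Real.norm_eq_abs]

/-- The integrand `(z - x)^{α-1} z^{-r} h(-1/z)`. -/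
noncomputable def contourIntegrand (r α : ℝ) (h : ℂ → ℂ) (x : ℝ) (z : ℂ) : ℂ :=
  (z - x) ^ ((α - 1 : ℝ) : ℂ) * inversion r h z

lemma sub_ofReal_mem_slitPlane {z : ℂ} (hz : z ∈ halfPlane) (x : ℝ) :
    z - x ∈ Complex.slitPlane := by
  refine halfPlane_subset_slitPlane ?_
  have : 0 < z.im := hz
  simpa using this

lemma differentiableOn_contourIntegrand {r α x : ℝ} {h : ℂ → ℂ}
    (hd : DifferentiableOn ℂ h halfPlane) :
    DifferentiableOn ℂ (contourIntegrand r α h x) halfPlane :=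
  (DifferentiableOn.cpow_const (by fun_prop) fun _ hz => sub_ofReal_mem_slitPlane hz x).mul
    (differentiableOn_inversion hd)

lemma neg_one_div_vert {y t : ℝ} (ht : 0 < t) :
    -1 / ((y : ℂ) + t * Complex.I) =
      ((-y / (y ^ 2 + t ^ 2) : ℝ) : ℂ) + ((t / (y ^ 2 + t ^ 2) : ℝ) : ℂ) * Complex.I := by
  have h1 : (y : ℂ) + t * Complex.I ≠ 0 :=
    Complex.slitPlane_ne_zero (halfPlane_subset_slitPlane (vert_mem_halfPlane y ht))
  have h2 : ((y : ℂ) ^ 2 + (t : ℂ) ^ 2) ≠ 0 := by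
    have : y ^ 2 + t ^ 2 ≠ 0 := by positivity
    exact_mod_cast this
  push_cast
  field_simp
  linear_combination (-(t : ℂ) ^ 2) * Complex.I_sq

/-- The inverted path reaches x along a semicircle tangent to the vertical. At height η its
horizontal distance from the line above x is at most η, and there the integrand is O(η^{α-1-s}); the
two values of G therefore differ by O(η^{α-s}), which tends to 0 as s < α. -/
lemma tendsto_primitive_at_real {r α s x : ℝ} {h G : ℂ → ℂ} (hb : DecayBound s h)
    (hα : s < α) (hx : x ≠ 0)
    (hG : ∀ z ∈ halfPlane, HasDerivAt G (contourIntegrand r α h x z) z) :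
    Tendsto (fun t : ℝ => G (-1 / (((-1 / x : ℝ) : ℂ) + t * Complex.I)) -
      G (x + ((t / ((-1 / x) ^ 2 + t ^ 2) : ℝ) : ℂ) * Complex.I)) (𝓝[>] 0) (𝓝 0) := by
  obtain ⟨C, c, hC, hc, hH⟩ := exists_norm_inversion_le (r := r) hb
  set y : ℝ := -1 / x with hy
  have hy0 : y ≠ 0 := div_ne_zero (by norm_num) hx
  have hxy : x = -1 / y := by rw [hy]; field_simp
  set Y := |y| with hY
  have hY0 : 0 < Y := abs_pos.2 hy0
  have hY2 : y ^ 2 = Y ^ 2 := (sq_abs y).symm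
  have hxY : |x| = 1 / Y := by rw [hxy, abs_div, abs_neg, abs_one]
  set p := 2 * s - r
  set K := C * ((1 / (2 * Y)) ^ p + (2 / Y) ^ p) * (1 + 2 ^ (α - 1)) with hK
  have hK0 : 0 < K := by positivity
  have hlim : Tendsto (fun t : ℝ => K * (t / (y ^ 2 + t ^ 2)) ^ (α - s)) (𝓝[>] 0) (𝓝 0) := by
    have h1 : ContinuousAt (fun t : ℝ => K * (t / (y ^ 2 + t ^ 2)) ^ (α - s)) 0 := by
      refine continuousAt_const.mul (ContinuousAt.rpow_const ?_ (Or.inr (by linarith)))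
      refine ContinuousAt.div (by fun_prop) (by fun_prop) ?_
      positivity
    have h2 := h1.tendsto
    simp only [zero_div, Real.zero_rpow (by linarith : α - s ≠ 0), mul_zero] at h2
    exact h2.mono_left nhdsWithin_le_nhds
  refine squeeze_zero_norm' ?_ hlim
  filter_upwards [Ioc_mem_nhdsGT hY0] with t ht
  have ht0 : 0 < t := ht.1
  have htY : t ≤ Y := ht.2
  set D := y ^ 2 + t ^ 2 with hD
  have hDY : D = Y ^ 2 + t ^ 2 := by rw [hD, hY2]
  have hD0 : 0 < D := by positivity
  set η := t / D with hη
  have hη0 : 0 < η := by positivity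
  rw [neg_one_div_vert ht0]
  have hd : |(-y / D) - x| = t ^ 2 / (Y * D) := by
    have : -y / D - x = t ^ 2 / (y * D) := by
      rw [hxy]; field_simp; rw [hD]; ring
    rw [this, abs_div, abs_mul, abs_of_pos hD0, abs_of_pos (by positivity : 0 < t ^ 2)]
  have hd1 : t ^ 2 / (Y * D) ≤ η := by
    rw [hη, div_le_div_iff₀ (by positivity) hD0]
    have : 0 < t * D := by positivity
    nlinarith
  have hd2 : t ^ 2 / (Y * D) ≤ 1 / (2 * Y) := by
    rw [div_le_div_iff₀ (by positivity) (by positivity), hDY]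
    nlinarith [mul_nonneg hY0.le (mul_nonneg (sub_nonneg.2 htY) (add_pos hY0 ht0).le)]
  have hη2 : η ≤ 1 / (2 * Y) := by
    rw [hη, div_le_div_iff₀ hD0 (by positivity), hDY]
    nlinarith [sq_nonneg (Y - t)]
  have hhalf : 1 / Y = 1 / (2 * Y) + 1 / (2 * Y) := by field_simp; norm_num
  have h2Y : 2 / Y = 4 * (1 / (2 * Y)) := by field_simp; norm_num
  have key := norm_sub_le_of_horizontal hG (x := x) (ξ := -y / D) (η := η)
    (M := K * η ^ (α - 1 - s)) hη0 (fun z hz1 hz2 => by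
      rw [hd] at hz2
      have hzH : z ∈ halfPlane := by rw [mem_ofPred_eq, hz1]; exact hη0
      have e1 : |x| - |z.re - x| ≤ |z.re| := by
        have := abs_sub_abs_le_abs_sub x (x - z.re)
        rw [sub_sub_cancel, abs_sub_comm x z.re] at this
        exact this
      have e2 : |z.re| ≤ |x| + |z.re - x| := by
        have := abs_add_le x (z.re - x); rwa [add_sub_cancel] at this
      have n1 : 1 / (2 * Y) ≤ ‖z‖ := by
        have := Complex.abs_re_le_norm z; rw [hxY] at e1; linarith
      have n2 : ‖z‖ ≤ 2 / Y := by
        have := Complex.norm_le_abs_re_add_abs_im z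
        rw [hz1, abs_of_pos hη0] at this
        rw [hxY] at e2; linarith
      have n3 : η ≤ ‖z - x‖ := by
        have := Complex.abs_im_le_norm (z - x)
        rw [Complex.sub_im, Complex.ofReal_im, sub_zero, hz1, abs_of_pos hη0] at this
        exact this
      have n4 : ‖z - x‖ ≤ 2 * η := by
        have := Complex.norm_le_abs_re_add_abs_im (z - x)
        rw [Complex.sub_im, Complex.ofReal_im, sub_zero, hz1, abs_of_pos hη0, Complex.sub_re,
          Complex.ofReal_re] at this
        linarith
      rw [contourIntegrand, norm_mul, Complex.norm_cpow_real]
      have b1 := rpow_le_rpow_add_rpow hη0 n3 n4 (α - 1)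
      have b2 := rpow_le_rpow_add_rpow (by positivity) n1 n2 p
      have b3 := hH z hzH
      rw [hz1] at b3
      have b4 : Real.exp (-c * (η / ‖z‖ ^ 2)) ≤ 1 := by
        rw [Real.exp_le_one_iff]
        have : 0 ≤ η / ‖z‖ ^ 2 := by positivity
        nlinarith
      calc ‖z - x‖ ^ (α - 1) * ‖inversion r h z‖
          ≤ (η ^ (α - 1) + (2 * η) ^ (α - 1)) *
            (C * (((1 / (2 * Y)) ^ p + (2 / Y) ^ p) * η ^ (-s) * 1)) := by
            refine mul_le_mul b1 (b3.trans ?_) (norm_nonneg _) (by positivity)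
            gcongr
        _ = K * η ^ (α - 1 - s) := by
            rw [Real.mul_rpow (by norm_num) hη0.le, sub_eq_add_neg (α - 1) s, Real.rpow_add hη0,
              hK]
            ring)
  refine key.trans ?_
  rw [hd]
  calc K * η ^ (α - 1 - s) * (t ^ 2 / (Y * D)) ≤ K * η ^ (α - 1 - s) * η := by gcongr
    _ = K * η ^ (α - s) := by
      rw [mul_assoc, ← Real.rpow_add_one hη0.ne']
      congr 2; ring

/-- At its other end the semicircle meets 0 vertically and is compared with the imaginary axis.
Between the two at height η, h(-1/z) is exponentially small in 1/η and beats every power, so the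
integrand stays bounded while the distance is at most η. -/
lemma tendsto_primitive_at_zero {r α s x : ℝ} {h G : ℂ → ℂ} (hb : DecayBound s h)
    (hx : x ≠ 0) (hG : ∀ z ∈ halfPlane, HasDerivAt G (contourIntegrand r α h x z) z) :
    Tendsto (fun t : ℝ => G (-1 / (((-1 / x : ℝ) : ℂ) + t * Complex.I)) -
      G (((t / ((-1 / x) ^ 2 + t ^ 2) : ℝ) : ℂ) * Complex.I)) atTop (𝓝 0) := by
  obtain ⟨C, c, hC, hc, hH⟩ := exists_norm_inversion_le (r := r) hb
  set y : ℝ := -1 / x with hy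
  have hy0 : y ≠ 0 := div_ne_zero (by norm_num) hx
  have hxy : x = -1 / y := by rw [hy]; field_simp
  set Y := |y| with hY
  have hY0 : 0 < Y := abs_pos.2 hy0
  have hY2 : y ^ 2 = Y ^ 2 := (sq_abs y).symm
  have hxY : |x| = 1 / Y := by rw [hxy, abs_div, abs_neg, abs_one]
  set p := 2 * s - r with hp
  obtain ⟨K₀, hK₀, hexp⟩ := exists_rpow_mul_exp_le_of_one_le (r - s) (c := c / 4) (by positivity)
  set K := ((1 / (2 * Y)) ^ (α - 1) + (2 / Y) ^ (α - 1)) * (C * (1 + 2 ^ p) * K₀) with hK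
  have hK0 : 0 < K := by positivity
  have hηlim : Tendsto (fun t : ℝ => t / (y ^ 2 + t ^ 2)) atTop (𝓝 0) := by
    refine squeeze_zero' (g := fun t : ℝ => t⁻¹) ?_ ?_ tendsto_inv_atTop_zero
    · filter_upwards [Ioi_mem_atTop 0] with t ht
      have : (0 : ℝ) < t := ht
      positivity
    · filter_upwards [Ioi_mem_atTop 0] with t ht
      have : (0 : ℝ) < t := ht
      rw [div_le_iff₀ (by positivity), inv_mul_eq_div, le_div_iff₀ this]
      nlinarith [sq_nonneg y]
  have hlim : Tendsto (fun t : ℝ => K * (t / (y ^ 2 + t ^ 2))) atTop (𝓝 0) := by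
    simpa using hηlim.const_mul K
  refine squeeze_zero_norm' ?_ hlim
  filter_upwards [Ioi_mem_atTop Y, hηlim.eventually (Iic_mem_nhds (one_pos : (0 : ℝ) < 1))]
    with t ht hη1
  have htY : Y ≤ t := le_of_lt ht
  have ht0 : 0 < t := hY0.trans_le htY
  set D := y ^ 2 + t ^ 2 with hD
  have hDY : D = Y ^ 2 + t ^ 2 := by rw [hD, hY2]
  have hD0 : 0 < D := by positivity
  set η := t / D with hη
  have hη0 : 0 < η := by positivity
  have hη1' : η ≤ 1 := hη1
  rw [neg_one_div_vert ht0]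
  have hd : |(-y / D) - (0 : ℝ)| = Y / D := by
    rw [sub_zero, abs_div, abs_neg, abs_of_pos hD0]
  have hd1 : Y / D ≤ η := by rw [hη]; gcongr
  have hd2 : Y / D ≤ 1 / (2 * Y) := by
    rw [div_le_div_iff₀ hD0 (by positivity), hDY]
    nlinarith
  have hη2 : η ≤ 1 / (2 * Y) := by
    rw [hη, div_le_div_iff₀ hD0 (by positivity), hDY]
    nlinarith [sq_nonneg (Y - t)]
  have hhalf : 1 / Y = 1 / (2 * Y) + 1 / (2 * Y) := by field_simp; norm_num
  have h2Y : 2 / Y = 4 * (1 / (2 * Y)) := by field_simp; norm_num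
  have key := norm_sub_le_of_horizontal hG (x := 0) (ξ := -y / D) (η := η)
    (M := K) hη0 (fun z hz1 hz2 => by
      rw [hd, sub_zero] at hz2
      have hzH : z ∈ halfPlane := by rw [mem_ofPred_eq, hz1]; exact hη0
      have n1 : η ≤ ‖z‖ := by
        have := Complex.abs_im_le_norm z
        rwa [hz1, abs_of_pos hη0] at this
      have n2 : ‖z‖ ≤ 2 * η := by
        have := Complex.norm_le_abs_re_add_abs_im z
        rw [hz1, abs_of_pos hη0] at this
        linarith
      have n3 : 1 / (2 * Y) ≤ ‖z - x‖ := by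
        have := Complex.abs_re_le_norm (z - x)
        rw [Complex.sub_re, Complex.ofReal_re] at this
        have e1 := abs_sub_abs_le_abs_sub x z.re
        rw [abs_sub_comm, hxY] at e1
        linarith
      have n4 : ‖z - x‖ ≤ 2 / Y := by
        have := norm_sub_le z (x : ℂ)
        rw [Complex.norm_real, Real.norm_eq_abs, hxY] at this
        linarith
      rw [contourIntegrand, norm_mul, Complex.norm_cpow_real]
      have b1 := rpow_le_rpow_add_rpow (by positivity) n3 n4 (α - 1)
      have b2 := rpow_le_rpow_add_rpow hη0 n1 n2 p
      have b3 := hH z hzH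
      rw [hz1] at b3
      have b4 : Real.exp (-c * (η / ‖z‖ ^ 2)) ≤ Real.exp (-(c / 4) * (1 / η)) := by
        apply Real.exp_le_exp.2
        have h1 : 1 / (4 * η) ≤ η / ‖z‖ ^ 2 := by
          have hz0 : 0 < ‖z‖ := hη0.trans_le n1
          have hz2 : ‖z‖ ^ 2 ≤ (2 * η) ^ 2 := by gcongr
          rw [div_le_div_iff₀ (by positivity) (by positivity)]
          linarith
        have h2 : 1 / η = 4 * (1 / (4 * η)) := by field_simp
        rw [h2]
        have h3 := mul_le_mul_of_nonneg_left h1 hc.le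
        linarith
      have b5 := hexp (1 / η) (by rw [le_div_iff₀ hη0]; linarith)
      refine mul_le_mul b1 (b3.trans ?_) (norm_nonneg _) (by positivity)
      calc C * (‖z‖ ^ p * η ^ (-s) * Real.exp (-c * (η / ‖z‖ ^ 2)))
          ≤ C * ((η ^ p + (2 * η) ^ p) * η ^ (-s) * Real.exp (-(c / 4) * (1 / η))) := by gcongr
        _ = C * (1 + 2 ^ p) * ((1 / η) ^ (r - s) * Real.exp (-(c / 4) * (1 / η))) := by
            have : (1 / η) ^ (r - s) = η ^ p * η ^ (-s) := by
              rw [one_div, Real.inv_rpow hη0.le, ← Real.rpow_neg hη0.le, ← Real.rpow_add hη0]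
              congr 1; rw [hp]; ring
            rw [this, Real.mul_rpow (by norm_num) hη0.le]
            ring
        _ ≤ _ := by gcongr)
  rw [Complex.ofReal_zero, zero_add] at key
  refine key.trans ?_
  rw [hd]
  gcongr

lemma integrableOn_rpow_mul_one_add_mul_exp {q c M : ℝ} (hq : -1 < q) (hc : 0 < c)
    (hM : 0 ≤ M) :
    IntegrableOn (fun t : ℝ => t ^ q * ((1 + t) ^ M * Real.exp (-c * t))) (Ioi 0) := by
  obtain ⟨C, hC, h⟩ := exists_rpow_mul_exp_le hM (by positivity : 0 < c / 2)
  have hi := (integrableOn_rpow_mul_exp hq (by positivity : 0 < c / 2)).const_mul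
    (C * Real.exp (c / 2))
  refine Integrable.mono' hi ?_ ?_
  · refine ContinuousOn.aestronglyMeasurable ?_ measurableSet_Ioi
    intro t ht
    have h0 : (0 : ℝ) < t := ht
    exact ((Real.continuousAt_rpow_const t _ (Or.inl h0.ne')).mul
      ((ContinuousAt.rpow_const (by fun_prop) (Or.inr hM)).mul
        (by fun_prop))).continuousWithinAt
  · filter_upwards [ae_restrict_mem measurableSet_Ioi] with t ht
    have h0 : (0 : ℝ) < t := ht
    rw [Real.norm_eq_abs, abs_of_pos (by positivity)]
    have h1 := h (1 + t) (by linarith)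
    have h2 : Real.exp (-c * t) =
        Real.exp (-(c / 2) * (1 + t)) * Real.exp (c / 2) * Real.exp (-(c / 2) * t) := by
      rw [← Real.exp_add, ← Real.exp_add]; congr 1; ring
    calc t ^ q * ((1 + t) ^ M * Real.exp (-c * t))
        = t ^ q * (((1 + t) ^ M * Real.exp (-(c / 2) * (1 + t))) *
            (Real.exp (c / 2) * Real.exp (-(c / 2) * t))) := by rw [h2]; ring
      _ ≤ t ^ q * (C * (Real.exp (c / 2) * Real.exp (-(c / 2) * t))) := by gcongr
      _ = _ := by ring

/-- `(1 - i x t)^e`. -/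
noncomputable def tilt (e x t : ℝ) : ℂ := (1 - Complex.I * x * t) ^ (e : ℂ)

lemma tilt_base_re (x t : ℝ) : (1 - Complex.I * x * t).re = 1 := by simp

lemma tilt_base_mem (x t : ℝ) : 1 - Complex.I * x * t ∈ Complex.slitPlane :=
  Complex.mem_slitPlane_iff.2 (Or.inl (by rw [tilt_base_re]; exact one_pos))

lemma norm_tilt_le (e x : ℝ) {t : ℝ} (ht : 0 ≤ t) :
    ‖tilt e x t‖ ≤ (1 + |x|) ^ |e| * (1 + t) ^ |e| := by
  rw [tilt, Complex.norm_cpow_real, ← Real.mul_rpow (by positivity) (by positivity)]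
  have h1 : 1 ≤ ‖1 - Complex.I * x * t‖ := by
    have := Complex.abs_re_le_norm (1 - Complex.I * x * t)
    rwa [tilt_base_re, abs_one] at this
  have h2 : ‖1 - Complex.I * x * t‖ ≤ (1 + |x|) * (1 + t) := by
    have := norm_sub_le (1 : ℂ) (Complex.I * x * t)
    rw [norm_one, norm_mul, norm_mul, Complex.norm_I, Complex.norm_real, Complex.norm_real,
      Real.norm_eq_abs, Real.norm_eq_abs, abs_of_nonneg ht] at this
    nlinarith [abs_nonneg x]
  exact (Real.rpow_le_rpow_of_exponent_le h1 (le_abs_self e)).trans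
    (Real.rpow_le_rpow (by linarith) h2 (abs_nonneg e))

lemma continuous_tilt (e : ℝ) : Continuous (fun q : ℝ × ℝ => tilt e q.1 q.2) :=
  continuous_iff_continuousAt.2 fun q =>
    ContinuousAt.cpow (by fun_prop) continuousAt_const (tilt_base_mem q.1 q.2)

lemma vert_norm_le {s C c : ℝ} {h : ℂ → ℂ} (hb : ∀ z : ℂ, 0 < z.im →
    ‖h z‖ ≤ C * (z.im ^ (-s) * Real.exp (-c * z.im))) (y : ℝ) {t : ℝ} (ht : 0 < t) :
    ‖h (y + t * Complex.I)‖ ≤ C * (t ^ (-s) * Real.exp (-c * t)) := by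
  simpa using hb (y + t * Complex.I) (vert_mem_halfPlane y ht)

lemma integrableOn_tilt_mul {α s e : ℝ} {h : ℂ → ℂ} (hb : DecayBound s h)
    (hc : ContinuousOn h halfPlane) (hα : s < α) (x y : ℝ) :
    IntegrableOn (fun t : ℝ => ((t ^ (α - 1) : ℝ) : ℂ) *
      (tilt e x t * h (y + t * Complex.I))) (Ioi 0) := by
  obtain ⟨C, c, hC, hc0, hb⟩ := hb
  have hi := (integrableOn_rpow_mul_one_add_mul_exp (q := α - 1 - s) (by linarith) hc0
    (abs_nonneg e)).const_mul ((1 + |x|) ^ |e| * C)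
  refine Integrable.mono' hi (ContinuousOn.aestronglyMeasurable
    ((continuousOn_ofReal_rpow _).mul (ContinuousOn.mul ?_ (continuousOn_vert hc y)))
      measurableSet_Ioi) ?_
  · exact ((continuous_tilt e).comp (by fun_prop : Continuous fun t : ℝ => (x, t))).continuousOn
  filter_upwards [ae_restrict_mem measurableSet_Ioi] with t ht
  have ht' : 0 < t := ht
  rw [norm_mul, norm_mul, Complex.norm_real, Real.norm_eq_abs, abs_of_pos (by positivity)]
  calc t ^ (α - 1) * (‖tilt e x t‖ * ‖h (y + t * Complex.I)‖)
      ≤ t ^ (α - 1) * (((1 + |x|) ^ |e| * (1 + t) ^ |e|) *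
          (C * (t ^ (-s) * Real.exp (-c * t)))) := by
        gcongr
        · exact norm_tilt_le e x ht'.le
        · exact vert_norm_le hb y ht'
    _ = _ := by
        rw [sub_eq_add_neg (α - 1) s, Real.rpow_add ht']; ring

/-- The secondary term produced by the inversion of a vertical Mellin-type integral. -/
noncomputable def inversionRemainder (r α : ℝ) (h : ℂ → ℂ) (x : ℝ) : ℂ :=
  ∫ t in Ioi (0 : ℝ), ((t ^ (α - 1) : ℝ) : ℂ) *
    ((tilt (-(α + 1 - r)) x t - 1) * h (((-1 / x : ℝ) : ℂ) + t * Complex.I))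

lemma I_cpow_sub_one_mul_I (α : ℝ) :
    Complex.I ^ ((α - 1 : ℝ) : ℂ) * Complex.I = Complex.I ^ (α : ℂ) := by
  have : ((α - 1 : ℝ) : ℂ) = (α : ℂ) - 1 := by push_cast; ring
  rw [this, Complex.cpow_sub _ _ Complex.I_ne_zero, Complex.cpow_one,
    div_mul_cancel₀ _ Complex.I_ne_zero]

/-- With u = 1 - ixt one has z = -1/w = x/u and z - x = i t x²/u. The principal powers of these
products split because 1/u has positive real part and x Im(1/u) > 0; this holds for both signs of x.
The powers of 1/u collect into the tilt factor. -/
lemma contourIntegrand_inverted (r α : ℝ) (h : ℂ → ℂ) {x : ℝ} (hx : x ≠ 0) {t : ℝ} (ht : 0 < t) :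
    contourIntegrand r α h x (-1 / (((-1 / x : ℝ) : ℂ) + t * Complex.I)) *
      (Complex.I / (((-1 / x : ℝ) : ℂ) + t * Complex.I) ^ 2) =
    (Complex.I ^ (α : ℂ) * ((|x| ^ (2 * α) : ℝ) : ℂ) * (x : ℂ) ^ ((-r : ℝ) : ℂ)) *
      (((t ^ (α - 1) : ℝ) : ℂ) *
        (tilt (-(α + 1 - r)) x t * h (((-1 / x : ℝ) : ℂ) + t * Complex.I))) := by
  set w : ℂ := ((-1 / x : ℝ) : ℂ) + t * Complex.I with hw
  set u : ℂ := 1 - Complex.I * x * t with hu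
  have hxc : (x : ℂ) ≠ 0 := by exact_mod_cast hx
  have hu0 : u ≠ 0 := Complex.slitPlane_ne_zero (tilt_base_mem x t)
  have hns : 0 < Complex.normSq u := Complex.normSq_pos.2 hu0
  have hvre : 0 < (u⁻¹).re := by
    rw [Complex.inv_re, hu, tilt_base_re]; positivity
  have hvim : 0 < x * (u⁻¹).im := by
    have h1 : u.im = -(x * t) := by simp [hu]
    rw [Complex.inv_im, h1, neg_neg, mul_div_assoc', ← mul_assoc]
    have : 0 < x * x := mul_self_pos.2 hx
    positivity
  have hv0 : u⁻¹ ≠ 0 := inv_ne_zero hu0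
  have hwu : w = -u / x := by
    rw [hw, hu]; push_cast; field_simp; ring
  have hw0 : w ≠ 0 := by
    rw [hwu]; exact div_ne_zero (neg_ne_zero.2 hu0) hxc
  have hz : -1 / w = x * u⁻¹ := by rw [hwu]; field_simp
  have hzx : (x : ℂ) * u⁻¹ - x = ((t * x ^ 2 : ℝ) : ℂ) * (Complex.I * u⁻¹) := by
    push_cast; field_simp; rw [hu]; ring
  have hzinv : -1 / ((x : ℂ) * u⁻¹) = w := by rw [← hz]; field_simp
  have hw2 : Complex.I / w ^ 2 = Complex.I * ((x ^ 2 : ℝ) : ℂ) * (u⁻¹) ^ 2 := by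
    rw [hwu]; push_cast; field_simp
  have htx : 0 < t * x ^ 2 := by positivity
  have htilt : tilt (-(α + 1 - r)) x t =
      u⁻¹ ^ ((α - 1 : ℝ) : ℂ) * u⁻¹ ^ ((-r : ℝ) : ℂ) * (u⁻¹) ^ 2 := by
    have e1 : tilt (-(α + 1 - r)) x t = u⁻¹ ^ ((α + 1 - r : ℝ) : ℂ) := by
      rw [tilt, Complex.inv_cpow _ _ (Complex.slitPlane_arg_ne_pi (tilt_base_mem x t)),
        ← Complex.cpow_neg]
      push_cast; rfl
    rw [e1, ← Complex.cpow_add _ _ hv0, ← Complex.cpow_ofNat, ← Complex.cpow_add _ _ hv0]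
    congr 1; push_cast; ring
  have hpow : ((|x| ^ (2 * α) : ℝ) : ℂ) * ((t ^ (α - 1) : ℝ) : ℂ) =
      (((t * x ^ 2) ^ (α - 1) : ℝ) : ℂ) * ((x ^ 2 : ℝ) : ℂ) := by
    rw [← Complex.ofReal_mul, ← Complex.ofReal_mul]
    congr 1
    rw [Real.mul_rpow ht.le (by positivity), mul_assoc, ← Real.rpow_add_one (by positivity),
      ← sq_abs, ← Real.rpow_natCast, ← Real.rpow_mul (abs_nonneg x), mul_comm]
    congr 2; push_cast; ring
  rw [hz, hw2, contourIntegrand, hzx, ofReal_mul_cpow htx (mul_ne_zero Complex.I_ne_zero hv0),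
    I_mul_cpow hvre, inversion, hzinv, real_mul_cpow hx hvre hvim, htilt,
    ← I_cpow_sub_one_mul_I α]
  linear_combination (-(Complex.I ^ ((α - 1 : ℝ) : ℂ) * Complex.I * (x : ℂ) ^ ((-r : ℝ) : ℂ) *
    (u⁻¹ ^ ((α - 1 : ℝ) : ℂ) * u⁻¹ ^ ((-r : ℝ) : ℂ) * (u⁻¹) ^ 2) * h w)) * hpow

lemma hasDerivAt_vert (y t : ℝ) :
    HasDerivAt (fun t : ℝ => (y : ℂ) + t * Complex.I) Complex.I t := by
  have h1 : HasDerivAt (fun t : ℝ => (t : ℂ) * Complex.I) (1 * Complex.I) t :=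
    (Complex.ofRealCLM.hasDerivAt (x := t)).mul_const Complex.I
  simpa using h1.const_add (y : ℂ)

lemma contourIntegrand_vert (r α : ℝ) (h : ℂ → ℂ) (x : ℝ) {t : ℝ} (ht : 0 < t) :
    contourIntegrand r α h x (x + t * Complex.I) * Complex.I =
      Complex.I ^ (α : ℂ) * (((t ^ (α - 1) : ℝ) : ℂ) * inversion r h (x + t * Complex.I)) := by
  rw [contourIntegrand, add_sub_cancel_left, ofReal_mul_cpow ht Complex.I_ne_zero,
    ← I_cpow_sub_one_mul_I α]
  ring

lemma integrableOn_inversion_vert {r α s x : ℝ} {h : ℂ → ℂ} (hb : DecayBound s h)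
    (hd : DifferentiableOn ℂ h halfPlane) (hα : s < α) (hx : x ≠ 0) :
    IntegrableOn (fun t : ℝ => ((t ^ (α - 1) : ℝ) : ℂ) * inversion r h (x + t * Complex.I))
      (Ioc 0 1) := by
  obtain ⟨C, c, hC, hc, hH⟩ := exists_norm_inversion_le (r := r) hb
  set K := C * (|x| ^ (2 * s - r) + (|x| + 1) ^ (2 * s - r)) with hK
  have hx0 : 0 < |x| := abs_pos.2 hx
  have hi : IntegrableOn (fun t : ℝ => K * t ^ (α - 1 - s)) (Ioc 0 1) := by
    have := intervalIntegral.intervalIntegrable_rpow' (a := 0) (b := 1)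
      (by linarith : -1 < α - 1 - s)
    rw [intervalIntegrable_iff_integrableOn_Ioc_of_le zero_le_one] at this
    exact this.const_mul K
  refine Integrable.mono' hi (ContinuousOn.aestronglyMeasurable
    (((continuousOn_ofReal_rpow _).mul (continuousOn_vert
      (differentiableOn_inversion hd).continuousOn x)).mono fun t ht => ht.1)
      measurableSet_Ioc) ?_
  filter_upwards [ae_restrict_mem measurableSet_Ioc] with t ht
  have ht' : 0 < t := ht.1
  rw [norm_mul, Complex.norm_real, Real.norm_eq_abs, abs_of_pos (by positivity)]
  set z : ℂ := x + t * Complex.I with hz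
  have him : z.im = t := by simp [hz]
  have hre : z.re = x := by simp [hz]
  have n1 : |x| ≤ ‖z‖ := by simpa [hre] using Complex.abs_re_le_norm z
  have n2 : ‖z‖ ≤ |x| + 1 := by
    have := Complex.norm_le_abs_re_add_abs_im z
    rw [hre, him, abs_of_pos ht'] at this
    linarith [ht.2]
  have b1 := rpow_le_rpow_add_rpow hx0 n1 n2 (2 * s - r)
  have b2 := hH z (vert_mem_halfPlane x ht')
  rw [him] at b2
  have b3 : Real.exp (-c * (t / ‖z‖ ^ 2)) ≤ 1 := by
    rw [Real.exp_le_one_iff]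
    have : 0 ≤ t / ‖z‖ ^ 2 := by positivity
    nlinarith
  calc t ^ (α - 1) * ‖inversion r h z‖
      ≤ t ^ (α - 1) * (C * ((|x| ^ (2 * s - r) + (|x| + 1) ^ (2 * s - r)) * t ^ (-s) * 1)) := by
        gcongr
        refine b2.trans ?_
        gcongr
    _ = K * t ^ (α - 1 - s) := by
        rw [sub_eq_add_neg (α - 1) s, Real.rpow_add ht', hK]; ring

/-- On the imaginary axis `z^{-r} h(-1/z)` is flat at the origin. -/
lemma exists_norm_inversion_I_le {r s : ℝ} {h : ℂ → ℂ} (hb : DecayBound s h) (N : ℝ) :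
    ∃ C : ℝ, 0 < C ∧ ∀ t ∈ Ioc (0 : ℝ) 1, ‖inversion r h (t * Complex.I)‖ ≤ C * t ^ N := by
  obtain ⟨C, c, hC, hc, hH⟩ := exists_norm_inversion_le (r := r) hb
  obtain ⟨K, hK, hexp⟩ := exists_rpow_mul_exp_le_of_one_le (N + r - s) hc
  refine ⟨C * K, by positivity, fun t ht => ?_⟩
  have ht' : 0 < t := ht.1
  have hn : ‖(t : ℂ) * Complex.I‖ = t := by
    rw [norm_mul, Complex.norm_I, Complex.norm_real, Real.norm_eq_abs, abs_of_pos ht', mul_one]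
  have b2 := hH (t * Complex.I) (by simpa using ht')
  have him : ((t : ℂ) * Complex.I).im = t := by simp
  rw [him, hn] at b2
  have b3 := hexp (1 / t) (by rw [le_div_iff₀ ht']; linarith [ht.2])
  have e1 : t / t ^ 2 = 1 / t := by field_simp
  have e2 : t ^ (2 * s - r) * t ^ (-s) = t ^ N * (1 / t) ^ (N + r - s) := by
    rw [one_div, Real.inv_rpow ht'.le, ← Real.rpow_neg ht'.le, ← Real.rpow_add ht',
      ← Real.rpow_add ht']
    congr 1; ring
  refine b2.trans ?_
  rw [e1, e2]
  calc C * (t ^ N * (1 / t) ^ (N + r - s) * Real.exp (-c * (1 / t)))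
      = C * t ^ N * ((1 / t) ^ (N + r - s) * Real.exp (-c * (1 / t))) := by ring
    _ ≤ C * t ^ N * K := by gcongr
    _ = _ := by ring

lemma norm_mul_I_sub_le {x X t : ℝ} (ht : t ∈ Ioc (0 : ℝ) 1) (hx : |x| ≤ X) (p : ℝ) :
    ‖((t : ℂ) * Complex.I - x) ^ (p : ℂ)‖ ≤ t ^ p + (X + 1) ^ p := by
  rw [Complex.norm_cpow_real]
  refine rpow_le_rpow_add_rpow ht.1 ?_ ?_ p
  · have := Complex.abs_im_le_norm ((t : ℂ) * Complex.I - x)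
    simpa [abs_of_pos ht.1] using this
  · have := Complex.norm_le_abs_re_add_abs_im ((t : ℂ) * Complex.I - x)
    simp [abs_of_pos ht.1] at this
    linarith [ht.2]

lemma mul_I_sub_mem_slitPlane {t : ℝ} (ht : 0 < t) (x : ℝ) :
    (t : ℂ) * Complex.I - x ∈ Complex.slitPlane :=
  sub_ofReal_mem_slitPlane (by simpa using ht) x

/-- The integral `∫₀¹ (it - x)^p Q(t) dt`. -/
noncomputable def axisIntegral (Q : ℝ → ℂ) (p x : ℝ) : ℂ :=
  ∫ t in Ioc (0 : ℝ) 1, ((t : ℂ) * Complex.I - x) ^ (p : ℂ) * Q t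

/-- Flatness of order |p| compensates the possible blow-up t^p of the power when p < 0, uniformly
for |x| ≤ X. -/
lemma axis_bound {Q : ℝ → ℂ} (hQ : ∀ N : ℝ, ∃ C : ℝ, 0 < C ∧ ∀ t ∈ Ioc (0 : ℝ) 1, ‖Q t‖ ≤ C * t ^ N)
    (p X : ℝ) (hX : 0 ≤ X) : ∃ K : ℝ, ∀ x : ℝ, |x| ≤ X → ∀ t ∈ Ioc (0 : ℝ) 1,
      ‖((t : ℂ) * Complex.I - x) ^ (p : ℂ) * Q t‖ ≤ K := by
  obtain ⟨C, hC, h⟩ := hQ |p|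
  refine ⟨(1 + (X + 1) ^ p) * C, fun x hx t ht => ?_⟩
  have ht' : 0 < t := ht.1
  rw [norm_mul]
  have h1 := norm_mul_I_sub_le ht hx p
  have h3 : t ^ p * t ^ |p| ≤ 1 := by
    rw [← Real.rpow_add ht']
    exact Real.rpow_le_one ht'.le ht.2 (by linarith [neg_abs_le p])
  have h4 : t ^ |p| ≤ 1 := Real.rpow_le_one ht'.le ht.2 (abs_nonneg p)
  calc ‖((t : ℂ) * Complex.I - x) ^ (p : ℂ)‖ * ‖Q t‖
      ≤ (t ^ p + (X + 1) ^ p) * (C * t ^ |p|) := by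
        gcongr
        exact h t ht
    _ = C * (t ^ p * t ^ |p|) + (X + 1) ^ p * C * t ^ |p| := by ring
    _ ≤ C * 1 + (X + 1) ^ p * C * 1 := by gcongr
    _ = _ := by ring

lemma integrableOn_axis {Q : ℝ → ℂ} (hc : ContinuousOn Q (Ioc 0 1))
    (hQ : ∀ N : ℝ, ∃ C : ℝ, 0 < C ∧ ∀ t ∈ Ioc (0 : ℝ) 1, ‖Q t‖ ≤ C * t ^ N) (p x : ℝ) :
    IntegrableOn (fun t : ℝ => ((t : ℂ) * Complex.I - x) ^ (p : ℂ) * Q t) (Ioc 0 1) := by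
  obtain ⟨K, hK⟩ := axis_bound hQ p |x| (abs_nonneg x)
  refine Integrable.mono' (integrable_const K) (ContinuousOn.aestronglyMeasurable
    (ContinuousOn.mul ?_ hc) measurableSet_Ioc) ?_
  · exact ContinuousOn.cpow_const (by fun_prop) fun t ht => mul_I_sub_mem_slitPlane ht.1 x
  · filter_upwards [ae_restrict_mem measurableSet_Ioc] with t ht using hK x le_rfl t ht

/-- Differentiation lowers p by one, and since Q is flat to every order no exponent is too negative;
the step can thus be iterated indefinitely, even at x = 0. -/
lemma hasDerivAt_axisIntegral {Q : ℝ → ℂ} (hc : ContinuousOn Q (Ioc 0 1))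
    (hQ : ∀ N : ℝ, ∃ C : ℝ, 0 < C ∧ ∀ t ∈ Ioc (0 : ℝ) 1, ‖Q t‖ ≤ C * t ^ N) (p x : ℝ) :
    HasDerivAt (axisIntegral Q p) (-p * axisIntegral Q (p - 1) x) x := by
  have hder : ∀ t ∈ Ioc (0 : ℝ) 1, ∀ x : ℝ, HasDerivAt
      (fun x : ℝ => ((t : ℂ) * Complex.I - x) ^ (p : ℂ) * Q t)
      (-p * (((t : ℂ) * Complex.I - x) ^ ((p - 1 : ℝ) : ℂ) * Q t)) x := by
    intro t ht x
    have h3 : HasDerivAt (fun x : ℝ => (t : ℂ) * Complex.I - (x : ℂ)) (-1) x :=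
      (Complex.ofRealCLM.hasDerivAt (x := x)).const_sub _
    have h4 := HasDerivAt.cpow_const (c := (p : ℂ)) (hasDerivAt_id ((t : ℂ) * Complex.I - (x : ℂ)))
      (mul_I_sub_mem_slitPlane ht.1 x)
    have h5 := (HasDerivAt.comp x h4 h3).mul_const (Q t)
    refine HasDerivAt.congr_deriv h5 ?_
    simp only [id]
    push_cast
    ring
  have key := hasDerivAt_integral_of_dominated_real (μ := volume.restrict (Ioc (0 : ℝ) 1))
    isOpen_univ (Φ := fun x t => ((t : ℂ) * Complex.I - x) ^ (p : ℂ) * Q t)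
    (Φ' := fun x t => -p * (((t : ℂ) * Complex.I - x) ^ ((p - 1 : ℝ) : ℂ) * Q t))
    (fun x _ => ((integrableOn_axis hc hQ (p - 1) x).const_mul _).aestronglyMeasurable)
    (fun x _ => integrableOn_axis hc hQ p x) ?_ ?_ ?_
  · refine (key.1 x (mem_univ x)).congr_deriv ?_
    rw [integral_const_mul, axisIntegral]
  · filter_upwards [ae_restrict_mem measurableSet_Ioc] with t ht x _ using hder t ht x
  · filter_upwards [ae_restrict_mem measurableSet_Ioc] with t ht
    refine continuousOn_const.mul (ContinuousOn.mul ?_ continuousOn_const)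
    exact ContinuousOn.cpow_const (by fun_prop) fun x _ => mul_I_sub_mem_slitPlane ht.1 x
  · intro x₀ _
    obtain ⟨K, hK⟩ := axis_bound hQ (p - 1) (|x₀| + 1) (by positivity)
    refine ⟨1, one_pos, fun _ => ‖(-p : ℂ)‖ * K, integrable_const _, ?_⟩
    filter_upwards [ae_restrict_mem measurableSet_Ioc] with t ht x hx
    rw [norm_mul]
    gcongr
    refine hK x ?_ t ht
    have h1 : |x - x₀| < 1 := by simpa [Real.dist_eq] using hx.1
    have h2 := abs_add_le x₀ (x - x₀)
    rw [add_sub_cancel] at h2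
    linarith

lemma contDiff_axisIntegral {Q : ℝ → ℂ} (hc : ContinuousOn Q (Ioc 0 1))
    (hQ : ∀ N : ℝ, ∃ C : ℝ, 0 < C ∧ ∀ t ∈ Ioc (0 : ℝ) 1, ‖Q t‖ ≤ C * t ^ N) (n : ℕ) :
    ∀ p : ℝ, ContDiff ℝ n (axisIntegral Q p) := by
  induction n with
  | zero =>
    intro p
    rw [Nat.cast_zero, contDiff_zero]
    exact continuous_iff_continuousAt.2 fun x => (hasDerivAt_axisIntegral hc hQ p x).continuousAt
  | succ n ih =>
    intro p
    rw [Nat.cast_add, Nat.cast_one, contDiff_succ_iff_deriv]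
    refine ⟨fun x => (hasDerivAt_axisIntegral hc hQ p x).differentiableAt, by simp, ?_⟩
    have : deriv (axisIntegral Q p) = fun x => -p * axisIntegral Q (p - 1) x :=
      funext fun x => (hasDerivAt_axisIntegral hc hQ p x).deriv
    rw [this]
    exact contDiff_const.mul (ih (p - 1))

/-- The integral of the contour integrand along the segment from `i` to `x + i`. -/
noncomputable def segmentIntegral (r α : ℝ) (h : ℂ → ℂ) (x : ℝ) : ℂ :=
  ∫ u in Ioc (0 : ℝ) 1, contourIntegrand r α h x (Complex.I + u * x) * x

/-- The values of `z^{-r} h(-1/z) dz` along the imaginary axis. -/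
noncomputable def axisValue (r : ℝ) (h : ℂ → ℂ) (t : ℝ) : ℂ :=
  inversion r h (t * Complex.I) * Complex.I

lemma continuousOn_axisValue {r : ℝ} {h : ℂ → ℂ} (hd : DifferentiableOn ℂ h halfPlane) :
    ContinuousOn (axisValue r h) (Ioc 0 1) :=
  (((differentiableOn_inversion hd).continuousOn).comp (by fun_prop)
    (fun t ht => by simpa using ht.1)).mul continuousOn_const

lemma exists_norm_axisValue_le {r s : ℝ} {h : ℂ → ℂ} (hb : DecayBound s h) (N : ℝ) :
    ∃ C : ℝ, 0 < C ∧ ∀ t ∈ Ioc (0 : ℝ) 1, ‖axisValue r h t‖ ≤ C * t ^ N := by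
  obtain ⟨C, hC, h1⟩ := exists_norm_inversion_I_le (r := r) hb N
  refine ⟨C, hC, fun t ht => ?_⟩
  rw [axisValue, norm_mul, Complex.norm_I, mul_one]
  exact h1 t ht

/-- Deformation of the vertical path at `x` to the image of a vertical path under inversion. -/
theorem contour_identity {r α s x : ℝ} {h : ℂ → ℂ} (hb : DecayBound s h)
    (hd : DifferentiableOn ℂ h halfPlane) (hα : s < α) (hx : x ≠ 0) :
    Complex.I ^ (α : ℂ) * (∫ t in Ioc (0 : ℝ) 1,
        ((t ^ (α - 1) : ℝ) : ℂ) * inversion r h (x + t * Complex.I)) =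
      (Complex.I ^ (α : ℂ) * ((|x| ^ (2 * α) : ℝ) : ℂ) * (x : ℂ) ^ ((-r : ℝ) : ℂ)) *
        (vertIntegral α h (-1 / x) + inversionRemainder r α h x) +
      axisIntegral (axisValue r h) (α - 1) x + segmentIntegral r α h x := by
  -- With a primitive on the whole half-plane each path integral becomes a difference of boundary
  -- values of G, and no closed contour through boundary points is needed.
  obtain ⟨G, hG⟩ := exists_primitive_halfPlane (differentiableOn_contourIntegrand (r := r) (α := α)
    (x := x) hd)
  have hy0 : -1 / x ≠ 0 := div_ne_zero (by norm_num) hx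
  -- the vertical path above `x`
  have d1 : ∀ t ∈ Ioi (0 : ℝ), HasDerivAt (fun t : ℝ => G (x + t * Complex.I))
      (contourIntegrand r α h x (x + t * Complex.I) * Complex.I) t := fun t ht =>
    HasDerivAt.comp t (hG _ (vert_mem_halfPlane x ht)) (hasDerivAt_vert x t)
  have i1 : IntegrableOn (fun t : ℝ => contourIntegrand r α h x (x + t * Complex.I) * Complex.I)
      (Ioc 0 1) :=
    IntegrableOn.congr_fun
      (Integrable.const_mul (integrableOn_inversion_vert (r := r) hb hd hα hx)
        (Complex.I ^ (α : ℂ)))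
      (fun t ht => (contourIntegrand_vert r α h x ht.1).symm) measurableSet_Ioc
  have l1 := tendsto_nhdsGT_of_hasDerivAt (fun t ht => d1 t ht.1) i1
  have e1 : ∫ t in Ioc (0 : ℝ) 1, contourIntegrand r α h x (x + t * Complex.I) * Complex.I =
      Complex.I ^ (α : ℂ) * (∫ t in Ioc (0 : ℝ) 1,
        ((t ^ (α - 1) : ℝ) : ℂ) * inversion r h (x + t * Complex.I)) := by
    rw [← integral_const_mul]
    exact setIntegral_congr_fun measurableSet_Ioc fun t ht => contourIntegrand_vert r α h x ht.1
  -- the imaginary axis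
  have d2 : ∀ t ∈ Ioi (0 : ℝ), HasDerivAt (fun t : ℝ => G (t * Complex.I))
      (((t : ℂ) * Complex.I - x) ^ ((α - 1 : ℝ) : ℂ) * axisValue r h t) t := by
    intro t ht
    have h1 := hasDerivAt_vert 0 t
    simp only [Complex.ofReal_zero, zero_add] at h1
    have h2 := HasDerivAt.comp t (hG (t * Complex.I) (by simpa using ht)) h1
    refine HasDerivAt.congr_deriv h2 ?_
    rw [contourIntegrand, axisValue, mul_assoc]
  have i2 := integrableOn_axis (continuousOn_axisValue (r := r) hd)
    (exists_norm_axisValue_le hb) (α - 1) x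
  have l2 := tendsto_nhdsGT_of_hasDerivAt (fun t ht => d2 t ht.1) i2
  -- the inverted vertical path
  have d3 : ∀ t ∈ Ioi (0 : ℝ), HasDerivAt
      (fun t : ℝ => G (-1 / (((-1 / x : ℝ) : ℂ) + t * Complex.I)))
      (contourIntegrand r α h x (-1 / (((-1 / x : ℝ) : ℂ) + t * Complex.I)) *
      (Complex.I / (((-1 / x : ℝ) : ℂ) + t * Complex.I) ^ 2)) t := by
    intro t ht
    have hw := vert_mem_halfPlane (-1 / x) ht
    have hw0 := Complex.slitPlane_ne_zero (halfPlane_subset_slitPlane hw)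
    have h1 := (hasDerivAt_vert (-1 / x) t).fun_inv hw0
    have h2 : HasDerivAt (fun t : ℝ => -1 / (((-1 / x : ℝ) : ℂ) + t * Complex.I))
        (Complex.I / (((-1 / x : ℝ) : ℂ) + t * Complex.I) ^ 2) t := by
      have h3 := h1.const_mul (-1 : ℂ)
      simp only [← div_eq_mul_inv] at h3
      refine HasDerivAt.congr_deriv h3 ?_
      ring
    exact HasDerivAt.comp t (hG _ (neg_one_div_mem_halfPlane hw)) h2
  have i3 : IntegrableOn (fun t : ℝ =>
      contourIntegrand r α h x (-1 / (((-1 / x : ℝ) : ℂ) + t * Complex.I)) *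
      (Complex.I / (((-1 / x : ℝ) : ℂ) + t * Complex.I) ^ 2)) (Ioi 0) :=
    IntegrableOn.congr_fun (Integrable.const_mul
      (integrableOn_tilt_mul (e := -(α + 1 - r)) hb hd.continuousOn hα x (-1 / x))
      (Complex.I ^ (α : ℂ) * ((|x| ^ (2 * α) : ℝ) : ℂ) * (x : ℂ) ^ ((-r : ℝ) : ℂ)))
      (fun t ht => (contourIntegrand_inverted r α h hx ht).symm) measurableSet_Ioi
  have e3 : ∫ t in Ioi (0 : ℝ), contourIntegrand r α h x
      (-1 / (((-1 / x : ℝ) : ℂ) + t * Complex.I)) *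
      (Complex.I / (((-1 / x : ℝ) : ℂ) + t * Complex.I) ^ 2) =
      (Complex.I ^ (α : ℂ) * ((|x| ^ (2 * α) : ℝ) : ℂ) * (x : ℂ) ^ ((-r : ℝ) : ℂ)) *
        (vertIntegral α h (-1 / x) + inversionRemainder r α h x) := by
    rw [setIntegral_congr_fun measurableSet_Ioi
      fun t ht => contourIntegrand_inverted r α h hx ht, integral_const_mul]
    congr 1
    rw [vertIntegral, inversionRemainder]
    have j1 := integrableOn_vert hb hd.continuousOn hα (-1 / x)
    have j2 := integrableOn_tilt_mul (e := -(α + 1 - r)) hb hd.continuousOn hα x (-1 / x)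
    have j3 : IntegrableOn (fun t : ℝ => ((t ^ (α - 1) : ℝ) : ℂ) *
        ((tilt (-(α + 1 - r)) x t - 1) * h (((-1 / x : ℝ) : ℂ) + t * Complex.I))) (Ioi 0) := by
      refine (j2.sub j1).congr_fun (fun t _ => ?_) measurableSet_Ioi
      simp only [Pi.sub_apply]
      ring
    rw [← integral_add j1 j3]
    congr 1
    ext t
    ring
  have hη0 : Tendsto (fun t : ℝ => t / ((-1 / x) ^ 2 + t ^ 2)) (𝓝[>] 0) (𝓝[>] 0) := by
    refine tendsto_nhdsWithin_iff.2 ⟨?_, ?_⟩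
    · have : ContinuousAt (fun t : ℝ => t / ((-1 / x) ^ 2 + t ^ 2)) 0 :=
        ContinuousAt.div (by fun_prop) (by fun_prop) (by positivity)
      have h1 := this.tendsto
      rw [zero_div] at h1
      exact h1.mono_left nhdsWithin_le_nhds
    · filter_upwards [self_mem_nhdsWithin] with t ht
      have : (0 : ℝ) < t := ht
      exact mem_Ioi.2 (by positivity)
  have hη1 : Tendsto (fun t : ℝ => t / ((-1 / x) ^ 2 + t ^ 2)) atTop (𝓝[>] 0) := by
    refine tendsto_nhdsWithin_iff.2 ⟨?_, ?_⟩
    · refine squeeze_zero' (g := fun t : ℝ => t⁻¹) ?_ ?_ tendsto_inv_atTop_zero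
      · filter_upwards [Ioi_mem_atTop 0] with t ht
        have : (0 : ℝ) < t := ht
        positivity
      · filter_upwards [Ioi_mem_atTop 0] with t ht
        have : (0 : ℝ) < t := ht
        rw [div_le_iff₀ (by positivity), inv_mul_eq_div, le_div_iff₀ this]
        nlinarith [sq_nonneg (-1 / x)]
    · filter_upwards [Ioi_mem_atTop 0] with t ht
      have : (0 : ℝ) < t := ht
      exact mem_Ioi.2 (by positivity)
  -- The inverted path runs from x (t → 0) to 0 (t → ∞); its limits of G agree with those along the
  -- vertical above x and along the imaginary axis.
  have m1 := (tendsto_primitive_at_real hb hα hx hG).add (l1.comp hη0)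
  have m2 := (tendsto_primitive_at_zero hb hx hG).add (l2.comp hη1)
  have e4 := integral_Ioi_of_hasDerivAt_of_tendsto_both d3 i3
    (m1.congr fun t => by simp only [Function.comp]; ring)
    (m2.congr fun t => by simp only [Function.comp]; ring)
  rw [e3, e1] at e4
  -- the horizontal segment
  have d5 : ∀ u ∈ Icc (0 : ℝ) 1, Complex.I + u * x ∈ halfPlane := fun u _ => by simp
  have e5 : segmentIntegral r α h x = G (x + (1 : ℝ) * Complex.I) - G ((1 : ℝ) * Complex.I) := by
    have h1 : ∀ u ∈ uIcc (0 : ℝ) 1, HasDerivAt (fun u : ℝ => G (Complex.I + u * x))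
        (contourIntegrand r α h x (Complex.I + u * x) * x) u := by
      intro u hu
      rw [uIcc_of_le zero_le_one] at hu
      have h2 : HasDerivAt (fun u : ℝ => Complex.I + (u : ℂ) * x) (1 * x) u :=
        ((Complex.ofRealCLM.hasDerivAt (x := u)).mul_const (x : ℂ)).const_add _
      rw [one_mul] at h2
      exact HasDerivAt.comp u (hG _ (d5 u hu)) h2
    have h3 : ContinuousOn (fun u : ℝ => contourIntegrand r α h x (Complex.I + u * x) * x)
        (uIcc 0 1) := by
      rw [uIcc_of_le zero_le_one]
      exact ((differentiableOn_contourIntegrand hd).continuousOn.comp (by fun_prop) d5).mul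
        continuousOn_const
    have h4 := intervalIntegral.integral_eq_sub_of_hasDerivAt h1 h3.intervalIntegrable
    rw [intervalIntegral.integral_of_le zero_le_one] at h4
    rw [segmentIntegral, h4]
    simp only [Complex.ofReal_one, Complex.ofReal_zero, one_mul, zero_mul, add_zero]
    rw [add_comm]
  rw [e4, e5, axisIntegral]
  ring

/-! ### Regularity of the individual terms -/

lemma contDiffAt_comp_ofReal {F : ℂ → ℂ} {x : ℝ} (hF : AnalyticAt ℂ F x) (n : ℕ) :
    ContDiffAt ℝ n (fun x : ℝ => F x) x :=
  (hF.contDiffAt.restrict_scalars ℝ).comp x Complex.ofRealCLM.contDiff.contDiffAt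

lemma analyticAt_integral_Ioc {U : Set ℂ} (hU : IsOpen U) {Φ : ℂ → ℝ → ℂ}
    (hc : ContinuousOn (Function.uncurry Φ) (U ×ˢ Icc 0 1))
    (hd : ∀ t ∈ Icc (0 : ℝ) 1, DifferentiableOn ℂ (fun s => Φ s t) U) {s₀ : ℂ} (hs₀ : s₀ ∈ U) :
    AnalyticAt ℂ (fun s => ∫ t in Ioc (0 : ℝ) 1, Φ s t) s₀ := by
  have key := hasDerivAt_integral_of_dominated (μ := volume.restrict (Ioc (0 : ℝ) 1)) hU (Φ := Φ)
    (fun s hs => ?_) ?_ ?_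
  · have h1 : DifferentiableOn ℂ (fun s => ∫ t in Ioc (0 : ℝ) 1, Φ s t) U :=
      fun s hs => (key s hs).differentiableAt.differentiableWithinAt
    exact h1.analyticAt (hU.mem_nhds hs₀)
  · refine ContinuousOn.aestronglyMeasurable ?_ measurableSet_Ioc
    exact hc.comp (by fun_prop : ContinuousOn (fun t : ℝ => (s, t)) _)
      fun t ht => ⟨hs, Ioc_subset_Icc_self ht⟩
  · filter_upwards [ae_restrict_mem measurableSet_Ioc] with t ht
      using hd t (Ioc_subset_Icc_self ht)
  · intro s₁ hs₁
    obtain ⟨ε, hε, hsub⟩ := Metric.nhds_basis_closedBall.mem_iff.1 (hU.mem_nhds hs₁)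
    obtain ⟨K, hK⟩ := ((isCompact_closedBall s₁ ε).prod
      (isCompact_Icc (a := (0 : ℝ)) (b := 1))).exists_bound_of_continuousOn
      (hc.mono (prod_mono hsub subset_rfl))
    refine ⟨ε, hε, fun _ => K, integrable_const _, ?_⟩
    filter_upwards [ae_restrict_mem measurableSet_Ioc] with t ht s hs
    exact hK (s, t) ⟨ball_subset_closedBall hs.1, Ioc_subset_Icc_self ht⟩

/-- Let x become complex with |Im x| < 1: both i + ux and i + ux - x stay in the upper half-plane
for 0 ≤ u ≤ 1, so the integral is analytic in x. -/
lemma contDiffAt_segmentIntegral {r α : ℝ} {h : ℂ → ℂ} (hd : DifferentiableOn ℂ h halfPlane)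
    (x : ℝ) (n : ℕ) : ContDiffAt ℝ n (segmentIntegral r α h) x := by
  set U : Set ℂ := {s : ℂ | |s.im| < 1} with hU
  have hUo : IsOpen U := isOpen_lt (by fun_prop) continuous_const
  have m1 : ∀ s ∈ U, ∀ u ∈ Icc (0 : ℝ) 1, Complex.I + u * s ∈ halfPlane := by
    intro s hs u hu
    have hs' : |s.im| < 1 := hs
    have h1 := abs_lt.1 hs'
    simp only [mem_ofPred_eq, Complex.add_im, Complex.I_im, Complex.mul_im, Complex.ofReal_re,
      Complex.ofReal_im, zero_mul, add_zero]
    nlinarith [hu.1, hu.2]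
  have m2 : ∀ s ∈ U, ∀ u ∈ Icc (0 : ℝ) 1, Complex.I + u * s - s ∈ halfPlane := by
    intro s hs u hu
    have hs' : |s.im| < 1 := hs
    have h1 := abs_lt.1 hs'
    simp only [mem_ofPred_eq, Complex.sub_im, Complex.add_im, Complex.I_im, Complex.mul_im,
      Complex.ofReal_re, Complex.ofReal_im, zero_mul, add_zero]
    nlinarith [hu.1, hu.2]
  have key := analyticAt_integral_Ioc hUo (Φ := fun s u =>
    (Complex.I + u * s - s) ^ ((α - 1 : ℝ) : ℂ) * inversion r h (Complex.I + u * s) * s) ?_ ?_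
    (s₀ := x) (by simp [hU])
  · exact contDiffAt_comp_ofReal key n
  · refine ContinuousOn.mul (ContinuousOn.mul ?_ ?_) (by fun_prop)
    · exact ContinuousOn.cpow_const (by fun_prop)
        fun q hq => halfPlane_subset_slitPlane (m2 q.1 hq.1 q.2 hq.2)
    · exact (differentiableOn_inversion hd).continuousOn.comp (by fun_prop)
        fun q hq => m1 q.1 hq.1 q.2 hq.2
  · intro t ht
    refine DifferentiableOn.mul (DifferentiableOn.mul ?_ ?_) (by fun_prop)
    · exact DifferentiableOn.cpow_const (by fun_prop)
        fun s hs => halfPlane_subset_slitPlane (m2 s hs t ht)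
    · exact (differentiableOn_inversion hd).comp (by fun_prop) fun s hs => m1 s hs t ht

/-- Again x may be complex: for Im x > -1/2 and t > 1 the argument x + it has height at least t/2,
and the exponential decay of h dominates. -/
lemma contDiffAt_integral_Ioi_one {α s : ℝ} {h : ℂ → ℂ} (hb : DecayBound s h) (hs : 0 ≤ s)
    (hd : DifferentiableOn ℂ h halfPlane) (hα : s < α) (x : ℝ) (n : ℕ) :
    ContDiffAt ℝ n (fun x : ℝ => ∫ t in Ioi (1 : ℝ),
      ((t ^ (α - 1) : ℝ) : ℂ) * h (x + t * Complex.I)) x := by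
  set U : Set ℂ := {s : ℂ | -(1 / 2) < s.im} with hU
  have hUo : IsOpen U := isOpen_lt continuous_const Complex.continuous_im
  have him : ∀ w ∈ U, ∀ t ∈ Ioi (1 : ℝ), t / 2 ≤ (w + t * Complex.I).im := by
    intro w hw t ht
    have h1 : -(1 / 2) < w.im := hw
    have h2 : (1 : ℝ) < t := ht
    simp only [Complex.add_im, Complex.mul_im, Complex.ofReal_re, Complex.I_im, mul_one,
      Complex.ofReal_im, Complex.I_re, mul_zero, add_zero]
    linarith
  have hmem : ∀ w ∈ U, ∀ t ∈ Ioi (1 : ℝ), w + t * Complex.I ∈ halfPlane := by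
    intro w hw t ht
    have h2 : (1 : ℝ) < t := ht
    have := him w hw t ht
    rw [mem_ofPred_eq]
    linarith
  obtain ⟨C, c, hC, hc, hb⟩ := hb
  have hi : IntegrableOn (fun t : ℝ => C * 2 ^ s *
      (t ^ (α - 1 - s) * Real.exp (-(c / 2) * t))) (Ioi 1) :=
    ((integrableOn_rpow_mul_exp (by linarith) (by positivity)).mono_set
      (Ioi_subset_Ioi zero_le_one)).const_mul _
  have key := hasDerivAt_integral_of_dominated (μ := volume.restrict (Ioi (1 : ℝ))) hUo
    (Φ := fun w t => ((t ^ (α - 1) : ℝ) : ℂ) * h (w + t * Complex.I)) ?_ ?_ ?_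
  · have h1 : DifferentiableOn ℂ (fun w => ∫ t in Ioi (1 : ℝ), ((t ^ (α - 1) : ℝ) : ℂ) *
        h (w + t * Complex.I)) U :=
      fun s hs => (key s hs).differentiableAt.differentiableWithinAt
    exact contDiffAt_comp_ofReal (h1.analyticAt (hUo.mem_nhds (by simp [hU]))) n
  · intro w hw
    refine ContinuousOn.aestronglyMeasurable ?_ measurableSet_Ioi
    refine ((continuousOn_ofReal_rpow _).mono (Ioi_subset_Ioi zero_le_one)).mul ?_
    exact hd.continuousOn.comp (by fun_prop) fun t ht => hmem w hw t ht
  · filter_upwards [ae_restrict_mem measurableSet_Ioi] with t ht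
    exact (differentiableOn_const _).mul (hd.comp (by fun_prop) fun w hw => hmem w hw t ht)
  · intro w₀ _
    refine ⟨1, one_pos, _, hi, ?_⟩
    filter_upwards [ae_restrict_mem measurableSet_Ioi] with t ht w hw
    have h2 : (0 : ℝ) < t := one_pos.trans ht
    have h3 := him w hw.2 t ht
    rw [norm_mul, Complex.norm_real, Real.norm_eq_abs, abs_of_pos (by positivity)]
    calc t ^ (α - 1) * ‖h (w + t * Complex.I)‖
        ≤ t ^ (α - 1) * (C * ((t / 2) ^ (-s) * Real.exp (-c * (t / 2)))) := by
          gcongr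
          refine (hb _ (hmem w hw.2 t ht)).trans ?_
          gcongr ?_ * (?_ * ?_)
          · exact Real.rpow_le_rpow_of_nonpos (by positivity) h3 (by linarith)
          · apply Real.exp_le_exp.2; nlinarith
      _ = _ := by
          rw [Real.div_rpow h2.le (by norm_num), Real.rpow_neg (by norm_num : (0:ℝ) ≤ 2),
            div_inv_eq_mul, sub_eq_add_neg (α - 1) s, Real.rpow_add h2]
          have : -c * (t / 2) = -(c / 2) * t := by ring
          rw [this]; ring

lemma hasDerivAt_tilt (e x t : ℝ) :
    HasDerivAt (fun x : ℝ => tilt e x t) (-Complex.I * t * e * tilt (e - 1) x t) x := by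
  have h3 : HasDerivAt (fun x : ℝ => 1 - Complex.I * (x : ℂ) * t) (-(Complex.I * 1 * t)) x :=
    (((Complex.ofRealCLM.hasDerivAt (x := x)).const_mul Complex.I).mul_const (t : ℂ)).const_sub 1
  have h4 := HasDerivAt.cpow_const (c := (e : ℂ)) (hasDerivAt_id (1 - Complex.I * x * t))
    (tilt_base_mem x t)
  have h5 := HasDerivAt.comp x h4 h3
  refine HasDerivAt.congr_deriv h5 ?_
  simp only [id, tilt]
  push_cast
  ring

lemma tilt_comm (e x t : ℝ) : tilt e x t = tilt e t x := by
  rw [tilt, tilt, mul_right_comm]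

lemma tilt_zero_right (e x : ℝ) : tilt e x 0 = 1 := by simp [tilt]

/-- Mean value inequality in t from t = 0. The gain is a factor |x| t: the |x| improves the order of
the error at 0, and the t pays for one derivative of h. -/
lemma norm_tilt_sub_one_le (e x : ℝ) {t : ℝ} (ht : 0 ≤ t) :
    ‖tilt e x t - 1‖ ≤ |e| * |x| * ((1 + |x|) ^ |e - 1| * (1 + t) ^ |e - 1|) * t := by
  have h1 : ∀ u ∈ Icc 0 t, HasDerivWithinAt (fun u : ℝ => tilt e x u)
      (-Complex.I * x * e * tilt (e - 1) x u) (Icc 0 t) u := by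
    intro u _
    have h2 := (hasDerivAt_tilt e u x).hasDerivWithinAt (s := Icc 0 t)
    simpa only [tilt_comm _ _ x] using h2
  have h3 := (convex_Icc 0 t).norm_image_sub_le_of_norm_hasDerivWithin_le h1
    (C := |e| * |x| * ((1 + |x|) ^ |e - 1| * (1 + t) ^ |e - 1|)) (fun u hu => ?_)
    (left_mem_Icc.2 ht) (right_mem_Icc.2 ht)
  · rwa [tilt_zero_right, sub_zero, Real.norm_eq_abs, abs_of_nonneg ht] at h3
  · rw [norm_mul, norm_mul, norm_mul, norm_neg, Complex.norm_I, Complex.norm_real,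
      Complex.norm_real, Real.norm_eq_abs, Real.norm_eq_abs, one_mul, mul_comm |x|]
    gcongr
    refine (norm_tilt_le (e - 1) x hu.1).trans ?_
    have := hu.1
    gcongr
    exact hu.2

lemma integrableOn_inversionRemainder {r α s : ℝ} {h : ℂ → ℂ} (hb : DecayBound s h)
    (hc : ContinuousOn h halfPlane) (hα : s < α) (x : ℝ) :
    IntegrableOn (fun t : ℝ => ((t ^ (α - 1) : ℝ) : ℂ) *
      ((tilt (-(α + 1 - r)) x t - 1) * h (((-1 / x : ℝ) : ℂ) + t * Complex.I))) (Ioi 0) := by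
  have j1 := integrableOn_vert hb hc hα (-1 / x)
  have j2 := integrableOn_tilt_mul (e := -(α + 1 - r)) hb hc hα x (-1 / x)
  refine (j2.sub j1).congr_fun (fun t _ => ?_) measurableSet_Ioi
  simp only [Pi.sub_apply]
  ring

/-- Together with the prefactor of size |x|^{2α-r} this bound produces the error exponent 2α - r +
1. -/
lemma exists_norm_inversionRemainder_le {r α s : ℝ} {h : ℂ → ℂ} (hb : DecayBound s h)
    (hα : s < α) :
    ∃ K : ℝ, ∀ x : ℝ, |x| ≤ 1 → ‖inversionRemainder r α h x‖ ≤ K * |x| := by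
  obtain ⟨C, c, hC, hc0, hb⟩ := hb
  set e : ℝ := -(α + 1 - r) with he
  have hi := integrableOn_rpow_mul_one_add_mul_exp (q := α - s) (by linarith) hc0
    (abs_nonneg (e - 1))
  refine ⟨∫ t in Ioi (0 : ℝ), (|e| * 2 ^ |e - 1| * C) *
    (t ^ (α - s) * ((1 + t) ^ |e - 1| * Real.exp (-c * t))), fun x hx => ?_⟩
  rw [mul_comm, ← integral_const_mul, inversionRemainder]
  refine norm_integral_le_of_norm_le ((hi.const_mul _).const_mul _) ?_
  filter_upwards [ae_restrict_mem measurableSet_Ioi] with t ht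
  have h0 : (0 : ℝ) < t := ht
  rw [norm_mul, norm_mul, Complex.norm_real, Real.norm_eq_abs, abs_of_pos (by positivity)]
  have h1 := norm_tilt_sub_one_le e x h0.le
  have h2 := vert_norm_le hb (-1 / x) h0
  have h3 : (1 + |x|) ^ |e - 1| ≤ 2 ^ |e - 1| :=
    Real.rpow_le_rpow (by positivity) (by linarith) (abs_nonneg _)
  calc t ^ (α - 1) * (‖tilt e x t - 1‖ * ‖h (((-1 / x : ℝ) : ℂ) + t * Complex.I)‖)
      ≤ t ^ (α - 1) * ((|e| * |x| * (2 ^ |e - 1| * (1 + t) ^ |e - 1|) * t) *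
          (C * (t ^ (-s) * Real.exp (-c * t)))) := by
        gcongr
        refine h1.trans ?_
        gcongr
    _ = _ := by
        have : t ^ (α - s) = t ^ (α - 1) * t * t ^ (-s) := by
          rw [← Real.rpow_add_one h0.ne', ← Real.rpow_add h0]
          congr 1; ring
        rw [this]
        ring

lemma contDiffOn_one_of_hasDerivAt {U : Set ℝ} (hU : IsOpen U) {F F' : ℝ → ℂ}
    (hd : ∀ x ∈ U, HasDerivAt F (F' x) x) (hc : ContinuousOn F' U) : ContDiffOn ℝ 1 F U := by
  have h : ContDiffOn ℝ (0 + 1) F U := by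
    rw [contDiffOn_succ_iff_deriv_of_isOpen hU]
    refine ⟨fun x hx => (hd x hx).differentiableAt.differentiableWithinAt, by simp, ?_⟩
    rw [contDiffOn_zero]
    exact hc.congr fun x hx => (hd x hx).deriv
  simpa using h

/-- When the derivative falls on h(-1/x + it), the decay bound loses a factor t, which is regained
from tilt minus one being O(t); the integrand is then O(t^{α-s-1}) near t = 0, which is integrable.
The factor 1/x² from the chain rule is why 0 is excluded. -/
lemma contDiffOn_inversionRemainder {r α s : ℝ} {h : ℂ → ℂ} (hb : DecayBound s h) (hs : 0 ≤ s)
    (hd : DifferentiableOn ℂ h halfPlane) (hα : s < α) :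
    ContDiffOn ℝ 1 (inversionRemainder r α h) {0}ᶜ := by
  have hb' := hb.deriv hs hd
  have hd' : DifferentiableOn ℂ (deriv h) halfPlane := hd.deriv isOpen_halfPlane
  obtain ⟨C, c, hC, hc0, hb₁⟩ := hb
  obtain ⟨C', c', hC', hc0', hb₂⟩ := hb'
  set e : ℝ := -(α + 1 - r) with he
  set M : ℝ := |e - 1| with hM
  have hM0 : 0 ≤ M := abs_nonneg _
  have key := hasDerivAt_integral_of_dominated_real (μ := volume.restrict (Ioi (0 : ℝ)))
    (U := {0}ᶜ) isOpen_compl_singleton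
    (Φ := fun x t => ((t ^ (α - 1) : ℝ) : ℂ) *
      ((tilt e x t - 1) * h (((-1 / x : ℝ) : ℂ) + t * Complex.I)))
    (Φ' := fun x t => ((t ^ (α - 1) : ℝ) : ℂ) *
      ((-Complex.I * t * e * tilt (e - 1) x t) * h (((-1 / x : ℝ) : ℂ) + t * Complex.I) +
        (tilt e x t - 1) * (deriv h (((-1 / x : ℝ) : ℂ) + t * Complex.I) * (1 / (x : ℂ) ^ 2))))
    ?_ ?_ ?_ ?_ ?_
  · exact contDiffOn_one_of_hasDerivAt isOpen_compl_singleton key.1 key.2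
  · intro x _
    have ht : ∀ p : ℝ, ContinuousOn (fun t : ℝ => tilt p x t) (Ioi 0) := fun p =>
      ((continuous_tilt p).comp (by fun_prop : Continuous fun t : ℝ => (x, t))).continuousOn
    refine ContinuousOn.aestronglyMeasurable ((continuousOn_ofReal_rpow _).mul
      (((ContinuousOn.mul (by fun_prop) (ht _)).mul (continuousOn_vert hd.continuousOn _)).add
        (((ht _).sub continuousOn_const).mul
          ((continuousOn_vert hd'.continuousOn _).mul continuousOn_const)))) measurableSet_Ioi
  · intro x _
    exact integrableOn_inversionRemainder ⟨C, c, hC, hc0, hb₁⟩ hd.continuousOn hα x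
  · filter_upwards [ae_restrict_mem measurableSet_Ioi] with t ht x hx
    have hx0 : x ≠ 0 := hx
    have h1 : HasDerivAt (fun x : ℝ => -1 / x) (1 / x ^ 2) x := by
      have := (hasDerivAt_inv hx0).const_mul (-1 : ℝ)
      simp only [← div_eq_mul_inv] at this
      refine HasDerivAt.congr_deriv this ?_
      rw [one_div]; ring
    have h2 : HasDerivAt (fun x : ℝ => ((-1 / x : ℝ) : ℂ) + t * Complex.I)
        ((1 / x ^ 2 : ℝ) : ℂ) x := (h1.ofReal_comp).add_const _
    have hz := vert_mem_halfPlane (-1 / x) ht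
    have h3 := HasDerivAt.comp x
      ((hd _ hz).differentiableAt (isOpen_halfPlane.mem_nhds hz)).hasDerivAt h2
    refine HasDerivAt.congr_deriv ((((hasDerivAt_tilt e x t).sub_const 1).mul h3).const_mul _) ?_
    simp only [Function.comp]
    push_cast
    ring
  · filter_upwards [ae_restrict_mem measurableSet_Ioi] with t ht
    have ht' : ∀ p : ℝ, ContinuousOn (fun x : ℝ => tilt p x t) {0}ᶜ := fun p =>
      ((continuous_tilt p).comp (by fun_prop : Continuous fun x : ℝ => (x, t))).continuousOn
    have hv : ContinuousOn (fun x : ℝ => ((-1 / x : ℝ) : ℂ) + t * Complex.I) {0}ᶜ :=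
      (Complex.continuous_ofReal.comp_continuousOn
        (ContinuousOn.div (by fun_prop) (by fun_prop) fun x hx => hx)).add continuousOn_const
    have hm : MapsTo (fun x : ℝ => ((-1 / x : ℝ) : ℂ) + t * Complex.I) {0}ᶜ halfPlane :=
      fun x _ => vert_mem_halfPlane (-1 / x) ht
    refine continuousOn_const.mul (ContinuousOn.add (ContinuousOn.mul (ContinuousOn.mul
      (by fun_prop) (ht' _)) (hd.continuousOn.comp hv hm)) (((ht' _).sub continuousOn_const).mul
        ((hd'.continuousOn.comp hv hm).mul (ContinuousOn.div (by fun_prop) (by fun_prop) ?_))))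
    intro x hx
    have hx0 : x ≠ 0 := hx
    exact pow_ne_zero 2 (by exact_mod_cast hx0)
  · intro x₀ hx₀
    have hx0 : 0 < |x₀| := abs_pos.2 hx₀
    set X : ℝ := 2 * |x₀| with hX
    have i1 := integrableOn_rpow_mul_one_add_mul_exp (q := α - s) (by linarith) hc0 hM0
    have i2 := integrableOn_rpow_mul_one_add_mul_exp (q := α - s - 1) (by linarith) hc0' hM0
    refine ⟨|x₀| / 2, by positivity, _, (i1.const_mul (|e| * (1 + X) ^ M * C)).add
      (i2.const_mul (|e| * X * (1 + X) ^ M * C' * (4 / |x₀| ^ 2))), ?_⟩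
    filter_upwards [ae_restrict_mem measurableSet_Ioi] with t ht x hx
    have h0 : (0 : ℝ) < t := ht
    have hdist : |x - x₀| < |x₀| / 2 := hx.1
    have a1 : |x| ≤ X := by
      have := abs_sub_abs_le_abs_sub x x₀
      rw [hX]; linarith
    have a2 : |x₀| / 2 ≤ |x| := by
      have := abs_sub_abs_le_abs_sub x₀ x
      rw [abs_sub_comm] at this; linarith
    have a4 : 0 < |x| := by linarith
    have a3 : 1 / |x| ^ 2 ≤ 4 / |x₀| ^ 2 := by
      rw [div_le_div_iff₀ (by positivity) (by positivity)]
      nlinarith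
    have b1 := norm_tilt_le (e - 1) x h0.le
    have b2 := norm_tilt_sub_one_le e x h0.le
    have b3 := vert_norm_le hb₁ (-1 / x) h0
    have b4 := vert_norm_le hb₂ (-1 / x) h0
    have b5 : (1 + |x|) ^ M ≤ (1 + X) ^ M :=
      Real.rpow_le_rpow (by positivity) (by linarith) hM0
    rw [norm_mul, Complex.norm_real, Real.norm_eq_abs, abs_of_pos (by positivity)]
    have c1 : ‖(-Complex.I * t * e * tilt (e - 1) x t) *
        h (((-1 / x : ℝ) : ℂ) + t * Complex.I)‖ ≤
        t * |e| * ((1 + X) ^ M * (1 + t) ^ M) * (C * (t ^ (-s) * Real.exp (-c * t))) := by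
      rw [norm_mul, norm_mul, norm_mul, norm_mul, norm_neg, Complex.norm_I, Complex.norm_real,
        Complex.norm_real, Real.norm_eq_abs, Real.norm_eq_abs, one_mul, abs_of_pos h0]
      gcongr
      exact b1.trans (by gcongr)
    have c2 : ‖(tilt e x t - 1) * (deriv h (((-1 / x : ℝ) : ℂ) + t * Complex.I) *
        (1 / (x : ℂ) ^ 2))‖ ≤ (|e| * X * ((1 + X) ^ M * (1 + t) ^ M) * t) *
        (C' * (t ^ (-(s + 1)) * Real.exp (-c' * t)) * (4 / |x₀| ^ 2)) := by
      rw [norm_mul, norm_mul, norm_div, norm_pow, norm_one, Complex.norm_real, Real.norm_eq_abs]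
      gcongr
      exact b2.trans (by gcongr)
    refine (mul_le_mul_of_nonneg_left ((norm_add_le _ _).trans (add_le_add c1 c2))
      (by positivity)).trans (le_of_eq ?_)
    have d1 : t ^ (α - s) = t ^ (α - 1) * t * t ^ (-s) := by
      rw [← Real.rpow_add_one h0.ne', ← Real.rpow_add h0]
      congr 1; ring
    have d2 : t ^ (α - s - 1) = t ^ (α - 1) * t * t ^ (-(s + 1)) := by
      rw [← Real.rpow_add_one h0.ne', ← Real.rpow_add h0]
      congr 1; ring
    simp only [Pi.add_apply]
    rw [d1, d2]
    ring

/-! ### Powers of a real variable, the function ψ and the singular kernel -/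

lemma neg_I_mul_mem_slitPlane {x : ℝ} (hx : x ≠ 0) : -Complex.I * x ∈ Complex.slitPlane :=
  Complex.mem_slitPlane_iff.2 (Or.inr (by simpa using hx))

lemma arg_I_add_arg_mem (x : ℝ) :
    Complex.I.arg + (-Complex.I * x).arg ∈ Ioc (-Real.pi) Real.pi := by
  have := abs_le.1 (Complex.abs_arg_le_pi_div_two_iff.2 (by simp : 0 ≤ (-Complex.I * x).re))
  rw [Complex.arg_I]
  constructor <;> linarith [Real.pi_pos]

lemma ofReal_eq_I_mul (x : ℝ) : (x : ℂ) = Complex.I * (-Complex.I * x) := by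
  rw [← mul_assoc, mul_neg, Complex.I_mul_I, neg_neg, one_mul]

/-- The arguments of i and -ix add up to 0 or π, which are the principal arguments of positive and
negative x. The power is thereby expressed, on both sides of 0, through a function analytic off the
cut. -/
lemma ofReal_cpow_eq_I_cpow_mul {x : ℝ} (hx : x ≠ 0) (c : ℂ) :
    (x : ℂ) ^ c = Complex.I ^ c * (-Complex.I * x) ^ c := by
  conv_lhs => rw [ofReal_eq_I_mul x]
  exact mul_cpow_of_arg Complex.I_ne_zero
    (Complex.slitPlane_ne_zero (neg_I_mul_mem_slitPlane hx)) (arg_I_add_arg_mem x) c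

lemma log_ofReal_eq_log_I_add {x : ℝ} (hx : x ≠ 0) :
    Complex.log x = Complex.log Complex.I + Complex.log (-Complex.I * x) := by
  conv_lhs => rw [ofReal_eq_I_mul x]
  exact (Complex.log_mul_eq_add_log_iff Complex.I_ne_zero
    (Complex.slitPlane_ne_zero (neg_I_mul_mem_slitPlane hx))).2 (arg_I_add_arg_mem x)

lemma contDiffAt_ofReal_cpow {x : ℝ} (hx : x ≠ 0) (c : ℂ) (n : ℕ) :
    ContDiffAt ℝ n (fun x : ℝ => (x : ℂ) ^ c) x := by
  have h1 : AnalyticAt ℂ (fun z : ℂ => Complex.I ^ c * (-Complex.I * z) ^ c) x :=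
    analyticAt_const.mul ((analyticAt_const.mul analyticAt_id).cpow analyticAt_const
      (neg_I_mul_mem_slitPlane hx))
  refine (contDiffAt_comp_ofReal h1 n).congr_of_eventuallyEq ?_
  filter_upwards [isOpen_compl_singleton.mem_nhds hx] with y hy
  exact ofReal_cpow_eq_I_cpow_mul hy c

lemma contDiffAt_log_ofReal {x : ℝ} (hx : x ≠ 0) (n : ℕ) :
    ContDiffAt ℝ n (fun x : ℝ => Complex.log x) x := by
  have h1 : AnalyticAt ℂ (fun z : ℂ => Complex.log Complex.I + Complex.log (-Complex.I * z)) x :=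
    analyticAt_const.add ((analyticAt_const.mul analyticAt_id).clog (neg_I_mul_mem_slitPlane hx))
  refine (contDiffAt_comp_ofReal h1 n).congr_of_eventuallyEq ?_
  filter_upwards [isOpen_compl_singleton.mem_nhds hx] with y hy
  exact log_ofReal_eq_log_I_add hy

lemma contDiffAt_psi (α r : ℝ) {x : ℝ} (hx : x ≠ 0) (n : ℕ) : ContDiffAt ℝ n (psi α r) x := by
  by_cases h : ∃ k : ℤ, α - r = k
  · have : psi α r = fun x : ℝ => (x : ℂ) ^ ((α - r : ℝ) : ℂ) * Complex.log x := by
      ext x; rw [psi, if_pos h]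
    rw [this]
    exact (contDiffAt_ofReal_cpow hx _ n).mul (contDiffAt_log_ofReal hx n)
  · have : psi α r = fun x : ℝ => (x : ℂ) ^ ((α - r : ℝ) : ℂ) := by
      ext x; rw [psi, if_neg h]
    rw [this]
    exact contDiffAt_ofReal_cpow hx _ n

lemma norm_psi_le (α r x : ℝ) :
    ‖psi α r x‖ ≤ |x| ^ (α - r) * (abs (Real.log |x|) + Real.pi) := by
  have h0 : 0 ≤ |x| ^ (α - r) := by positivity
  rw [psi]
  split_ifs with h
  · rw [norm_mul, Complex.norm_cpow_real, Complex.norm_real, Real.norm_eq_abs]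
    refine mul_le_mul_of_nonneg_left ?_ h0
    refine (Complex.norm_le_abs_re_add_abs_im _).trans ?_
    rw [Complex.log_re, Complex.log_im, Complex.norm_real, Real.norm_eq_abs]
    gcongr
    exact Complex.abs_arg_le_pi _
  · rw [Complex.norm_cpow_real, Complex.norm_real, Real.norm_eq_abs]
    nlinarith [Real.pi_gt_three, abs_nonneg (Real.log |x|)]

lemma tendsto_abs_nhdsNE : Tendsto (fun x : ℝ => |x|) (𝓝[≠] 0) (𝓝[>] 0) := by
  refine tendsto_nhdsWithin_iff.2 ⟨?_, ?_⟩
  · have : Tendsto (fun x : ℝ => |x|) (𝓝 0) (𝓝 |0|) := continuous_abs.tendsto 0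
    rw [abs_zero] at this
    exact this.mono_left nhdsWithin_le_nhds
  · filter_upwards [self_mem_nhdsWithin] with x hx using abs_pos.2 hx

lemma tendsto_abs_rpow {p : ℝ} (hp : 0 < p) :
    Tendsto (fun x : ℝ => |x| ^ p) (𝓝[≠] 0) (𝓝 0) := by
  have h := (tendsto_abs_nhdsNE.mono_right nhdsWithin_le_nhds).rpow_const (p := p) (Or.inr hp.le)
  rwa [Real.zero_rpow hp.ne'] at h

lemma tendsto_psi {α r : ℝ} (h : r < α) : Tendsto (psi α r) (𝓝[≠] 0) (𝓝 0) := by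
  have hp : 0 < α - r := by linarith
  have h1 := ((tendsto_log_mul_rpow_nhdsGT_zero hp).comp tendsto_abs_nhdsNE).abs
  have h2 := h1.add ((tendsto_abs_rpow hp).mul_const Real.pi)
  simp only [abs_zero, zero_mul, add_zero] at h2
  refine squeeze_zero_norm (fun x => (norm_psi_le α r x).trans (le_of_eq ?_)) h2
  simp only [Function.comp]
  rw [abs_mul, abs_of_nonneg (by positivity : 0 ≤ |x| ^ (α - r))]
  ring

/-- `|x|^{2α} x^{-r}` -/
noncomputable def inversionFactor (α r x : ℝ) : ℂ :=
  ((|x| ^ (2 * α) : ℝ) : ℂ) * (x : ℂ) ^ ((-r : ℝ) : ℂ)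

lemma norm_inversionFactor (α r : ℝ) {x : ℝ} (hx : x ≠ 0) :
    ‖inversionFactor α r x‖ = |x| ^ (2 * α - r) := by
  rw [inversionFactor, norm_mul, Complex.norm_cpow_real, Complex.norm_real, Complex.norm_real,
    Real.norm_eq_abs, Real.norm_eq_abs, abs_of_nonneg (by positivity), sub_eq_add_neg,
    Real.rpow_add (abs_pos.2 hx)]

lemma contDiffAt_inversionFactor (α r : ℝ) {x : ℝ} (hx : x ≠ 0) (n : ℕ) :
    ContDiffAt ℝ n (inversionFactor α r) x := by
  refine ContDiffAt.mul ?_ (contDiffAt_ofReal_cpow hx _ n)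
  exact Complex.ofRealCLM.contDiff.contDiffAt.comp x
    ((contDiffAt_abs hx).rpow_const_of_ne (abs_pos.2 hx).ne')

/-- The integral `∫₀¹ t^{α-1} (x + it)^{-r} dt`. -/
noncomputable def verticalKernel (α r x : ℝ) : ℂ :=
  ∫ t in Ioc (0 : ℝ) 1, ((t ^ (α - 1) : ℝ) : ℂ) * ((x : ℂ) + t * Complex.I) ^ ((-r : ℝ) : ℂ)

lemma vert_cpow {t : ℝ} (ht : 0 < t) (x r : ℝ) :
    ((x : ℂ) + t * Complex.I) ^ ((-r : ℝ) : ℂ) =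
      Complex.I ^ ((-r : ℝ) : ℂ) * (-Complex.I * x + t) ^ ((-r : ℝ) : ℂ) := by
  rw [← I_mul_cpow (by simpa using ht), mul_add, ← mul_assoc, mul_neg, Complex.I_mul_I,
    neg_neg, one_mul, mul_comm Complex.I]

lemma verticalKernel_eq (α r x : ℝ) : verticalKernel α r x =
    Complex.I ^ ((-r : ℝ) : ℂ) * betaKernel (Ioc 0 1) α r (-Complex.I * x) := by
  rw [verticalKernel, betaKernel, ← integral_const_mul]
  refine setIntegral_congr_fun measurableSet_Ioc fun t ht => ?_
  rw [vert_cpow ht.1]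
  ring

lemma integrableOn_verticalKernel {α r : ℝ} (hα : 0 < α) (hr : 0 < r) {x : ℝ} (hx : x ≠ 0) :
    IntegrableOn (fun t : ℝ => ((t ^ (α - 1) : ℝ) : ℂ) *
      ((x : ℂ) + t * Complex.I) ^ ((-r : ℝ) : ℂ)) (Ioc 0 1) := by
  have h1 := integrableOn_betaKernel measurableSet_Ioc (fun t ht => ht.1) hr.le
    (integrableOn_rpow_mul_one_add_Ioc hα hr.le) (neg_I_mul_mem_slitPlane hx)
  refine IntegrableOn.congr_fun (Integrable.const_mul h1 (Complex.I ^ ((-r : ℝ) : ℂ)))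
    (fun t ht => ?_) measurableSet_Ioc
  rw [vert_cpow ht.1]
  ring

lemma contDiffAt_verticalKernel {α r : ℝ} (hα : 0 < α) (hr : 0 < r) {x : ℝ} (hx : x ≠ 0)
    (n : ℕ) : ContDiffAt ℝ n (verticalKernel α r) x := by
  have h1 : DifferentiableOn ℂ (betaKernel (Ioc 0 1) α r) Complex.slitPlane := fun s hs =>
    (hasDerivAt_betaKernel measurableSet_Ioc (fun t ht => ht.1) hr.le
      (integrableOn_rpow_mul_one_add_Ioc hα hr.le) hs).differentiableAt.differentiableWithinAt
  have h2 : AnalyticAt ℂ (betaKernel (Ioc 0 1) α r) (-Complex.I * x) :=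
    h1.analyticAt (Complex.isOpen_slitPlane.mem_nhds (neg_I_mul_mem_slitPlane hx))
  have h3 : AnalyticAt ℂ (fun z : ℂ => Complex.I ^ ((-r : ℝ) : ℂ) *
      betaKernel (Ioc 0 1) α r (-Complex.I * z)) x :=
    analyticAt_const.mul (AnalyticAt.fun_comp h2 (analyticAt_const.mul analyticAt_id))
  have h4 : verticalKernel α r = fun x : ℝ => Complex.I ^ ((-r : ℝ) : ℂ) *
      betaKernel (Ioc 0 1) α r (-Complex.I * x) := funext (verticalKernel_eq α r)
  rw [h4]
  exact contDiffAt_comp_ofReal h3 n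

lemma tendsto_neg_I_mul : Tendsto (fun x : ℝ => -Complex.I * (x : ℂ)) (𝓝[≠] 0) (𝓝 0) := by
  have h : Continuous fun x : ℝ => -Complex.I * (x : ℂ) := by fun_prop
  have := h.tendsto 0
  simp only [Complex.ofReal_zero, mul_zero] at this
  exact this.mono_left nhdsWithin_le_nhds

lemma contDiffAt_comp_neg_I_mul {a : ℂ → ℂ} (ha : AnalyticAt ℂ a 0) (c : ℂ) (n : ℕ) :
    ContDiffAt ℝ n (fun x : ℝ => c * a (-Complex.I * x)) 0 := by
  have ha' : AnalyticAt ℂ a (-Complex.I * ((0 : ℝ) : ℂ)) := by simpa using ha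
  exact contDiffAt_comp_ofReal (F := fun z => c * a (-Complex.I * z)) (analyticAt_const.mul
    (AnalyticAt.fun_comp ha' (analyticAt_const.mul analyticAt_id))) n

/-- The singular part of the kernel at the origin. -/
theorem verticalKernel_expansion {α r : ℝ} (hr : 0 < r) (hrα : r < α) :
    ∃ A : ℝ, A ≠ 0 ∧ ∃ k : ℝ → ℂ, (∀ n : ℕ, ContDiffAt ℝ n k 0) ∧ ∀ᶠ x in 𝓝[≠] 0,
      verticalKernel α r x = A * Complex.I ^ ((-α : ℝ) : ℂ) * psi α r x + k x := by
  have hα : 0 < α := hr.trans hrα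
  -- The factor i^{-α} of the statement arises here: i^{α-r} is used up in turning (-ix)^{α-r} into
  -- x^{α-r}.
  have hI : Complex.I ^ ((-r : ℝ) : ℂ) =
      Complex.I ^ ((-α : ℝ) : ℂ) * Complex.I ^ ((α - r : ℝ) : ℂ) := by
    rw [← Complex.cpow_add _ _ Complex.I_ne_zero]
    congr 1; push_cast; ring
  by_cases h : ∃ k : ℤ, α - r = k
  · obtain ⟨n, hn⟩ : ∃ n : ℕ, α - r = n := by
      obtain ⟨k, hk⟩ := h
      have : (0 : ℝ) < k := by linarith
      lift k to ℕ using by exact_mod_cast this.le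
      exact ⟨k, by simpa using hk⟩
    obtain ⟨A, hA, a, ha, hev⟩ := betaKernel_expansion_of_int n α r hα hr hn
    -- Since log(-ix) = log x - log i, passing to ψ leaves a multiple of x^n, which joins the smooth
    -- part.
    refine ⟨A, hA, fun x => Complex.I ^ ((-r : ℝ) : ℂ) * a (-Complex.I * x) -
      A * Complex.I ^ ((-α : ℝ) : ℂ) * Complex.log Complex.I * (x : ℂ) ^ n, fun m => ?_, ?_⟩
    · refine (contDiffAt_comp_neg_I_mul ha _ m).sub (ContDiffAt.mul contDiffAt_const ?_)
      exact (Complex.ofRealCLM.contDiff.contDiffAt).pow n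
    · filter_upwards [tendsto_neg_I_mul.eventually hev, self_mem_nhdsWithin] with x hx hx0
      have hx0' : x ≠ 0 := hx0
      rw [verticalKernel_eq, hx (neg_I_mul_mem_slitPlane hx0'), psi, if_pos h,
        log_ofReal_eq_log_I_add hx0', hI]
      have e1 : (x : ℂ) ^ ((α - r : ℝ) : ℂ) = (x : ℂ) ^ n := by
        rw [hn, Complex.ofReal_natCast, Complex.cpow_natCast]
      have e2 : Complex.I ^ ((α - r : ℝ) : ℂ) * (-Complex.I * x) ^ n = (x : ℂ) ^ n := by
        rw [hn, Complex.ofReal_natCast, Complex.cpow_natCast, ← mul_pow, ← ofReal_eq_I_mul]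
      rw [e1]
      linear_combination (Complex.I ^ ((-α : ℝ) : ℂ) * A * Complex.log (-Complex.I * x)) * e2
  · obtain ⟨n, hn⟩ := exists_nat_gt (α - r)
    obtain ⟨A, hA, a, ha, hev⟩ := betaKernel_expansion_of_nonint n α r hα hr hn
      (fun k hk => h ⟨k, hk⟩)
    refine ⟨A, hA, fun x => Complex.I ^ ((-r : ℝ) : ℂ) * a (-Complex.I * x),
      contDiffAt_comp_neg_I_mul ha _, ?_⟩
    filter_upwards [tendsto_neg_I_mul.eventually hev, self_mem_nhdsWithin] with x hx hx0
    have hx0' : x ≠ 0 := hx0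
    rw [verticalKernel_eq, hx (neg_I_mul_mem_slitPlane hx0'), psi, if_neg h,
      ofReal_cpow_eq_I_cpow_mul hx0', hI]
    ring

/-- For Hölder exponent 0 only boundedness of the oscillation on compact sets is required, and
continuity of the derivative provides it. -/
lemma memCkHolder_of_contDiffOn {U : Set ℝ} (hU : IsOpen U) {E : ℝ → ℂ}
    (h : ContDiffOn ℝ 1 E U) : MemCkHolder 1 0 U E := by
  have h' : ContDiffOn ℝ (0 + 1) E U := by simpa using h
  rw [contDiffOn_succ_iff_deriv_of_isOpen hU] at h'
  have hc : ContinuousOn (deriv E) U := h'.2.2.continuousOn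
  refine ⟨h.continuousOn, fun j hj x hx => ?_, fun K hK hKc => ?_⟩
  · obtain rfl : j = 0 := by omega
    rw [iteratedDeriv_zero]
    exact h'.1.differentiableAt (hU.mem_nhds hx)
  · rw [iteratedDeriv_one]
    obtain ⟨C, hC⟩ := hKc.exists_bound_of_continuousOn (hc.mono hK)
    refine ⟨hc.mono hK, 2 * C, fun x hx y hy => ?_⟩
    rw [Real.rpow_zero, mul_one]
    linarith [norm_sub_le (deriv E x) (deriv E y), hC x hx, hC y hy]

lemma isBigO_pow_rpow {s : ℝ} (hs : 0 < s) {n : ℕ} (h : s ≤ n) :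
    (fun x : ℝ => x ^ n) =O[𝓝 0] fun x : ℝ => |x| ^ s := by
  refine Asymptotics.IsBigO.of_bound 1 ?_
  filter_upwards [ball_mem_nhds (0 : ℝ) one_pos] with x hx
  rw [mem_ball_zero_iff, Real.norm_eq_abs] at hx
  rw [one_mul, norm_pow, Real.norm_eq_abs, Real.norm_eq_abs,
    abs_of_nonneg (by positivity : 0 ≤ |x| ^ s)]
  rcases (abs_nonneg x).eq_or_lt with h0 | h0
  · have hn : n ≠ 0 := by
      rintro rfl
      simp only [Nat.cast_zero] at h
      linarith
    rw [← h0, zero_pow hn]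
    positivity
  · rw [← Real.rpow_natCast]
    exact Real.rpow_le_rpow_of_exponent_ge h0 hx.le h

/-- Taylor expansion with an error of real order. -/
lemma exists_polynomial_isBigO {G : ℝ → ℂ} (hG : ∀ n : ℕ, ContDiffAt ℝ n G 0) {s : ℝ}
    (hs : 0 < s) : ∃ P : Polynomial ℂ, (∀ n ∈ P.support, (n : ℝ) < s) ∧
      (fun x : ℝ => G x - P.eval (x : ℂ)) =O[𝓝 0] fun x : ℝ => |x| ^ s := by
  set n := ⌈s⌉₊ with hn
  have hsn : s ≤ n := Nat.le_ceil s
  obtain ⟨ε, hε, hc⟩ : ∃ ε > 0, ContDiffOn ℝ n G (ball 0 ε) := by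
    obtain ⟨ε, hε, h⟩ := Metric.eventually_nhds_iff_ball.1 ((hG n).eventually (by simp))
    exact ⟨ε, hε, fun x hx => (h x hx).contDiffWithinAt⟩
  have hb : ball (0 : ℝ) ε ∈ 𝓝 0 := ball_mem_nhds 0 hε
  have ht := taylor_isLittleO (convex_ball 0 ε) (mem_ball_self hε) hc
  rw [nhdsWithin_eq_nhds.2 hb] at ht
  simp only [sub_zero, taylor_within_apply] at ht
  set c : ℕ → ℂ := fun k => ((k.factorial : ℝ)⁻¹ : ℝ) * iteratedDerivWithin k G (ball 0 ε) 0
  -- Only degrees k < ⌈s⌉ are kept, which means k < s; the Taylor term of degree n ≥ s is dropped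
  -- and is itself O(|x|^s).
  refine ⟨∑ k ∈ Finset.range n, Polynomial.monomial k (c k), fun k hk => ?_, ?_⟩
  · rw [Polynomial.mem_support_iff, Polynomial.finsetSum_coeff] at hk
    by_contra! hle
    refine hk (Finset.sum_eq_zero fun j hj => ?_)
    rw [Polynomial.coeff_monomial, if_neg]
    rintro rfl
    have := Nat.lt_ceil.1 (Finset.mem_range.1 hj)
    linarith
  · have h1 := ht.isBigO.trans (isBigO_pow_rpow hs hsn)
    have h2 : (fun x : ℝ => c n * ((x ^ n : ℝ) : ℂ)) =O[𝓝 0] fun x : ℝ => |x| ^ s := by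
      refine (Asymptotics.IsBigO.const_mul_left ?_ _)
      exact (Complex.isBigO_ofReal_left.2 (isBigO_pow_rpow hs hsn))
    refine (h1.add h2).congr_left fun x => ?_
    rw [Finset.sum_range_succ, Polynomial.eval_finsetSum]
    simp only [Polynomial.eval_monomial, Complex.real_smul, c]
    push_cast
    have h3 : ∀ k : ℕ, ((k.factorial : ℂ)⁻¹ * (x : ℂ) ^ k) *
        iteratedDerivWithin k G (ball 0 ε) 0 =
        (k.factorial : ℂ)⁻¹ * iteratedDerivWithin k G (ball 0 ε) 0 * (x : ℂ) ^ k :=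
      fun k => by ring
    simp only [h3]
    ring

/-! ### The approximate functional equation at the origin -/

/-- The part of the fractional integral that is smooth on the whole real line. -/
noncomputable def smoothPart (r α : ℝ) (f h : ℂ → ℂ) (a : ℂ) (x : ℝ) : ℂ :=
  (Complex.I ^ (α : ℂ))⁻¹ * (axisIntegral (axisValue r h) (α - 1) x + segmentIntegral r α h x) +
    (∫ t in Ioi (1 : ℝ), ((t ^ (α - 1) : ℝ) : ℂ) * (f (x + t * Complex.I) - a)) - a / α

lemma contDiffAt_smoothPart {r α s : ℝ} {f h : ℂ → ℂ} {a : ℂ} (hb : DecayBound s h)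
    (hd : DifferentiableOn ℂ h halfPlane) (hf : DecayBound s (fun z => f z - a))
    (hfd : DifferentiableOn ℂ f halfPlane) (hs : 0 ≤ s) (hα : s < α) (x : ℝ) (n : ℕ) :
    ContDiffAt ℝ n (smoothPart r α f h a) x :=
  ((contDiffAt_const.mul (((contDiff_axisIntegral (continuousOn_axisValue hd)
    (exists_norm_axisValue_le hb) n _).contDiffAt).add (contDiffAt_segmentIntegral hd x n))).add
      (contDiffAt_integral_Ioi_one hf hs (hfd.sub_const a) hα x n)).sub contDiffAt_const

/-- The fractional integral of a function with a transformation law under inversion. -/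
theorem vertIntegral_eq_inversion {r α s x : ℝ} {f g : ℂ → ℂ} {a b : ℂ} (hr : 0 < r)
    (hfd : DifferentiableOn ℂ f halfPlane) (hgd : DifferentiableOn ℂ g halfPlane)
    (hfg : ∀ z ∈ halfPlane, f z = z ^ ((-r : ℝ) : ℂ) * g (-1 / z))
    (hf : DecayBound s (fun z => f z - a)) (hg : DecayBound s (fun z => g z - b))
    (hs : 0 < s) (hα : s < α) (hx : x ≠ 0) :
    vertIntegral α (fun z => f z - a) x =
      inversionFactor α r x * (vertIntegral α (fun z => g z - b) (-1 / x) +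
        inversionRemainder r α (fun z => g z - b) x) +
      smoothPart r α f (fun z => g z - b) a x + b * verticalKernel α r x := by
  have hα0 : 0 < α := hs.trans hα
  have hhd : DifferentiableOn ℂ (fun z => g z - b) halfPlane := hgd.sub_const b
  have i0 := integrableOn_vert hf (hfd.sub_const a).continuousOn hα x
  have i1 := integrableOn_inversion_vert (r := r) hg hhd hα hx
  have i2 := integrableOn_verticalKernel hα0 hr hx
  have i3 : IntegrableOn (fun t : ℝ => t ^ (α - 1)) (Ioc 0 1) :=
    (intervalIntegrable_iff_integrableOn_Ioc_of_le zero_le_one).1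
      (intervalIntegral.intervalIntegrable_rpow' (by linarith))
  have i4 : IntegrableOn (fun t : ℝ => ((t ^ (α - 1) : ℝ) : ℂ) * a) (Ioc 0 1) :=
    i3.ofReal.mul_const a
  have e3 : ∫ t in Ioc (0 : ℝ) 1, ((t ^ (α - 1) : ℝ) : ℂ) * a = a / α := by
    rw [integral_mul_const, integral_complex_ofReal, ← intervalIntegral.integral_of_le zero_le_one,
      integral_rpow (Or.inl (by linarith))]
    rw [sub_add_cancel, Real.one_rpow, Real.zero_rpow hα0.ne', sub_zero]
    push_cast
    ring
  -- On (0, 1] use f - a = z^{-r} (g-b)(-1/z) + b z^{-r} - a; the last term integrates to -a/α.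
  have e1 : ∫ t in Ioc (0 : ℝ) 1, ((t ^ (α - 1) : ℝ) : ℂ) * (f (x + t * Complex.I) - a) =
      (∫ t in Ioc (0 : ℝ) 1, ((t ^ (α - 1) : ℝ) : ℂ) *
        inversion r (fun z => g z - b) (x + t * Complex.I)) +
      b * verticalKernel α r x - a / α := by
    rw [← e3, verticalKernel, ← integral_const_mul,
      ← integral_add' i1 (Integrable.const_mul i2 b),
      ← integral_sub (i1.add (Integrable.const_mul i2 b) :) i4]
    refine setIntegral_congr_fun measurableSet_Ioc fun t ht => ?_
    simp only [hfg _ (vert_mem_halfPlane x ht.1), inversion, Pi.add_apply]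
    ring
  have e2 := contour_identity hg hhd hα hx (r := r)
  have hI : Complex.I ^ (α : ℂ) ≠ 0 := by
    rw [Ne, Complex.cpow_eq_zero_iff]
    simp
  rw [vertIntegral, ← Ioc_union_Ioi_eq_Ioi (zero_le_one' ℝ), setIntegral_union
    (Ioc_disjoint_Ioi le_rfl) measurableSet_Ioi (i0.mono_set Ioc_subset_Ioi_self)
    (i0.mono_set (Ioi_subset_Ioi zero_le_one)), e1, smoothPart, inversionFactor]
  set J := ∫ t in Ioc (0 : ℝ) 1, ((t ^ (α - 1) : ℝ) : ℂ) *
        inversion r (fun z => g z - b) (x + t * Complex.I)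
  generalize vertIntegral α (fun z => g z - b) (-1 / x) = v at e2 ⊢
  have e4 := inv_mul_cancel₀ hI
  linear_combination (Complex.I ^ (α : ℂ))⁻¹ * e2 - (J - ((|x| ^ (2 * α) : ℝ) : ℂ) *
    (x : ℂ) ^ ((-r : ℝ) : ℂ) * (v + inversionRemainder r α (fun z => g z - b) x)) * e4

lemma tendsto_inversionFactor_mul {r α : ℝ} (h : r < 2 * α) {F : ℝ → ℂ} {M : ℝ}
    (hM : ∀ x, ‖F x‖ ≤ M) :
    Tendsto (fun x => inversionFactor α r x * F (-1 / x)) (𝓝[≠] 0) (𝓝 0) := by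
  have h1 := (tendsto_abs_rpow (p := 2 * α - r) (by linarith)).mul_const M
  rw [zero_mul] at h1
  refine squeeze_zero_norm' ?_ h1
  filter_upwards [self_mem_nhdsWithin] with x hx
  rw [norm_mul, norm_inversionFactor _ _ hx]
  gcongr
  exact hM _

/-- The approximate functional equation at the origin for the fractional integrals of a pair of
functions interchanged by inversion. -/
theorem approx_functional_equation_zero {r α s : ℝ} {f g : ℂ → ℂ} {a b : ℂ} (hr : 0 < r)
    (hfd : DifferentiableOn ℂ f halfPlane) (hgd : DifferentiableOn ℂ g halfPlane)
    (hfg : ∀ z ∈ halfPlane, f z = z ^ ((-r : ℝ) : ℂ) * g (-1 / z))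
    (hf : DecayBound s (fun z => f z - a)) (hg : DecayBound s (fun z => g z - b))
    (hs : 0 < s) (hα : s < α) (hrα : r < 2 * α) (hb : b ≠ 0 → r < α) :
    ∃ A : ℝ, A ≠ 0 ∧ ∃ E : ℝ → ℂ, (∀ x : ℝ, x ≠ 0 →
      vertIntegral α (fun z => f z - a) x =
        A * Complex.I ^ ((-α : ℝ) : ℂ) * b * psi α r x +
          inversionFactor α r x * vertIntegral α (fun z => g z - b) (-1 / x) + E x) ∧
      E 0 = vertIntegral α (fun z => f z - a) 0 ∧
      ContDiffOn ℝ 1 E {0}ᶜ ∧ MemPointwiseHolder (2 * α - r + 1) 0 E := by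
  have hα0 : 0 < α := hs.trans hα
  have hhd : DifferentiableOn ℂ (fun z => g z - b) halfPlane := hgd.sub_const b
  obtain ⟨A, hA, k, hk, hK⟩ : ∃ A : ℝ, A ≠ 0 ∧ ∃ k : ℝ → ℂ, (∀ n : ℕ, ContDiffAt ℝ n k 0) ∧
      ∀ᶠ x in 𝓝[≠] 0, b * verticalKernel α r x =
        A * Complex.I ^ ((-α : ℝ) : ℂ) * b * psi α r x + k x := by
    -- If b = 0 the singular term is absent, r < α is not available, and any non-zero A serves.
    by_cases hb0 : b = 0
    · exact ⟨1, one_ne_zero, fun _ => 0, fun n => contDiffAt_const, by simp [hb0]⟩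
    · obtain ⟨A, hA, k, hk, hK⟩ := verticalKernel_expansion hr (hb hb0)
      refine ⟨A, hA, fun x => b * k x, fun n => contDiffAt_const.mul (hk n), ?_⟩
      filter_upwards [hK] with x hx
      rw [hx]; ring
  set F := vertIntegral α (fun z => f z - a) with hF
  set Fg := vertIntegral α (fun z => g z - b) with hFg
  set R := inversionRemainder r α (fun z => g z - b) with hR
  set S := smoothPart r α f (fun z => g z - b) a with hS
  set c : ℂ := A * Complex.I ^ ((-α : ℝ) : ℂ) * b with hc
  -- The value at 0 is prescribed rather than read off the formula; it is the limit of E there,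
  -- since both subtracted terms tend to 0.
  set E : ℝ → ℂ := fun x => if x = 0 then F 0 else
    F x - (c * psi α r x + inversionFactor α r x * Fg (-1 / x)) with hE
  have hE1 : ∀ x, x ≠ 0 → E x = F x - (c * psi α r x + inversionFactor α r x * Fg (-1 / x)) :=
    fun x hx => if_neg hx
  have hE0 : E 0 = F 0 := if_pos rfl
  have hE2 : ∀ x, x ≠ 0 → E x = inversionFactor α r x * R x + S x +
      (b * verticalKernel α r x - c * psi α r x) := by
    intro x hx
    rw [hE1 x hx, hF, vertIntegral_eq_inversion hr hfd hgd hfg hf hg hs hα hx]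
    ring
  have hSd : ∀ x : ℝ, ∀ n : ℕ, ContDiffAt ℝ n S x :=
    contDiffAt_smoothPart hg hhd hf hfd hs.le hα
  -- regularity away from the origin
  have hreg : ContDiffOn ℝ 1 E {0}ᶜ := by
    refine ContDiffOn.congr (f := fun x => inversionFactor α r x * R x + S x +
      (b * verticalKernel α r x - c * psi α r x)) ?_ fun x hx => hE2 x hx
    have hRd := contDiffOn_inversionRemainder (r := r) hg hs.le hhd hα
    intro x hx
    exact ((((contDiffAt_inversionFactor α r hx 1).contDiffWithinAt).mul (hRd x hx)).add
      (hSd x 1).contDiffWithinAt).add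
      (((contDiffAt_const.mul (contDiffAt_verticalKernel hα0 hr hx 1)).sub
        (contDiffAt_const.mul (contDiffAt_psi α r hx 1))).contDiffWithinAt)
  -- continuity at the origin
  have hFc : Continuous F := continuous_vertIntegral hf hs.le (hfd.sub_const a) hα
  obtain ⟨M, hM⟩ := exists_norm_vertIntegral_le hg hα
  have hpsi : Tendsto (fun x => c * psi α r x) (𝓝[≠] 0) (𝓝 0) := by
    by_cases hb0 : b = 0
    · simp [hc, hb0]
    · simpa using (tendsto_psi (hb hb0)).const_mul c
  have hlim : Tendsto E (𝓝[≠] 0) (𝓝 (F 0)) := by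
    have h1 := ((hFc.tendsto 0).mono_left nhdsWithin_le_nhds).sub
      (hpsi.add (tendsto_inversionFactor_mul hrα hM))
    rw [add_zero, sub_zero] at h1
    refine h1.congr' ?_
    filter_upwards [self_mem_nhdsWithin] with x hx using (hE1 x hx).symm
  have hcont : Continuous E := by
    refine continuous_iff_continuousAt.2 fun x => ?_
    by_cases hx : x = 0
    · rw [hx, continuousAt_iff_punctured_nhds, hE0]
      exact hlim
    · exact hreg.continuousOn.continuousAt (isOpen_compl_singleton.mem_nhds hx)
  -- Taylor expansion at the origin
  set G : ℝ → ℂ := fun x => S x + k x with hG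
  have hGd : ∀ n : ℕ, ContDiffAt ℝ n G 0 := fun n => (hSd 0 n).add (hk n)
  obtain ⟨K, hKb⟩ := exists_norm_inversionRemainder_le (r := r) hg hα
  have hEG : ∀ᶠ x in 𝓝[≠] 0, ‖E x - G x‖ ≤ K * |x| ^ (2 * α - r + 1) := by
    filter_upwards [hK, self_mem_nhdsWithin,
      mem_nhdsWithin_of_mem_nhds (closedBall_mem_nhds (0 : ℝ) one_pos)] with x h1 h2 h3
    have h2' : x ≠ 0 := h2
    rw [mem_closedBall_zero_iff, Real.norm_eq_abs] at h3
    have e : E x - G x = inversionFactor α r x * R x := by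
      rw [hE2 x h2', h1]; simp only [hG]; ring
    rw [e, norm_mul, norm_inversionFactor _ _ h2', Real.rpow_add_one (abs_pos.2 h2').ne']
    calc |x| ^ (2 * α - r) * ‖R x‖ ≤ |x| ^ (2 * α - r) * (K * |x|) := by
          gcongr; exact hKb x h3
      _ = _ := by ring
  have hs1 : 0 < 2 * α - r + 1 := by linarith
  -- Continuity forces agreement at 0, which extends the punctured estimate to a full neighbourhood.
  have hG0 : E 0 = G 0 := by
    have h1 : Tendsto (fun x => E x - G x) (𝓝[≠] 0) (𝓝 (E 0 - G 0)) :=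
      ((hcont.tendsto 0).sub (hGd 0).continuousAt.tendsto).mono_left nhdsWithin_le_nhds
    have h2 : Tendsto (fun x => E x - G x) (𝓝[≠] 0) (𝓝 0) := by
      have h3 := (tendsto_abs_rpow hs1).const_mul K
      rw [mul_zero] at h3
      exact squeeze_zero_norm' hEG h3
    exact sub_eq_zero.1 (tendsto_nhds_unique h1 h2)
  obtain ⟨P, hP, hPO⟩ := exists_polynomial_isBigO hGd hs1
  refine ⟨A, hA, E, fun x hx => ?_, hE0, hreg, hcont, P, hP, ?_⟩
  · rw [hE1 x hx]; ring
  · simp only [sub_zero]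
    have h1 : (fun x => E x - G x) =O[𝓝 0] fun x : ℝ => |x| ^ (2 * α - r + 1) := by
      refine Asymptotics.IsBigO.of_bound K ?_
      rw [eventually_nhdsWithin_iff] at hEG
      filter_upwards [hEG] with x hx
      rw [Real.norm_eq_abs, abs_of_nonneg (by positivity)]
      by_cases hx0 : x = 0
      · rw [hx0, hG0, sub_self, norm_zero, abs_zero, Real.zero_rpow hs1.ne', mul_zero]
      · exact hx hx0
    refine (h1.add hPO).congr_left fun x => ?_
    ring

/-! ### Cusp parameters and convergence at infinity -/

/-- A point where G does not vanish shows that κ is admissible exactly when e^{2πiκ} = u; the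
fractional part of arg u / 2π is the least non-negative such κ, so the infimum is attained. -/
lemma cuspParameter_spec {G : ℂ → ℂ} {u : ℂ} (hu : ‖u‖ = 1)
    (hper : ∀ z ∈ halfPlane, G (z + 1) = u * G z) (hne : ∃ z ∈ halfPlane, G z ≠ 0) :
    0 ≤ cuspParameter G ∧ cuspParameter G < 1 ∧
      Complex.exp (2 * Real.pi * Complex.I * cuspParameter G) = u := by
  obtain ⟨z₀, hz₀, hG⟩ := hne
  have hiff : ∀ κ : ℝ, (∀ z : ℂ, 0 < z.im →
      G (z + 1) = Complex.exp (2 * Real.pi * Complex.I * κ) * G z) ↔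
      Complex.exp (2 * Real.pi * Complex.I * κ) = u := by
    refine fun κ => ⟨fun h => ?_, fun h z hz => by rw [h]; exact hper z hz⟩
    exact mul_right_cancel₀ hG ((h z₀ hz₀).symm.trans (hper z₀ hz₀))
  set θ : ℝ := u.arg / (2 * Real.pi) with hθ
  have hθu : Complex.exp (2 * Real.pi * Complex.I * θ) = u := by
    have h1 : 2 * Real.pi * Complex.I * θ = u.arg * Complex.I := by
      rw [hθ]
      push_cast
      have : (Real.pi : ℂ) ≠ 0 := by exact_mod_cast Real.pi_ne_zero
      field_simp
    have h2 := Complex.norm_mul_exp_arg_mul_I u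
    rwa [hu, Complex.ofReal_one, one_mul, ← h1] at h2
  have hint : ∀ (κ : ℝ) (n : ℤ), Complex.exp (2 * Real.pi * Complex.I * ((κ - n : ℝ) : ℂ)) =
      Complex.exp (2 * Real.pi * Complex.I * κ) := by
    intro κ n
    rw [Complex.exp_eq_exp_iff_exists_int]
    exact ⟨-n, by push_cast; ring⟩
  have hfr : Complex.exp (2 * Real.pi * Complex.I * (Int.fract θ : ℝ)) = u := by
    rw [Int.fract, hint, hθu]
  have hleast : IsLeast {κ : ℝ | 0 ≤ κ ∧ ∀ z : ℂ, 0 < z.im →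
      G (z + 1) = Complex.exp (2 * Real.pi * Complex.I * κ) * G z} (Int.fract θ) := by
    refine ⟨⟨Int.fract_nonneg θ, (hiff _).2 hfr⟩, fun κ hκ => ?_⟩
    obtain ⟨h0, h1⟩ := hκ
    have h2 := ((hiff κ).1 h1).trans hfr.symm
    rw [Complex.exp_eq_exp_iff_exists_int] at h2
    obtain ⟨n, hn⟩ := h2
    have h3 : (κ : ℂ) = ((Int.fract θ + n : ℝ) : ℂ) := by
      have h4 := Complex.two_pi_I_ne_zero
      refine mul_left_cancel₀ h4 ?_
      rw [hn]; push_cast; ring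
    have h5 : κ = Int.fract θ + n := by exact_mod_cast h3
    have h6 : (-1 : ℝ) < n := by linarith [Int.fract_lt_one θ]
    have h7 : (-1 : ℤ) < n := by exact_mod_cast h6
    have h8 : (0 : ℝ) ≤ n := by exact_mod_cast (by omega : 0 ≤ n)
    linarith
  have hk : cuspParameter G = Int.fract θ := hleast.csInf_eq
  rw [hk]
  exact ⟨Int.fract_nonneg θ, Int.fract_lt_one θ, hfr⟩

lemma norm_sub_floor {G : ℂ → ℂ} {u : ℂ} (hu : ‖u‖ = 1)
    (hper : ∀ z ∈ halfPlane, G (z + 1) = u * G z) {z : ℂ} (hz : z ∈ halfPlane) :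
    ‖G z‖ = ‖G ((Int.fract z.re : ℝ) + z.im * Complex.I)‖ := by
  have hz' : 0 < z.im := hz
  have hP : Function.Periodic (fun x : ℝ => ‖G (x + z.im * Complex.I)‖) 1 := by
    intro x
    beta_reduce
    have h1 := hper (x + z.im * Complex.I) (vert_mem_halfPlane x hz')
    have h2 : ((x + 1 : ℝ) : ℂ) + z.im * Complex.I = x + z.im * Complex.I + 1 := by
      push_cast; ring
    rw [h2, h1, norm_mul, hu, one_mul]
  have h3 := hP.sub_int_mul_eq (x := z.re) ⌊z.re⌋
  rw [mul_one] at h3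
  rw [Int.fract, h3, Complex.re_add_im]

/-- Exponential convergence of a quasi-periodic holomorphic function of moderate growth. -/
theorem exists_norm_sub_valueAtInfty_le {G : ℂ → ℂ} {u : ℂ} (hd : DifferentiableOn ℂ G halfPlane)
    (hu : ‖u‖ = 1) (hper : ∀ z ∈ halfPlane, G (z + 1) = u * G z) (hne : ∃ z ∈ halfPlane, G z ≠ 0)
    (hpoly : ∃ C K Y : ℝ, ∀ z : ℂ, Y ≤ z.im → 0 ≤ z.re → z.re ≤ 1 → ‖G z‖ ≤ C * z.im ^ K)
    {y₁ : ℝ} (hy₁ : 0 < y₁) :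
    ∃ C c : ℝ, 0 < C ∧ 0 < c ∧ ∀ z : ℂ, y₁ ≤ z.im →
      ‖G z - valueAtInfty G‖ ≤ C * Real.exp (-c * z.im) := by
  obtain ⟨hκ0, hκ1, hκu⟩ := cuspParameter_spec hu hper hne
  set κ := cuspParameter G with hκ
  -- passage to periodic functions
  set Q : ℂ → ℂ := fun z => if 0 < z.im then
    G z * Complex.exp (-(2 * Real.pi * Complex.I * κ * z)) else 0 with hQ
  have hQper : Function.Periodic Q ((1 : ℝ) : ℂ) := by
    intro z
    simp only [hQ, Complex.ofReal_one, Complex.add_im, Complex.one_im, add_zero]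
    split_ifs with hz
    · rw [hper z hz, ← hκu, mul_add, mul_one, neg_add, Complex.exp_add, Complex.exp_neg
        (2 * Real.pi * Complex.I * κ)]
      field_simp [Complex.exp_ne_zero]
    · rfl
  have hQn : ∀ z ∈ halfPlane, ‖Q z‖ = ‖G z‖ * Real.exp (2 * Real.pi * κ * z.im) := by
    intro z hz
    have hz' : 0 < z.im := hz
    simp only [hQ, if_pos hz', norm_mul, Complex.norm_exp]
    congr 2
    simp
  have hIev : ∀ {p : ℂ → Prop}, (∀ z ∈ halfPlane, p z) → ∀ᶠ z in comap Complex.im atTop, p z := by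
    intro p hp
    exact (tendsto_comap.eventually (eventually_gt_atTop (0 : ℝ))).mono fun z hz => hp z hz
  have hQd : ∀ z ∈ halfPlane, DifferentiableAt ℂ Q z := by
    intro z hz
    have h1 : DifferentiableAt ℂ
        (fun z => G z * Complex.exp (-(2 * Real.pi * Complex.I * κ * z))) z :=
      (hd.differentiableAt (isOpen_halfPlane.mem_nhds hz)).mul (by fun_prop)
    refine h1.congr_of_eventuallyEq ?_
    filter_upwards [isOpen_halfPlane.mem_nhds hz] with w hw
    have hw' : 0 < w.im := hw
    simp only [hQ, if_pos hw']
  -- Q may grow like y^K e^{2πκy}, but κ < 1, so the extra factor e^{2πiz} makes Q₁ tend to 0. Its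
  -- decay is then of order e^{-2πy}, and dividing the factor out again shows that Q is bounded.
  set Q₁ : ℂ → ℂ := fun z => Complex.exp (2 * Real.pi * Complex.I * z) * Q z with hQ₁
  have hQ₁per : Function.Periodic Q₁ ((1 : ℝ) : ℂ) := by
    intro z
    simp only [hQ₁]
    rw [hQper z, Complex.ofReal_one, mul_add, mul_one, Complex.exp_add, Complex.exp_two_pi_mul_I,
      mul_one]
  have hQ₁n : ∀ z, ‖Q₁ z‖ = Real.exp (-(2 * Real.pi * z.im)) * ‖Q z‖ := by
    intro z
    simp only [hQ₁, norm_mul, Complex.norm_exp]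
    congr 2
    simp
  have hQ₁d : ∀ z ∈ halfPlane, DifferentiableAt ℂ Q₁ z := fun z hz =>
    DifferentiableAt.mul (by fun_prop) (hQd z hz)
  have hQ₁z : ZeroAtFilter (comap Complex.im atTop) Q₁ := by
    obtain ⟨C, K, Y, hC⟩ := hpoly
    have h1 : Tendsto (fun y : ℝ => C * (y ^ K * Real.exp (-(2 * Real.pi * (1 - κ)) * y)))
        atTop (𝓝 (C * 0)) :=
      (tendsto_rpow_mul_exp_neg_mul_atTop_nhds_zero K _
        (mul_pos Real.two_pi_pos (by linarith))).const_mul C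
    rw [mul_zero] at h1
    refine squeeze_zero_norm' ?_ (h1.comp tendsto_comap)
    filter_upwards [tendsto_comap.eventually (eventually_gt_atTop (0 : ℝ)),
      tendsto_comap.eventually (eventually_ge_atTop Y)] with z hz hY
    have h2 := hC ((Int.fract z.re : ℝ) + z.im * Complex.I) (by simpa using hY)
      (by simp) (by simpa using (Int.fract_lt_one z.re).le)
    rw [← norm_sub_floor hu hper hz] at h2
    rw [hQ₁n, hQn z hz]
    simp only [Function.comp]
    have h3 : ((Int.fract z.re : ℝ) + z.im * Complex.I : ℂ).im = z.im := by simp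
    rw [h3] at h2
    have h4 : Real.exp (-(2 * Real.pi * (1 - κ)) * z.im) =
        Real.exp (-(2 * Real.pi * z.im)) * Real.exp (2 * Real.pi * κ * z.im) := by
      rw [← Real.exp_add]; congr 1; ring
    rw [h4]
    calc Real.exp (-(2 * Real.pi * z.im)) * (‖G z‖ * Real.exp (2 * Real.pi * κ * z.im))
        ≤ Real.exp (-(2 * Real.pi * z.im)) *
          ((C * z.im ^ K) * Real.exp (2 * Real.pi * κ * z.im)) := by gcongr
      _ = _ := by ring
  obtain ⟨C₁, hC₁⟩ := (Function.Periodic.exp_decay_of_zero_at_inf one_pos hQ₁per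
    (hIev hQ₁d) hQ₁z).bound
  have hQb : BoundedAtFilter (comap Complex.im atTop) Q := by
    refine Asymptotics.IsBigO.of_bound C₁ ?_
    filter_upwards [hC₁] with z hz
    rw [hQ₁n, Real.norm_eq_abs, Real.abs_exp] at hz
    have h1 : -2 * Real.pi * z.im / 1 = -(2 * Real.pi * z.im) := by ring
    rw [h1, mul_comm] at hz
    simpa using le_of_mul_le_mul_right hz (Real.exp_pos _)
  obtain ⟨C₂, hC₂⟩ := (Function.Periodic.exp_decay_sub_of_bounded_at_inf one_pos hQper
    (hIev hQd) hQb).bound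
  set q := Function.Periodic.cuspFunction 1 Q 0 with hq
  obtain ⟨Y, -, hY⟩ := (atTop_basis.comap Complex.im).eventually_iff.1 hC₂
  set Y₀ := max Y 1 with hY₀
  have hY₀1 : 1 ≤ Y₀ := le_max_right _ _
  have hQq : ∀ z : ℂ, Y₀ ≤ z.im → ‖Q z - q‖ ≤ C₂ * Real.exp (-(2 * Real.pi) * z.im) := by
    intro z hz
    have h1 := hY (show z ∈ Complex.im ⁻¹' Ici Y from (le_max_left _ _).trans hz)
    rw [Real.norm_eq_abs, Real.abs_exp] at h1
    have h2 : -2 * Real.pi * z.im / 1 = -(2 * Real.pi) * z.im := by ring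
    rwa [h2] at h1
  have hC₂0 : 0 ≤ C₂ := by
    have h1 := (norm_nonneg _).trans (hQq (Y₀ * Complex.I) (by simp))
    exact nonneg_of_mul_nonneg_left h1 (Real.exp_pos _)
  -- the expansion for large imaginary part
  obtain ⟨C₃, c, hC₃, hc, hexp⟩ : ∃ C c : ℝ, 0 ≤ C ∧ 0 < c ∧ ∀ z : ℂ, Y₀ ≤ z.im →
      ‖G z - valueAtInfty G‖ ≤ C * Real.exp (-c * z.im) := by
    by_cases hk : κ = 0
    · have hQG : ∀ z ∈ halfPlane, Q z = G z := by
        intro z hz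
        have hz' : 0 < z.im := hz
        simp only [hQ, if_pos hz', hk]
        simp
      have hper' : ∀ z ∈ halfPlane, G (z + 1) = G z := by
        intro z hz
        rw [hper z hz, ← hκu, hk]
        simp
      have hv : valueAtInfty G = ∫ x in (0 : ℝ)..1, G (x + (1 : ℝ) * Complex.I) := by
        rw [valueAtInfty, if_pos (by rw [← hκ, hk]), fourierCoeff, ← hκ, hk]
        simp
      -- The horizontal mean of G is independent of the height, so it equals the limit of Q at
      -- infinity.
      have hvq : valueAtInfty G = q := by
        have h1 : ∀ t : ℝ, Y₀ ≤ t →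
            ‖valueAtInfty G - q‖ ≤ C₂ * Real.exp (-(2 * Real.pi) * t) := by
          intro t ht
          have ht0 : 0 < t := by linarith
          have h2 : valueAtInfty G - q = ∫ x in (0 : ℝ)..1, (G (x + t * Complex.I) - q) := by
            rw [intervalIntegral.integral_sub _ intervalIntegrable_const, hv,
              integral_horizontal_eq hd hper' one_pos ht0]
            · simp
            · refine ContinuousOn.intervalIntegrable (hd.continuousOn.comp (by fun_prop)
                fun x _ => vert_mem_halfPlane x ht0)
          rw [h2]
          have h3 := intervalIntegral.norm_integral_le_of_norm_le_const
            (C := C₂ * Real.exp (-(2 * Real.pi) * t)) (a := 0) (b := 1)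
            (f := fun x : ℝ => G (x + t * Complex.I) - q) (fun x _ => by
              have h4 := hQq (x + t * Complex.I) (by simpa using ht)
              rw [hQG _ (vert_mem_halfPlane x ht0)] at h4
              simpa using h4)
          simpa using h3
        have h2 : Tendsto (fun t : ℝ => C₂ * Real.exp (-(2 * Real.pi) * t)) atTop (𝓝 (C₂ * 0)) := by
          have := (tendsto_rpow_mul_exp_neg_mul_atTop_nhds_zero 0 _ Real.two_pi_pos).const_mul C₂
          simpa only [Real.rpow_zero, one_mul] using this
        rw [mul_zero] at h2
        have h3 : ‖valueAtInfty G - q‖ ≤ 0 := ge_of_tendsto h2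
          ((eventually_ge_atTop Y₀).mono fun t ht => h1 t ht)
        exact sub_eq_zero.1 (norm_le_zero_iff.1 h3)
      refine ⟨C₂, 2 * Real.pi, hC₂0, Real.two_pi_pos, fun z hz => ?_⟩
      have h1 := hQq z hz
      rwa [hQG z (show 0 < z.im by linarith), ← hvq] at h1
    -- For κ > 0 boundedness of Q is enough: untwisting supplies the factor e^{-2πκy}.
    · have hk0 : 0 < κ := lt_of_le_of_ne hκ0 (Ne.symm hk)
      have hv : valueAtInfty G = 0 := by rw [valueAtInfty, if_neg (by rw [← hκ]; exact hk)]
      refine ⟨C₂ + ‖q‖, 2 * Real.pi * κ, by positivity, by positivity, fun z hz => ?_⟩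
      have hz0 : 0 < z.im := by linarith
      have h1 := hQq z hz
      have h2 : ‖Q z‖ ≤ C₂ + ‖q‖ := by
        have h3 : Real.exp (-(2 * Real.pi) * z.im) ≤ 1 :=
          Real.exp_le_one_iff.2 (by nlinarith [Real.pi_pos])
        have h4 := norm_le_norm_add_norm_sub q (Q z)
        rw [norm_sub_rev] at h4
        nlinarith
      rw [hQn z hz0] at h2
      rw [hv, sub_zero]
      calc ‖G z‖ = ‖G z‖ * Real.exp (2 * Real.pi * κ * z.im) *
            Real.exp (-(2 * Real.pi * κ) * z.im) := by
            rw [mul_assoc, ← Real.exp_add]; simp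
        _ ≤ _ := by gcongr
  -- the remaining compact range
  have hK : IsCompact ((fun p : ℝ × ℝ => (p.1 : ℂ) + p.2 * Complex.I) ''
      (Icc (0 : ℝ) 1 ×ˢ Icc y₁ Y₀)) :=
    (isCompact_Icc.prod isCompact_Icc).image (by fun_prop)
  obtain ⟨M, hM⟩ := hK.exists_bound_of_continuousOn (f := G) (hd.continuousOn.mono (by
    rintro _ ⟨p, hp, rfl⟩
    exact vert_mem_halfPlane _ (hy₁.trans_le hp.2.1)))
  set V := ‖valueAtInfty G‖ with hV
  refine ⟨C₃ + (|M| + V) * Real.exp (c * Y₀) + 1, c, by positivity, hc, fun z hz => ?_⟩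
  have hz0 : 0 < z.im := hy₁.trans_le hz
  have he := Real.exp_pos (-c * z.im)
  have hp : 0 ≤ (|M| + V) * Real.exp (c * Y₀) := by positivity
  rcases le_total Y₀ z.im with h | h
  · refine (hexp z h).trans ?_
    gcongr
    linarith
  · have h1 : ‖G z‖ ≤ M := by
      rw [norm_sub_floor hu hper hz0]
      exact hM _ ⟨(Int.fract z.re, z.im),
        ⟨⟨Int.fract_nonneg _, (Int.fract_lt_one _).le⟩, hz, h⟩, rfl⟩
    have h2 : 1 ≤ Real.exp (c * Y₀) * Real.exp (-c * z.im) := by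
      rw [← Real.exp_add]
      exact Real.one_le_exp (by nlinarith)
    have h3 : ‖G z - valueAtInfty G‖ ≤ |M| + V :=
      (norm_sub_le _ _).trans (by gcongr; exact h1.trans (le_abs_self M))
    have h4 : 0 ≤ |M| + V := by positivity
    calc ‖G z - valueAtInfty G‖ ≤ (|M| + V) * (Real.exp (c * Y₀) * Real.exp (-c * z.im)) := by
          nlinarith
      _ = ((|M| + V) * Real.exp (c * Y₀)) * Real.exp (-c * z.im) := by ring
      _ ≤ _ := by
          gcongr
          linarith

/-! ### Fractional linear transformations -/

lemma autFactor_ne_zero {M : Matrix (Fin 2) (Fin 2) ℝ} (hM : M.det = 1) {z : ℂ} (hz : 0 < z.im) :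
    autFactor M z ≠ 0 := by
  intro h
  have h1 := congrArg Complex.im h
  have h2 := congrArg Complex.re h
  simp [autFactor] at h1 h2
  rcases h1 with h1 | h1
  · rw [h1] at h2
    rw [det_fin_two, h1] at hM
    simp only [zero_mul, zero_add] at h2
    rw [h2] at hM
    simp at hM
  · exact hz.ne' h1

lemma moebius_im {M : Matrix (Fin 2) (Fin 2) ℝ} (hM : M.det = 1) (z : ℂ) :
    (moebius M z).im = z.im / ‖autFactor M z‖ ^ 2 := by
  rw [moebius, Complex.div_im, ← Complex.normSq_eq_norm_sq, ← sub_div]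
  congr 1
  rw [det_fin_two] at hM
  simp [autFactor]
  linear_combination z.im * hM

lemma moebius_mem_halfPlane {M : Matrix (Fin 2) (Fin 2) ℝ} (hM : M.det = 1) {z : ℂ}
    (hz : z ∈ halfPlane) : moebius M z ∈ halfPlane := by
  have hz' : 0 < z.im := hz
  have := norm_pos_iff.2 (autFactor_ne_zero hM hz')
  rw [mem_ofPred_eq, moebius_im hM]
  positivity

lemma autFactor_mul (M : Matrix (Fin 2) (Fin 2) ℝ) {N : Matrix (Fin 2) (Fin 2) ℝ} {z : ℂ}
    (h : autFactor N z ≠ 0) :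
    autFactor (M * N) z = autFactor M (moebius N z) * autFactor N z := by
  conv_rhs => rw [autFactor, moebius, add_mul, mul_assoc, div_mul_cancel₀ _ h]
  simp only [autFactor, mul_apply, Fin.sum_univ_two]
  push_cast
  ring

lemma moebius_mul (M : Matrix (Fin 2) (Fin 2) ℝ) {N : Matrix (Fin 2) (Fin 2) ℝ} {z : ℂ}
    (h : autFactor N z ≠ 0) : moebius (M * N) z = moebius M (moebius N z) := by
  conv_lhs => rw [moebius, autFactor_mul M h]
  conv_rhs => rw [moebius, ← mul_div_mul_right _ _ h]
  congr 1
  conv_rhs => rw [add_mul, mul_assoc, moebius, div_mul_cancel₀ _ h]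
  simp only [autFactor, mul_apply, Fin.sum_univ_two]
  push_cast
  ring

lemma moebius_neg (M : Matrix (Fin 2) (Fin 2) ℝ) (z : ℂ) : moebius (-M) z = moebius M z := by
  simp only [moebius, autFactor, Matrix.neg_apply]
  rw [← neg_div_neg_eq]
  push_cast
  congr 1 <;> ring

lemma autFactor_neg (M : Matrix (Fin 2) (Fin 2) ℝ) (z : ℂ) :
    autFactor (-M) z = -autFactor M z := by
  simp only [autFactor, Matrix.neg_apply]
  push_cast
  ring

lemma moebius_one (z : ℂ) : moebius 1 z = z := by simp [moebius, autFactor]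

lemma specialLinearGroup_mul_apply (g h : SpecialLinearGroup (Fin 2) ℤ) (i j : Fin 2) :
    (g * h) i j = g i 0 * h 0 j + g i 1 * h 1 j :=
  Matrix.mul_apply.trans (Fin.sum_univ_two _)

lemma realMat_apply (g : SpecialLinearGroup (Fin 2) ℤ) (i j : Fin 2) :
    realMat g i j = (g i j : ℝ) := rfl

lemma realMat_mul (g h : SpecialLinearGroup (Fin 2) ℤ) :
    realMat (g * h) = realMat g * realMat h := by
  ext i j
  rw [mul_apply, Fin.sum_univ_two]
  simp only [realMat_apply]
  rw [specialLinearGroup_mul_apply]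
  push_cast
  rfl

lemma realMat_one : realMat 1 = 1 := by
  ext i j
  fin_cases i <;> fin_cases j <;> simp [realMat]

lemma realMat_neg (g : SpecialLinearGroup (Fin 2) ℤ) : realMat (-g) = -realMat g := by
  ext i j
  simp [realMat]

lemma det_realMat (g : SpecialLinearGroup (Fin 2) ℤ) : (realMat g).det = 1 := by
  have h := g.det_coe
  rw [det_fin_two] at h ⊢
  simp only [realMat, map_apply]
  exact_mod_cast h

lemma moebius_realMat_inv {g : SpecialLinearGroup (Fin 2) ℤ} {z : ℂ} (hz : 0 < z.im) :
    moebius (realMat g⁻¹) (moebius (realMat g) z) = z := by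
  rw [← moebius_mul _ (autFactor_ne_zero (det_realMat g) hz), ← realMat_mul, inv_mul_cancel,
    realMat_one, moebius_one]

/-- The dilation `diag(√m, 1/√m)`. -/
noncomputable def dilation (m : ℝ) : Matrix (Fin 2) (Fin 2) ℝ := !![√m, 0; 0, 1 / √m]

lemma det_dilation {m : ℝ} (hm : 0 < m) : (dilation m).det = 1 := by
  have := (Real.sqrt_pos.2 hm).ne'
  rw [dilation, det_fin_two_of]
  field_simp
  simp

lemma autFactor_dilation (m : ℝ) (z : ℂ) : autFactor (dilation m) z = ((1 / √m : ℝ) : ℂ) := by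
  simp [autFactor, dilation]

lemma moebius_dilation {m : ℝ} (hm : 0 ≤ m) (z : ℂ) : moebius (dilation m) z = m * z := by
  rw [moebius, autFactor_dilation]
  have h : ((√m : ℝ) : ℂ) * ((√m : ℝ) : ℂ) = m := by
    rw [← Complex.ofReal_mul, Real.mul_self_sqrt hm]
  simp only [dilation]
  simp
  linear_combination z * h

/-! ### The slash operator -/

lemma differentiableOn_autFactor_cpow (M : Matrix (Fin 2) (Fin 2) ℝ) (c : ℂ) :
    DifferentiableOn ℂ (fun z => autFactor M z ^ c) halfPlane := by
  by_cases h : M 1 0 = 0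
  · simp only [autFactor, h, Complex.ofReal_zero, zero_mul]
    exact differentiableOn_const _
  · refine DifferentiableOn.cpow_const (by unfold autFactor; fun_prop) fun z hz => ?_
    have hz' : 0 < z.im := hz
    refine Complex.mem_slitPlane_iff.2 (Or.inr ?_)
    simp [autFactor, h, hz'.ne']

lemma differentiableOn_moebius {M : Matrix (Fin 2) (Fin 2) ℝ} (hM : M.det = 1) :
    DifferentiableOn ℂ (moebius M) halfPlane := by
  refine DifferentiableOn.div (c := fun z => (M 0 0 : ℂ) * z + (M 0 1 : ℂ)) (d := autFactor M)
    (by fun_prop) (by unfold autFactor; fun_prop) fun z hz => autFactor_ne_zero hM hz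

lemma cpow_ne_zero_of_ne {z : ℂ} (hz : z ≠ 0) (c : ℂ) : z ^ c ≠ 0 := by
  rw [Ne, Complex.cpow_eq_zero_iff]
  tauto

lemma differentiableOn_slash {r : ℝ} {M : Matrix (Fin 2) (Fin 2) ℝ} (hM : M.det = 1) {f : ℂ → ℂ}
    (hf : DifferentiableOn ℂ f halfPlane) : DifferentiableOn ℂ (slash r M f) halfPlane := by
  refine DifferentiableOn.div (c := fun z => ((M.det ^ (r / 2) : ℝ) : ℂ) * f (moebius M z))
    ((differentiableOn_const _).mul (hf.comp (differentiableOn_moebius hM)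
      fun z hz => moebius_mem_halfPlane hM hz)) (differentiableOn_autFactor_cpow M r)
      fun z hz => cpow_ne_zero_of_ne (autFactor_ne_zero hM hz) _

lemma slash_of_det {r : ℝ} {M : Matrix (Fin 2) (Fin 2) ℝ} (hM : M.det = 1) (f : ℂ → ℂ) (z : ℂ) :
    slash r M f z = f (moebius M z) / autFactor M z ^ (r : ℂ) := by
  rw [slash, hM, Real.one_rpow, Complex.ofReal_one, one_mul]

/-- The invariant size `|f(w)| (Im w)^{r/2}` of a form of weight `r`. -/
noncomputable def weightNorm (r : ℝ) (f : ℂ → ℂ) (w : ℂ) : ℝ := ‖f w‖ * w.im ^ (r / 2)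

lemma norm_slash_mul {r : ℝ} {M : Matrix (Fin 2) (Fin 2) ℝ} (hM : M.det = 1) (f : ℂ → ℂ) {z : ℂ}
    (hz : z ∈ halfPlane) :
    ‖slash r M f z‖ * z.im ^ (r / 2) = weightNorm r f (moebius M z) := by
  have hz' : 0 < z.im := hz
  have hj := norm_pos_iff.2 (autFactor_ne_zero hM hz')
  rw [slash_of_det hM, weightNorm, moebius_im hM, norm_div, Complex.norm_cpow_real,
    Real.div_rpow hz'.le (by positivity), ← Real.rpow_natCast, ← Real.rpow_mul hj.le]
  have : ((2 : ℕ) : ℝ) * (r / 2) = r := by push_cast; ring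
  rw [this]
  ring

lemma weightNorm_moebius_of_mem {r : ℝ} {Γ : Subgroup (SpecialLinearGroup (Fin 2) ℤ)} {μ : Γ → ℂ}
    {f : ℂ → ℂ} (hf : IsModularForm r Γ μ f) {g : SpecialLinearGroup (Fin 2) ℤ} (hg : g ∈ Γ)
    {w : ℂ} (hw : w ∈ halfPlane) :
    weightNorm r f (moebius (realMat g) w) = weightNorm r f w := by
  have hM := det_realMat g
  have h1 := hf.transform ⟨g, hg⟩ w hw
  rw [← norm_slash_mul hM f hw, slash_of_det hM, h1, norm_div, norm_mul, norm_mul,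
    hf.norm_multiplier, one_mul, weightNorm]
  have := norm_ne_zero_iff.2 (cpow_ne_zero_of_ne (autFactor_ne_zero hM hw) (r : ℂ))
  congr 1
  field_simp

/-! ### Cusp stabilizers, widths and periodicity -/

lemma mem_or_neg_mem_of_mem_sup {Γ : Subgroup (SpecialLinearGroup (Fin 2) ℤ)}
    {g : SpecialLinearGroup (Fin 2) ℤ} (hg : g ∈ Γ ⊔ Subgroup.zpowers (-1)) : g ∈ Γ ∨ -g ∈ Γ := by
  let H : Subgroup (SpecialLinearGroup (Fin 2) ℤ) :=
    { carrier := {g | g ∈ Γ ∨ -g ∈ Γ}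
      mul_mem' := by
        rintro a b (ha | ha) (hb | hb)
        · exact Or.inl (mul_mem ha hb)
        · exact Or.inr (by simpa using mul_mem ha hb)
        · exact Or.inr (by simpa using mul_mem ha hb)
        · exact Or.inl (by simpa using mul_mem ha hb)
      one_mem' := Or.inl (one_mem Γ)
      inv_mem' := by
        rintro a (ha | ha)
        · exact Or.inl (inv_mem ha)
        · exact Or.inr (by simpa using inv_mem ha) }
  have h1 : Γ ⊔ Subgroup.zpowers (-1) ≤ H := by
    refine sup_le (fun a ha => Or.inl ha) ?_
    rw [Subgroup.zpowers_le]
    exact Or.inr (by simp)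
  exact h1 hg

lemma mem_cuspStabilizer_smul_infty {g x : SpecialLinearGroup (Fin 2) ℤ} :
    x ∈ cuspStabilizer (SpecialLinearGroup.mapGL ℚ g • (OnePoint.infty : OnePoint ℚ)) ↔
      (g⁻¹ * x * g) 1 0 = 0 := by
  rw [cuspStabilizer, Subgroup.mem_comap, MulAction.mem_stabilizer_iff, ← mul_smul, ← map_mul,
    ← inv_smul_eq_iff, ← map_inv, ← mul_smul, ← map_mul, ← mul_assoc,
    OnePoint.smul_infty_eq_self_iff]
  generalize g⁻¹ * x * g = y
  simp

/-- An integral upper triangular matrix of determinant one has diagonal (1, 1) or (-1, -1), so such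
matrices are translations up to sign. -/
lemma mul_comm_of_lower_left_eq_zero {a b : SpecialLinearGroup (Fin 2) ℤ} (ha : a 1 0 = 0)
    (hb : b 1 0 = 0) : a * b = b * a := by
  have da := a.det_coe
  have db := b.det_coe
  rw [det_fin_two, ha, mul_zero, sub_zero] at da
  rw [det_fin_two, hb, mul_zero, sub_zero] at db
  have ea : a 0 0 = a 1 1 := by
    rcases Int.mul_eq_one_iff_eq_one_or_neg_one.1 da with h | h <;> rw [h.1, h.2]
  have eb : b 0 0 = b 1 1 := by
    rcases Int.mul_eq_one_iff_eq_one_or_neg_one.1 db with h | h <;> rw [h.1, h.2]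
  refine Matrix.SpecialLinearGroup.ext _ _ fun i j => ?_
  rw [specialLinearGroup_mul_apply, specialLinearGroup_mul_apply]
  fin_cases i <;> fin_cases j <;> simp only [Fin.zero_eta, Fin.mk_one, ha, hb, ea, eb] <;> ring

/-- Parabolic elements: the width of a cusp is positive, and the corresponding power of the
generator of the unipotent stabilizer lies in the group up to sign. -/
theorem exists_conj_T_pow_mem {Γ : Subgroup (SpecialLinearGroup (Fin 2) ℤ)} (hΓ : Γ.FiniteIndex)
    (g : SpecialLinearGroup (Fin 2) ℤ) {m : ℕ}
    (hm : m = cuspWidth Γ (SpecialLinearGroup.mapGL ℚ g • (OnePoint.infty : OnePoint ℚ))) :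
    0 < m ∧ (g * ModularGroup.T ^ m * g⁻¹ ∈ Γ ∨ -(g * ModularGroup.T ^ m * g⁻¹) ∈ Γ) := by
  set S := cuspStabilizer (SpecialLinearGroup.mapGL ℚ g • (OnePoint.infty : OnePoint ℚ)) with hS
  set H := Γ ⊔ Subgroup.zpowers (-1) with hH
  have hHf : H.FiniteIndex := Subgroup.finiteIndex_of_le (le_sup_left : Γ ≤ H)
  -- The stabilizer is conjugate to the upper triangular group, hence abelian. The intersection with
  -- Γ·{±1} is thus normal in it, and raising an element to the index lands in that intersection.
  have hcomm : ∀ a b : S, a * b = b * a := by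
    intro a b
    have ha := mem_cuspStabilizer_smul_infty.1 a.2
    have hb := mem_cuspStabilizer_smul_infty.1 b.2
    set a' := g⁻¹ * (a : SpecialLinearGroup (Fin 2) ℤ) * g with ha'
    set b' := g⁻¹ * (b : SpecialLinearGroup (Fin 2) ℤ) * g with hb'
    have h1 : a' * b' = b' * a' := mul_comm_of_lower_left_eq_zero ha hb
    have h2 : (a : SpecialLinearGroup (Fin 2) ℤ) * b = b * a := by
      have h3 := congrArg (fun x => g * x * g⁻¹) h1
      simpa [ha', hb', mul_assoc] using h3
    exact Subtype.ext h2
  have hN : (H.subgroupOf S).Normal := ⟨fun n hn x => by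
    rw [hcomm x n, mul_inv_cancel_right]; exact hn⟩
  have hmS : m = (H.subgroupOf S).index := hm
  have hT : g * ModularGroup.T * g⁻¹ ∈ S := by
    rw [hS, mem_cuspStabilizer_smul_infty]
    have : g⁻¹ * (g * ModularGroup.T * g⁻¹) * g = ModularGroup.T := by group
    rw [this]
    simp [ModularGroup.T]
  constructor
  · have h1 : (H.subgroupOf S).FiniteIndex := inferInstance
    rw [hmS]
    exact Nat.pos_of_ne_zero h1.index_ne_zero
  · have h1 := (H.subgroupOf S).pow_index_mem ⟨_, hT⟩
    rw [← hmS, Subgroup.mem_subgroupOf, Subgroup.coe_pow, Subtype.coe_mk, conj_pow] at h1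
    exact mem_or_neg_mem_of_mem_sup h1

lemma moebius_translation (z : ℂ) : moebius !![1, 1; 0, 1] z = z + 1 := by
  simp [moebius, autFactor]

lemma autFactor_translation (z : ℂ) : autFactor !![1, 1; 0, 1] z = 1 := by
  simp [autFactor]

lemma realMat_T_pow_mul_dilation (m : ℕ) :
    realMat (ModularGroup.T ^ m) * dilation m = dilation m * !![1, 1; 0, 1] := by
  have h : realMat (ModularGroup.T ^ m) = !![1, (m : ℝ); 0, 1] := by
    have h1 := ModularGroup.coe_T_zpow m
    rw [zpow_natCast] at h1
    rw [realMat, h1]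
    ext i j
    fin_cases i <;> fin_cases j <;> simp
  rw [h, dilation]
  ext i j
  fin_cases i <;> fin_cases j <;> simp [mul_apply, Fin.sum_univ_two, ← div_eq_mul_inv]

/-- The form transformed to the cusp `g ∞`, scaled to have period one. -/
theorem exists_slash_add_one {r : ℝ} {Γ : Subgroup (SpecialLinearGroup (Fin 2) ℤ)} {μ : Γ → ℂ}
    {f : ℂ → ℂ} (hf : IsModularForm r Γ μ f) (hΓ : Γ.FiniteIndex)
    (g : SpecialLinearGroup (Fin 2) ℤ) {m : ℕ}
    (hm : m = cuspWidth Γ (SpecialLinearGroup.mapGL ℚ g • (OnePoint.infty : OnePoint ℚ))) :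
    ∃ u : ℂ, ‖u‖ = 1 ∧ ∀ z ∈ halfPlane,
      slash r (realMat g * dilation m) f (z + 1) = u * slash r (realMat g * dilation m) f z := by
  obtain ⟨hm0, hη⟩ := exists_conj_T_pow_mem hΓ g hm
  set σ := realMat g * dilation m with hσ
  have hσd : σ.det = 1 := by
    rw [hσ, det_mul, det_realMat, det_dilation (by exact_mod_cast hm0), one_mul]
  -- Only one of ± the parabolic element need lie in Γ. The sign ε records which; it leaves the
  -- Möbius action unchanged and has modulus one.
  obtain ⟨η, hηΓ, ε, hε, hηm, hηj⟩ : ∃ η ∈ Γ, ∃ ε : ℂ, ‖ε‖ = 1 ∧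
      (∀ z, moebius (realMat η * σ) z = moebius (σ * !![1, 1; 0, 1]) z) ∧
      ∀ z, autFactor (realMat η * σ) z = ε * autFactor (σ * !![1, 1; 0, 1]) z := by
    have h1 : realMat (g * ModularGroup.T ^ m * g⁻¹) * σ = σ * !![1, 1; 0, 1] := by
      rw [hσ, ← mul_assoc, ← realMat_mul, inv_mul_cancel_right, realMat_mul, mul_assoc,
        realMat_T_pow_mul_dilation, mul_assoc]
    rcases hη with h | h
    · exact ⟨_, h, 1, norm_one, fun z => by rw [h1], fun z => by rw [h1, one_mul]⟩
    · refine ⟨_, h, -1, by simp, fun z => ?_, fun z => ?_⟩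
      · rw [realMat_neg, neg_mul, h1, moebius_neg]
      · rw [realMat_neg, neg_mul, h1, autFactor_neg]; ring
  have ht : ∀ z, autFactor !![1, 1; 0, 1] z ≠ 0 := fun z => by
    rw [autFactor_translation]; exact one_ne_zero
  have hadd : ∀ {z : ℂ}, z ∈ halfPlane → z + 1 ∈ halfPlane := fun {z} hz => by
    have hz' : 0 < z.im := hz
    rw [mem_ofPred_eq]; simpa using hz'
  have e1 : ∀ z ∈ halfPlane, moebius σ (z + 1) = moebius (realMat η) (moebius σ z) := by
    intro z hz
    rw [← moebius_translation z, ← moebius_mul _ (ht z), ← hηm,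
      moebius_mul _ (autFactor_ne_zero hσd hz)]
  have e2 : ∀ z ∈ halfPlane, autFactor (realMat η) (moebius σ z) * autFactor σ z =
      ε * autFactor σ (z + 1) := by
    intro z hz
    rw [← autFactor_mul _ (autFactor_ne_zero hσd hz), hηj, autFactor_mul _ (ht z),
      moebius_translation, autFactor_translation, mul_one]
  -- For real weight the cocycle relation holds only up to a branch factor. This quotient is
  -- holomorphic of modulus one, hence constant, so the branches need not be computed.
  set v : ℂ → ℂ := fun z => μ ⟨η, hηΓ⟩ * (autFactor (realMat η) (moebius σ z) ^ (r : ℂ) *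
    autFactor σ z ^ (r : ℂ) / autFactor σ (z + 1) ^ (r : ℂ)) with hv
  have hj : ∀ z ∈ halfPlane, autFactor σ z ^ (r : ℂ) ≠ 0 := fun z hz =>
    cpow_ne_zero_of_ne (autFactor_ne_zero hσd hz) _
  obtain ⟨u, hu, huv⟩ := exists_eq_const_of_norm_eq_one (u := v) (by
      refine (differentiableOn_const _).mul (DifferentiableOn.div
        (((differentiableOn_autFactor_cpow _ _).comp (differentiableOn_moebius hσd)
          fun z hz => moebius_mem_halfPlane hσd hz).mul (differentiableOn_autFactor_cpow _ _))
        ((differentiableOn_autFactor_cpow σ r).comp (f := fun z => z + 1) (by fun_prop)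
          fun z hz => hadd hz) fun z hz => hj _ (hadd hz))) (by
      intro z hz
      have h1 := congrArg norm (e2 z hz)
      rw [norm_mul, norm_mul, hε, one_mul] at h1
      simp only [hv, norm_mul, norm_div, hf.norm_multiplier, Complex.norm_cpow_real, one_mul]
      rw [← Real.mul_rpow (norm_nonneg _) (norm_nonneg _), h1, div_self]
      exact (Real.rpow_pos_of_pos (norm_pos_iff.2 (autFactor_ne_zero hσd (hadd hz))) _).ne')
  refine ⟨u, hu, fun z hz => ?_⟩
  rw [← huv z hz, slash_of_det hσd, slash_of_det hσd, e1 z hz]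
  have h1 := hf.transform ⟨η, hηΓ⟩ (moebius σ z) (moebius_mem_halfPlane hσd hz)
  rw [h1]
  have h2 := hj z hz
  simp only [hv]
  field_simp

/-! ### Growth of a modular form -/

/-- The growth hypothesis speaks only about points near the real axis, so infinity must be sent to a
finite cusp. If g fixes infinity, a power of the lower unipotent matrix lying in Γ achieves this
without changing the invariant size of f. -/
lemma exists_lower_left_ne_zero {r : ℝ} {Γ : Subgroup (SpecialLinearGroup (Fin 2) ℤ)} {μ : Γ → ℂ}
    {f : ℂ → ℂ} (hf : IsModularForm r Γ μ f) (hΓ : Γ.FiniteIndex)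
    (g : SpecialLinearGroup (Fin 2) ℤ) :
    ∃ g' : SpecialLinearGroup (Fin 2) ℤ, g' 1 0 ≠ 0 ∧ ∀ w ∈ halfPlane,
      weightNorm r f (moebius (realMat g') w) = weightNorm r f (moebius (realMat g) w) := by
  by_cases h : g 1 0 = 0
  · let L : SpecialLinearGroup (Fin 2) ℤ := ⟨!![1, 0; 1, 1], by simp [det_fin_two]⟩
    have hL : ∀ n : ℕ, (L ^ n) 1 0 = n ∧ (L ^ n) 1 1 = 1 := by
      intro n
      induction n with
      | zero => simp
      | succ n ih =>
        rw [pow_succ, specialLinearGroup_mul_apply, specialLinearGroup_mul_apply, ih.1, ih.2]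
        simp [L]
    obtain ⟨n, hn, -, hmem⟩ := Subgroup.exists_pow_mem_of_index_ne_zero hΓ.index_ne_zero L
    refine ⟨L ^ n * g, ?_, fun w hw => ?_⟩
    · rw [specialLinearGroup_mul_apply, h, mul_zero, add_zero, (hL n).1]
      have hd := g.det_coe
      rw [det_fin_two, h, mul_zero, sub_zero] at hd
      exact mul_ne_zero (by exact_mod_cast hn.ne') (left_ne_zero_of_mul_eq_one hd)
    · rw [realMat_mul, moebius_mul _ (autFactor_ne_zero (det_realMat g) hw),
        weightNorm_moebius_of_mem hf hmem (moebius_mem_halfPlane (det_realMat g) hw)]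
  · exact ⟨g, h, fun _ _ => rfl⟩

/-- Moderate growth at the cusps. -/
lemma exists_weightNorm_le {r : ℝ} {Γ : Subgroup (SpecialLinearGroup (Fin 2) ℤ)} {μ : Γ → ℂ}
    {f : ℂ → ℂ} (hf : IsModularForm r Γ μ f) (hΓ : Γ.FiniteIndex)
    (g : SpecialLinearGroup (Fin 2) ℤ) {X : ℝ} (hX : 0 ≤ X) :
    ∃ C K Y : ℝ, 0 < Y ∧ ∀ z : ℂ, Y ≤ z.im → 0 ≤ z.re → z.re ≤ X →
      weightNorm r f (moebius (realMat g) z) ≤ C * z.im ^ K := by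
  obtain ⟨g', hg', hgg'⟩ := exists_lower_left_ne_zero hf hΓ g
  obtain ⟨C, K, δ, hδ, hC⟩ := hf.growth
  set c : ℝ := (g' 1 0 : ℝ) with hc
  set d : ℝ := (g' 1 1 : ℝ) with hd
  have hc1 : 1 ≤ |c| := by
    rw [hc]; exact_mod_cast Int.one_le_abs hg'
  set L : ℝ := |c| * (X + 1) + |d| with hL
  have hL0 : 0 < L := by positivity
  set p := r / 2 - K with hp
  refine ⟨|C| * ((1 / L ^ 2) ^ p + 1), -p, max 1 (2 / δ), by positivity, fun z hz h0 h1 => ?_⟩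
  have hz1 : 1 ≤ z.im := (le_max_left _ _).trans hz
  have hz2 : 2 / δ ≤ z.im := (le_max_right _ _).trans hz
  have hz0 : 0 < z.im := by linarith
  have hM := det_realMat g'
  have hj : autFactor (realMat g') z = c * z + d := rfl
  have hj1 : z.im ≤ ‖autFactor (realMat g') z‖ := by
    have h2 := Complex.abs_im_le_norm (autFactor (realMat g') z)
    rw [hj] at h2 ⊢
    simp only [Complex.add_im, Complex.mul_im, Complex.ofReal_re, Complex.ofReal_im, zero_mul,
      add_zero, abs_mul, abs_of_pos hz0] at h2
    nlinarith
  have hj2 : ‖autFactor (realMat g') z‖ ≤ L * z.im := by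
    rw [hj]
    refine (norm_add_le _ _).trans ?_
    rw [norm_mul, Complex.norm_real, Complex.norm_real, Real.norm_eq_abs, Real.norm_eq_abs]
    have h2 := Complex.norm_le_abs_re_add_abs_im z
    rw [abs_of_nonneg h0, abs_of_pos hz0] at h2
    have h3 : ‖z‖ ≤ (X + 1) * z.im := by nlinarith
    have h4 : |d| ≤ |d| * z.im := le_mul_of_one_le_right (abs_nonneg d) hz1
    have h5 : |c| * ‖z‖ ≤ |c| * ((X + 1) * z.im) := by gcongr
    rw [hL]
    linarith
  set w := moebius (realMat g') z with hw
  have hjp : 0 < ‖autFactor (realMat g') z‖ := hz0.trans_le hj1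
  have hwim : w.im = z.im / ‖autFactor (realMat g') z‖ ^ 2 := moebius_im hM z
  have hw0 : 0 < w.im := by rw [hwim]; positivity
  -- In the strip |cz + d| lies between y and Ly, so the image has height comparable with 1/y and
  -- falls below δ once y is large.
  have hw1 : w.im ≤ 1 / z.im := by
    rw [hwim, div_le_div_iff₀ (by positivity) hz0]
    nlinarith
  have hw2 : 1 / (L ^ 2 * z.im) ≤ w.im := by
    rw [hwim, div_le_div_iff₀ (by positivity) (by positivity)]
    nlinarith [mul_le_mul hj2 hj2 hjp.le (by positivity)]
  have hwδ : w.im < δ := by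
    refine hw1.trans_lt ?_
    rw [div_le_iff₀ hδ] at hz2
    rw [div_lt_iff₀ hz0]
    linarith
  rw [← hgg' z hz0, ← hw, weightNorm]
  have h2 := rpow_le_rpow_add_rpow (by positivity) hw2 hw1 p
  calc ‖f w‖ * w.im ^ (r / 2) ≤ (|C| * w.im ^ (-K)) * w.im ^ (r / 2) := by
        gcongr
        exact (hC w hw0 hwδ).trans (by gcongr; exact le_abs_self C)
    _ = |C| * w.im ^ p := by
        rw [mul_assoc, ← Real.rpow_add hw0, hp]; congr 2; ring
    _ ≤ |C| * ((1 / (L ^ 2 * z.im)) ^ p + (1 / z.im) ^ p) := by gcongr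
    _ = _ := by
        rw [← div_div, Real.div_rpow (by positivity) hz0.le,
          Real.div_rpow zero_le_one hz0.le, Real.one_rpow, Real.rpow_neg hz0.le]
        field_simp

lemma det_realMat_mul_dilation (g : SpecialLinearGroup (Fin 2) ℤ) {m : ℝ} (hm : 0 < m) :
    (realMat g * dilation m).det = 1 := by
  rw [det_mul, det_realMat, det_dilation hm, one_mul]

lemma norm_slash_dilation {r : ℝ} (f : ℂ → ℂ) (g : SpecialLinearGroup (Fin 2) ℤ) {m : ℝ}
    (hm : 0 < m) {z : ℂ} (hz : z ∈ halfPlane) :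
    ‖slash r (realMat g * dilation m) f z‖ * z.im ^ (r / 2) =
      weightNorm r f (moebius (realMat g) (m * z)) := by
  rw [norm_slash_mul (det_realMat_mul_dilation g hm) f hz,
    moebius_mul _ (autFactor_ne_zero (det_dilation hm) hz), moebius_dilation hm.le]

lemma exists_slash_ne_zero {r : ℝ} {f : ℂ → ℂ} (hf0 : ∃ z : ℂ, 0 < z.im ∧ f z ≠ 0)
    {σ : Matrix (Fin 2) (Fin 2) ℝ} (hσ : σ.det = 1) : ∃ z ∈ halfPlane, slash r σ f z ≠ 0 := by
  obtain ⟨w, hw, hfw⟩ := hf0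
  have hσ' : σ⁻¹.det = 1 := by
    rw [det_nonsing_inv, hσ, Ring.inverse_one]
  have hz := moebius_mem_halfPlane hσ' hw
  refine ⟨moebius σ⁻¹ w, hz, ?_⟩
  rw [slash_of_det hσ, ← moebius_mul _ (autFactor_ne_zero hσ' hw),
    mul_nonsing_inv _ (by rw [hσ]; exact isUnit_one), moebius_one]
  exact div_ne_zero hfw (cpow_ne_zero_of_ne (autFactor_ne_zero hσ hz) _)

/-- Exponential convergence to the value at the cusp. -/
theorem exists_norm_slash_sub_le {r : ℝ} {Γ : Subgroup (SpecialLinearGroup (Fin 2) ℤ)} {μ : Γ → ℂ}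
    {f : ℂ → ℂ} (hf : IsModularForm r Γ μ f) (hΓ : Γ.FiniteIndex)
    (hf0 : ∃ z : ℂ, 0 < z.im ∧ f z ≠ 0) (g : SpecialLinearGroup (Fin 2) ℤ) {m : ℕ}
    (hm : m = cuspWidth Γ (SpecialLinearGroup.mapGL ℚ g • (OnePoint.infty : OnePoint ℚ)))
    {y₁ : ℝ} (hy₁ : 0 < y₁) :
    ∃ C c : ℝ, 0 < C ∧ 0 < c ∧ ∀ z : ℂ, y₁ ≤ z.im →
      ‖slash r (realMat g * dilation m) f z - valueAtInfty (slash r (realMat g * dilation m) f)‖ ≤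
        C * Real.exp (-c * z.im) := by
  have hm0 : (0 : ℝ) < m := by exact_mod_cast (exists_conj_T_pow_mem hΓ g hm).1
  have hσ := det_realMat_mul_dilation g hm0
  obtain ⟨u, hu, hper⟩ := exists_slash_add_one hf hΓ g hm
  refine exists_norm_sub_valueAtInfty_le (differentiableOn_slash hσ hf.analytic) hu hper
    (exists_slash_ne_zero hf0 hσ) ?_ hy₁
  obtain ⟨C, K, Y, hY, hC⟩ := exists_weightNorm_le hf hΓ g hm0.le
  refine ⟨C * (m : ℝ) ^ K, K - r / 2, Y / m, fun z hz h0 h1 => ?_⟩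
  have hz0 : 0 < z.im := lt_of_lt_of_le (by positivity) hz
  have hre : (((m : ℝ) : ℂ) * z).re = m * z.re := by simp
  have him : (((m : ℝ) : ℂ) * z).im = m * z.im := by simp
  have h2 := hC ((m : ℝ) * z) (by rw [him, mul_comm]; exact (div_le_iff₀ hm0).1 hz)
    (by rw [hre]; positivity) (by rw [hre]; nlinarith)
  rw [← norm_slash_dilation f g hm0 hz0, him, Real.mul_rpow hm0.le hz0.le] at h2
  have h3 : 0 < z.im ^ (r / 2) := Real.rpow_pos_of_pos hz0 _
  rw [Real.rpow_sub hz0, ← mul_div_assoc, le_div_iff₀ h3, mul_assoc]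
  exact h2

lemma weightNorm_neg (r : ℝ) (f : ℂ → ℂ) (g : SpecialLinearGroup (Fin 2) ℤ) (w : ℂ) :
    weightNorm r f (moebius (realMat (-g)) w) = weightNorm r f (moebius (realMat g) w) := by
  rw [realMat_neg, moebius_neg]

lemma half_le_alphaZero {r : ℝ} (hr : 0 < r) (Γ : Subgroup (SpecialLinearGroup (Fin 2) ℤ))
    (f : ℂ → ℂ) : r / 2 ≤ alphaZero r Γ f := by
  rw [alphaZero]
  split_ifs <;> linarith

/-- The exponent α₀ - r/2 covers both cases: it is 0 for cusp forms, where exponential decay absorbs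
y^{r/2}, and r/2 otherwise, where f at the cusp is merely bounded. -/
lemma exists_weightNorm_le_of_normalized {r : ℝ} (hr : 0 < r)
    {Γ : Subgroup (SpecialLinearGroup (Fin 2) ℤ)} {μ : Γ → ℂ}
    {f : ℂ → ℂ} (hf : IsModularForm r Γ μ f) (hΓ : Γ.FiniteIndex)
    (hf0 : ∃ z : ℂ, 0 < z.im ∧ f z ≠ 0) (g : SpecialLinearGroup (Fin 2) ℤ)
    (hg : g 1 0 < 0 ∨ (g 1 0 = 0 ∧ g 1 1 = 1)) :
    ∃ C : ℝ, ∀ w : ℂ, 1 / 2 ≤ w.im →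
      weightNorm r f (moebius (realMat g) w) ≤ C * w.im ^ (alphaZero r Γ f - r / 2) := by
  obtain ⟨m, hm⟩ : ∃ m, m =
      cuspWidth Γ (SpecialLinearGroup.mapGL ℚ g • (OnePoint.infty : OnePoint ℚ)) := ⟨_, rfl⟩
  have hm0 : (0 : ℝ) < m := by exact_mod_cast (exists_conj_T_pow_mem hΓ g hm).1
  have hmc : ((m : ℝ) : ℂ) ≠ 0 := by exact_mod_cast hm0.ne'
  obtain ⟨C, c, hC, hc, h⟩ := exists_norm_slash_sub_le hf hΓ hf0 g hm
    (y₁ := 1 / 2 / m) (by positivity)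
  set G := slash r (realMat g * dilation m) f with hG
  have key : ∀ w : ℂ, 1 / 2 ≤ w.im → ∃ z : ℂ, z.im = w.im / m ∧ 0 < z.im ∧
      weightNorm r f (moebius (realMat g) w) = ‖G z‖ * z.im ^ (r / 2) ∧
      ‖G z - valueAtInfty G‖ ≤ C * Real.exp (-c * z.im) := by
    intro w hw
    have him : (w / (m : ℝ)).im = w.im / m := by rw [Complex.div_ofReal_im]
    have hz : 0 < (w / (m : ℝ)).im := by rw [him]; exact div_pos (by linarith) hm0
    refine ⟨w / (m : ℝ), him, hz, ?_, h _ (by rw [him]; gcongr)⟩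
    rw [norm_slash_dilation f g hm0 hz, mul_div_cancel₀ _ hmc]
  by_cases hcusp : IsCuspForm r Γ f
  · have hv : valueAtInfty G = 0 := hcusp _ _ ⟨g, rfl, hg, by rw [← hm]; rfl⟩
    obtain ⟨D, hD, hDle⟩ := exists_rpow_mul_exp_le (by positivity : 0 ≤ r / 2) hc
    refine ⟨C * D, fun w hw => ?_⟩
    obtain ⟨z, -, hz0, hwn, hz⟩ := key w hw
    rw [hv, sub_zero] at hz
    rw [alphaZero, if_pos hcusp, sub_self, Real.rpow_zero, mul_one, hwn]
    calc ‖G z‖ * z.im ^ (r / 2) ≤ (C * Real.exp (-c * z.im)) * z.im ^ (r / 2) := by gcongr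
      _ = C * (z.im ^ (r / 2) * Real.exp (-c * z.im)) := by ring
      _ ≤ C * D := by gcongr; exact hDle _ hz0
  · refine ⟨(C + ‖valueAtInfty G‖) * (1 / m) ^ (r / 2), fun w hw => ?_⟩
    obtain ⟨z, hzw, hz0, hwn, hz⟩ := key w hw
    have hw0 : 0 < w.im := by linarith
    have e : alphaZero r Γ f - r / 2 = r / 2 := by rw [alphaZero, if_neg hcusp]; ring
    have h1 : ‖G z‖ ≤ C + ‖valueAtInfty G‖ := by
      have h2 := norm_sub_norm_le (G z) (valueAtInfty G)
      have h3 : Real.exp (-c * z.im) ≤ 1 := Real.exp_le_one_iff.2 (by nlinarith)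
      nlinarith
    rw [e, hwn, mul_assoc, ← Real.mul_rpow (by positivity) hw0.le, hzw, one_div_mul_eq_div]
    gcongr

/-- Either g or -g satisfies the sign normalization of a scaling matrix, and both act by the same
Möbius map. -/
lemma exists_weightNorm_le_of_half_le {r : ℝ} (hr : 0 < r)
    {Γ : Subgroup (SpecialLinearGroup (Fin 2) ℤ)} {μ : Γ → ℂ}
    {f : ℂ → ℂ} (hf : IsModularForm r Γ μ f) (hΓ : Γ.FiniteIndex)
    (hf0 : ∃ z : ℂ, 0 < z.im ∧ f z ≠ 0) (g : SpecialLinearGroup (Fin 2) ℤ) :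
    ∃ C : ℝ, ∀ w : ℂ, 1 / 2 ≤ w.im →
      weightNorm r f (moebius (realMat g) w) ≤ C * w.im ^ (alphaZero r Γ f - r / 2) := by
  have key := exists_weightNorm_le_of_normalized hr hf hΓ hf0
  have hneg : ((-g) 1 0 < 0 ∨ ((-g) 1 0 = 0 ∧ (-g) 1 1 = 1)) ∨
      (g 1 0 < 0 ∨ (g 1 0 = 0 ∧ g 1 1 = 1)) := by
    have h0 : (-g) 1 0 = -(g 1 0) := rfl
    have h1 : (-g) 1 1 = -(g 1 1) := rfl
    rw [h0, h1]
    rcases lt_trichotomy (g 1 0) 0 with h | h | h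
    · exact Or.inr (Or.inl h)
    · have hd := g.det_coe
      rw [det_fin_two, h, mul_zero, sub_zero] at hd
      rcases Int.mul_eq_one_iff_eq_one_or_neg_one.1 hd with h' | h'
      · exact Or.inr (Or.inr ⟨h, h'.2⟩)
      · exact Or.inl (Or.inr ⟨by omega, by omega⟩)
    · exact Or.inl (Or.inl (by omega))
  rcases hneg with h | h
  · simpa only [weightNorm_neg] using key (-g) h
  · exact key g h

lemma exists_weightNorm_le_uniform {r : ℝ} (hr : 0 < r)
    {Γ : Subgroup (SpecialLinearGroup (Fin 2) ℤ)} {μ : Γ → ℂ}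
    {f : ℂ → ℂ} (hf : IsModularForm r Γ μ f) (hΓ : Γ.FiniteIndex)
    (hf0 : ∃ z : ℂ, 0 < z.im ∧ f z ≠ 0) :
    ∃ C : ℝ, ∀ g : SpecialLinearGroup (Fin 2) ℤ, ∀ w : ℂ, 1 / 2 ≤ w.im →
      weightNorm r f (moebius (realMat g) w) ≤ C * w.im ^ (alphaZero r Γ f - r / 2) := by
  choose C hC using exists_weightNorm_le_of_half_le hr hf hΓ hf0
  have hfin : Finite (SpecialLinearGroup (Fin 2) ℤ ⧸ Γ) := Subgroup.finite_quotient_of_finiteIndex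
  obtain ⟨M, hM⟩ := (Set.finite_range
    fun q : SpecialLinearGroup (Fin 2) ℤ ⧸ Γ => C (q.out)⁻¹).bddAbove
  refine ⟨M, fun g w hw => ?_⟩
  have hw0 : 0 < w.im := by linarith
  -- The quotient consists of left cosets, while invariance is on the left of g; inverting the
  -- representative of g⁻¹ gives one of Γg.
  obtain ⟨h, hh⟩ := QuotientGroup.mk_out_eq_mul Γ g⁻¹
  have h1 := hC (((g⁻¹ : SpecialLinearGroup (Fin 2) ℤ) : SpecialLinearGroup (Fin 2) ℤ ⧸ Γ).out)⁻¹
    w hw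
  have h2 : C (((g⁻¹ : SpecialLinearGroup (Fin 2) ℤ) :
      SpecialLinearGroup (Fin 2) ℤ ⧸ Γ).out)⁻¹ ≤ M := hM ⟨_, rfl⟩
  have h3 := Real.rpow_nonneg hw0.le (alphaZero r Γ f - r / 2)
  have h4 : weightNorm r f (moebius (realMat g) w) =
      weightNorm r f (moebius (realMat (((g⁻¹ : SpecialLinearGroup (Fin 2) ℤ) :
        SpecialLinearGroup (Fin 2) ℤ ⧸ Γ).out)⁻¹) w) := by
    rw [hh, _root_.mul_inv_rev, inv_inv, realMat_mul,
      moebius_mul _ (autFactor_ne_zero (det_realMat g) hw0),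
      weightNorm_moebius_of_mem hf (inv_mem h.2) (moebius_mem_halfPlane (det_realMat g) hw0)]
  rw [h4]
  exact h1.trans (by gcongr)

lemma im_moebius_realMat_le (g : SpecialLinearGroup (Fin 2) ℤ) {z : ℂ} (hz : 0 < z.im) :
    (moebius (realMat g) z).im ≤ max z.im (1 / z.im) := by
  have hM := det_realMat g
  have hj : autFactor (realMat g) z = (g 1 0 : ℝ) * z + (g 1 1 : ℝ) := rfl
  rw [moebius_im hM]
  by_cases h : g 1 0 = 0
  · refine le_max_of_le_left ?_
    have hd := g.det_coe
    rw [det_fin_two, h, mul_zero, sub_zero] at hd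
    have h1 : ‖autFactor (realMat g) z‖ = 1 := by
      rw [hj, h]
      rcases Int.mul_eq_one_iff_eq_one_or_neg_one.1 hd with h' | h' <;> rw [h'.2] <;> simp
    rw [h1, one_pow, div_one]
  · refine le_max_of_le_right ?_
    have h1 : z.im ≤ ‖autFactor (realMat g) z‖ := by
      have h2 := Complex.abs_im_le_norm (autFactor (realMat g) z)
      rw [hj] at h2 ⊢
      simp only [Complex.add_im, Complex.mul_im, Complex.ofReal_re, Complex.ofReal_im, zero_mul,
        add_zero, abs_mul, abs_of_pos hz] at h2
      have h3 : (1 : ℝ) ≤ |(g 1 0 : ℝ)| := by exact_mod_cast Int.one_le_abs h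
      nlinarith
    have h4 : 0 < ‖autFactor (realMat g) z‖ := hz.trans_le h1
    rw [div_le_div_iff₀ (by positivity) hz]
    nlinarith

lemma exists_half_le_im_moebius {z : ℂ} (hz : 0 < z.im) :
    ∃ g : SpecialLinearGroup (Fin 2) ℤ, 1 / 2 ≤ (moebius (realMat g) z).im := by
  obtain ⟨g, hg⟩ := ModularGroup.exists_one_half_le_im_smul ⟨z, hz⟩
  refine ⟨g, ?_⟩
  have h : ((g • (⟨z, hz⟩ : UpperHalfPlane) : UpperHalfPlane) : ℂ) = moebius (realMat g) z := by
    rw [UpperHalfPlane.specialLinearGroup_apply]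
    simp [moebius, autFactor, realMat_apply]
  rw [← h]
  exact hg

/-- Choose h with hz of height at least 1/2 and write g = (g h⁻¹) h; the uniform bound applies at
hz, whose height is at most max(y, 1/y). -/
theorem exists_weightNorm_le_max {r : ℝ} (hr : 0 < r)
    {Γ : Subgroup (SpecialLinearGroup (Fin 2) ℤ)} {μ : Γ → ℂ}
    {f : ℂ → ℂ} (hf : IsModularForm r Γ μ f) (hΓ : Γ.FiniteIndex)
    (hf0 : ∃ z : ℂ, 0 < z.im ∧ f z ≠ 0) :
    ∃ C : ℝ, 0 ≤ C ∧ ∀ g : SpecialLinearGroup (Fin 2) ℤ, ∀ z : ℂ, 0 < z.im →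
      weightNorm r f (moebius (realMat g) z) ≤
        C * (max z.im (1 / z.im)) ^ (alphaZero r Γ f - r / 2) := by
  obtain ⟨C, hC⟩ := exists_weightNorm_le_uniform hr hf hΓ hf0
  refine ⟨|C|, abs_nonneg C, fun g z hz => ?_⟩
  obtain ⟨h, hh⟩ := exists_half_le_im_moebius hz
  have h1 := hC (g * h⁻¹) _ hh
  have h2 : moebius (realMat (g * h⁻¹)) (moebius (realMat h) z) = moebius (realMat g) z := by
    rw [realMat_mul, moebius_mul _ (autFactor_ne_zero (det_realMat _)
      (moebius_mem_halfPlane (det_realMat h) hz)), moebius_realMat_inv hz]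
  rw [h2] at h1
  have h3 : 0 < (moebius (realMat h) z).im := by linarith
  refine h1.trans ?_
  gcongr
  · exact le_abs_self C
  · have := half_le_alphaZero hr Γ f
    linarith
  · exact im_moebius_realMat_le h hz

/-! ### Expansions at the cusps and changes of variable -/

/-- The properties of the expansion at a cusp that enter the analysis. -/
structure CuspExpansion (s : ℝ) (G : ℂ → ℂ) : Prop where
  differentiableOn : DifferentiableOn ℂ G halfPlane
  nonneg : 0 ≤ cuspParameter G
  lt_one : cuspParameter G < 1
  map_add_one : ∀ z ∈ halfPlane,
    G (z + 1) = Complex.exp (2 * Real.pi * Complex.I * cuspParameter G) * G z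
  decay : DecayBound s (fun z => G z - valueAtInfty G)

/-- Above height 1 the exponential convergence absorbs y^s at the cost of half the rate. Below it, m
≥ 1 gives max(my, 1/(my)) ≤ m/y, so |G| y^{r/2} is O(y^{-(s-r/2)}) and G is O(y^{-s}). -/
theorem cuspExpansion_slash {r : ℝ} (hr : 0 < r)
    {Γ : Subgroup (SpecialLinearGroup (Fin 2) ℤ)} {μ : Γ → ℂ}
    {f : ℂ → ℂ} (hf : IsModularForm r Γ μ f) (hΓ : Γ.FiniteIndex)
    (hf0 : ∃ z : ℂ, 0 < z.im ∧ f z ≠ 0) (g : SpecialLinearGroup (Fin 2) ℤ) {m : ℕ}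
    (hm : m = cuspWidth Γ (SpecialLinearGroup.mapGL ℚ g • (OnePoint.infty : OnePoint ℚ))) :
    CuspExpansion (alphaZero r Γ f) (slash r (realMat g * dilation m) f) := by
  have hm1 := (exists_conj_T_pow_mem hΓ g hm).1
  have hm0 : (0 : ℝ) < m := by exact_mod_cast hm1
  have hm1 : (1 : ℝ) ≤ m := by exact_mod_cast hm1
  have hσ := det_realMat_mul_dilation g hm0
  obtain ⟨u, hu, hper⟩ := exists_slash_add_one hf hΓ g hm
  obtain ⟨h0, h1, h2⟩ := cuspParameter_spec hu hper (exists_slash_ne_zero hf0 hσ)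
  obtain ⟨C₁, c, hC₁, hc, hlarge⟩ := exists_norm_slash_sub_le hf hΓ hf0 g hm one_pos
  obtain ⟨C₂, hC₂, hsmall⟩ := exists_weightNorm_le_max hr hf hΓ hf0
  refine ⟨differentiableOn_slash hσ hf.analytic, h0, h1, by rwa [h2], ?_⟩
  set G := slash r (realMat g * dilation m) f with hG
  set s := alphaZero r Γ f with hs
  have hs0 : r / 2 ≤ s := half_le_alphaZero hr Γ f
  set p := s - r / 2 with hp
  have hp0 : 0 ≤ p := by linarith
  have hc2 : 0 < c / 2 := by positivity
  obtain ⟨D, hD, hDle⟩ := exists_rpow_mul_exp_le (by linarith : 0 ≤ s) hc2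
  set V := ‖valueAtInfty G‖ with hV
  refine ⟨C₁ * D + (C₂ * (m : ℝ) ^ p + V) * Real.exp (c / 2), c / 2, by positivity, hc2,
    fun z hz => ?_⟩
  have hzs : 0 < z.im ^ (-s) := Real.rpow_pos_of_pos hz _
  have he := Real.exp_pos (-(c / 2) * z.im)
  have hA : 0 ≤ C₁ * D := by positivity
  have hB : 0 ≤ (C₂ * (m : ℝ) ^ p + V) * Real.exp (c / 2) := by positivity
  rcases le_total 1 z.im with h | h
  · calc ‖G z - valueAtInfty G‖ ≤ C₁ * Real.exp (-c * z.im) := hlarge z h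
      _ = C₁ * (z.im ^ s * Real.exp (-(c / 2) * z.im)) *
          (z.im ^ (-s) * Real.exp (-(c / 2) * z.im)) := by
          have e1 : Real.exp (-c * z.im) =
              Real.exp (-(c / 2) * z.im) * Real.exp (-(c / 2) * z.im) := by
            rw [← Real.exp_add]; congr 1; ring
          have e2 : z.im ^ s * z.im ^ (-s) = 1 := by
            rw [← Real.rpow_add hz, add_neg_cancel, Real.rpow_zero]
          rw [e1]
          linear_combination (-C₁ * Real.exp (-(c / 2) * z.im) * Real.exp (-(c / 2) * z.im)) * e2
      _ ≤ (C₁ * D + (C₂ * (m : ℝ) ^ p + V) * Real.exp (c / 2)) *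
          (z.im ^ (-s) * Real.exp (-(c / 2) * z.im)) := by
          gcongr
          have := mul_le_mul_of_nonneg_left (hDle _ hz) hC₁.le
          linarith
  · have him : (((m : ℝ) : ℂ) * z).im = m * z.im := by simp
    have hmz : 0 < (m : ℝ) * z.im := by positivity
    have h3 := hsmall g ((m : ℝ) * z) (by rw [him]; exact hmz)
    rw [← norm_slash_dilation f g hm0 hz, him, ← hG] at h3
    have h4 : max ((m : ℝ) * z.im) (1 / (m * z.im)) ≤ m / z.im := by
      refine max_le ?_ ?_
      · rw [le_div_iff₀ hz]
        nlinarith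
      · rw [div_le_div_iff₀ hmz hz]
        nlinarith
    have h5 : ‖G z‖ * z.im ^ (r / 2) ≤ C₂ * ((m : ℝ) ^ p * z.im ^ (-p)) := by
      refine h3.trans ?_
      rw [Real.rpow_neg hz.le, ← div_eq_mul_inv, ← Real.div_rpow hm0.le hz.le]
      gcongr
    have h6 : ‖G z‖ ≤ C₂ * (m : ℝ) ^ p * z.im ^ (-s) := by
      have e1 : z.im ^ (-s) = z.im ^ (-p) / z.im ^ (r / 2) := by
        rw [← Real.rpow_sub hz]; congr 1; rw [hp]; ring
      rw [e1, ← mul_div_assoc, le_div_iff₀ (Real.rpow_pos_of_pos hz _), mul_assoc]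
      exact h5
    have h7 : 1 ≤ z.im ^ (-s) := Real.one_le_rpow_of_pos_of_le_one_of_nonpos hz h (by linarith)
    have h8 : 1 ≤ Real.exp (c / 2) * Real.exp (-(c / 2) * z.im) := by
      rw [← Real.exp_add]
      exact Real.one_le_exp (by nlinarith)
    have hCm : 0 ≤ C₂ * (m : ℝ) ^ p := by positivity
    have hV0 : 0 ≤ V := norm_nonneg _
    calc ‖G z - valueAtInfty G‖ ≤ ‖G z‖ + V := norm_sub_le _ _
      _ ≤ (C₂ * (m : ℝ) ^ p + V) * z.im ^ (-s) := by nlinarith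
      _ ≤ (C₂ * (m : ℝ) ^ p + V) * z.im ^ (-s) *
          (Real.exp (c / 2) * Real.exp (-(c / 2) * z.im)) :=
          le_mul_of_one_le_right (by positivity) h8
      _ = ((C₂ * (m : ℝ) ^ p + V) * Real.exp (c / 2)) *
          (z.im ^ (-s) * Real.exp (-(c / 2) * z.im)) := by ring
      _ ≤ _ := by
          gcongr
          linarith

lemma cuspParameter_const_mul {k : ℂ} (hk : k ≠ 0) (G : ℂ → ℂ) :
    cuspParameter (fun z => k * G z) = cuspParameter G := by
  unfold cuspParameter
  congr 1
  ext κ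
  refine and_congr_right fun _ => forall₂_congr fun z _ => ?_
  rw [mul_left_comm]
  exact mul_right_inj' hk

lemma valueAtInfty_const_mul {k : ℂ} (hk : k ≠ 0) (G : ℂ → ℂ) :
    valueAtInfty (fun z => k * G z) = k * valueAtInfty G := by
  rw [valueAtInfty, valueAtInfty, cuspParameter_const_mul hk]
  split_ifs with h
  · rw [fourierCoeff, fourierCoeff, ← intervalIntegral.integral_const_mul,
      cuspParameter_const_mul hk]
    simp only [mul_assoc]
  · rw [mul_zero]

/-- Affine changes of variable preserve the decay estimate. -/
lemma DecayBound.comp_affine {s : ℝ} {h : ℂ → ℂ} (hb : DecayBound s h) (k : ℂ) {l : ℝ}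
    (hl : 0 < l) (t : ℝ) : DecayBound s (fun z => k * h (l * z + t)) := by
  obtain ⟨C, c, hC, hc, hb⟩ := hb
  refine ⟨(‖k‖ + 1) * C * l ^ (-s), c * l, by positivity, by positivity, fun z hz => ?_⟩
  have him : ((l : ℂ) * z + t).im = l * z.im := by simp
  have h1 := hb (l * z + t) (by rw [him]; positivity)
  rw [him, Real.mul_rpow hl.le hz.le] at h1
  rw [norm_mul]
  calc ‖k‖ * ‖h (l * z + t)‖
      ≤ (‖k‖ + 1) * (C * (l ^ (-s) * z.im ^ (-s) * Real.exp (-c * (l * z.im)))) := by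
        gcongr
        linarith
    _ = _ := by
        have : -c * (l * z.im) = -(c * l) * z.im := by ring
        rw [this]; ring

lemma vertIntegral_comp_affine (α : ℝ) (h : ℂ → ℂ) (k : ℂ) {l : ℝ} (hl : 0 < l) (t x : ℝ) :
    vertIntegral α (fun z => k * h (l * z + t)) x =
      k * ((l ^ (-α) : ℝ) : ℂ) * vertIntegral α h (l * x + t) := by
  have h1 := integral_comp_mul_left_Ioi (fun y : ℝ => ((y ^ (α - 1) : ℝ) : ℂ) *
    h (((l * x + t : ℝ) : ℂ) + y * Complex.I)) 0 hl
  rw [mul_zero] at h1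
  have h2 : vertIntegral α h (l * x + t) = (l : ℂ) * ∫ y in Ioi (0 : ℝ),
      (((l * y) ^ (α - 1) : ℝ) : ℂ) *
        h (((l * x + t : ℝ) : ℂ) + ((l * y : ℝ) : ℂ) * Complex.I) := by
    rw [h1, Complex.real_smul, Complex.ofReal_inv, mul_inv_cancel_left₀ (by exact_mod_cast hl.ne')]
    rfl
  rw [h2, ← mul_assoc, ← integral_const_mul, vertIntegral]
  refine setIntegral_congr_fun measurableSet_Ioi fun y hy => ?_
  have hy0 : (0 : ℝ) < y := hy
  have e1 : l ^ (-α) * l * (l * y) ^ (α - 1) = y ^ (α - 1) := by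
    rw [Real.mul_rpow hl.le hy0.le, ← mul_assoc, ← Real.rpow_add_one hl.ne', ← Real.rpow_add hl]
    have : -α + 1 + (α - 1) = 0 := by ring
    rw [this, Real.rpow_zero, one_mul]
  have e2 : ((l * x + t : ℝ) : ℂ) + ((l * y : ℝ) : ℂ) * Complex.I =
      (l : ℂ) * (x + y * Complex.I) + t := by push_cast; ring
  rw [e2, ← e1]
  push_cast
  ring

lemma CuspExpansion.const_mul {s : ℝ} {G : ℂ → ℂ} (hG : CuspExpansion s G) {k : ℂ} (hk : k ≠ 0) :
    CuspExpansion s (fun z => k * G z) := by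
  refine ⟨hG.differentiableOn.const_mul k, ?_, ?_, fun z hz => ?_, ?_⟩
  · rw [cuspParameter_const_mul hk]; exact hG.nonneg
  · rw [cuspParameter_const_mul hk]; exact hG.lt_one
  · rw [cuspParameter_const_mul hk, hG.map_add_one z hz, mul_left_comm]
  · have h := hG.decay.comp_affine k one_pos 0
    simpa only [valueAtInfty_const_mul hk, mul_sub, Complex.ofReal_one, one_mul,
      Complex.ofReal_zero, add_zero] using h

/-- The constant relating the series and the integral. -/
noncomputable def gammaFactor (α : ℝ) : ℝ := (2 * Real.pi) ^ α / Real.Gamma α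

lemma CuspExpansion.tendsto {s α : ℝ} {G : ℂ → ℂ} (hG : CuspExpansion s G) (hs : 0 < s)
    (hα : s < α) (x : ℝ) : Tendsto (fracPartialSum G α x) atTop
      (𝓝 (gammaFactor α * vertIntegral α (fun z => G z - valueAtInfty G) x)) := by
  refine tendsto_fracPartialSum hG.differentiableOn hG.nonneg hG.lt_one hG.map_add_one hG.decay
    (fun h => ?_) hs hα x
  by_contra hne
  exact h (by rw [valueAtInfty, if_neg hne])

/-- At infinity f(mz) differs from the slashed form with γ = 1 only by the non-zero constant
(1/√m)^r. -/
lemma cuspExpansion_dilate {r : ℝ} (hr : 0 < r)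
    {Γ : Subgroup (SpecialLinearGroup (Fin 2) ℤ)} {μ : Γ → ℂ}
    {f : ℂ → ℂ} (hf : IsModularForm r Γ μ f) (hΓ : Γ.FiniteIndex)
    (hf0 : ∃ z : ℂ, 0 < z.im ∧ f z ≠ 0) :
    0 < cuspWidth Γ OnePoint.infty ∧ CuspExpansion (alphaZero r Γ f) (dilate Γ f) := by
  have h1 : cuspWidth Γ OnePoint.infty =
      cuspWidth Γ (SpecialLinearGroup.mapGL ℚ (1 : SpecialLinearGroup (Fin 2) ℤ) •
        (OnePoint.infty : OnePoint ℚ)) := by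
    rw [map_one, one_smul]
  have hm0 := (exists_conj_T_pow_mem hΓ 1 h1).1
  refine ⟨hm0, ?_⟩
  set m := cuspWidth Γ OnePoint.infty with hm
  have hm0' : (0 : ℝ) < m := by exact_mod_cast hm0
  have h2 := cuspExpansion_slash hr hf hΓ hf0 1 h1
  set k : ℂ := ((1 / √(m : ℝ) : ℝ) : ℂ) ^ (r : ℂ) with hk
  have hk0 : k ≠ 0 := by
    refine cpow_ne_zero_of_ne ?_ _
    have := Real.sqrt_pos.2 hm0'
    exact_mod_cast (by positivity : (1 / √(m : ℝ)) ≠ 0)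
  have h3 : dilate Γ f = fun z => k * slash r (realMat 1 * dilation m) f z := by
    ext z
    rw [realMat_one, one_mul, slash_of_det (det_dilation hm0'), moebius_dilation hm0'.le,
      autFactor_dilation, ← hk, mul_div_cancel₀ _ hk0, dilate, ← hm, Complex.ofReal_natCast]
  rw [h3]
  exact h2.const_mul hk0

/-! ### Scaling matrices at a finite cusp -/

/-- Geometry of a transformation with `σ ∞ = x₀`. -/
lemma realMoebius_inv_eq {σ : Matrix (Fin 2) (Fin 2) ℝ} (hσ : σ.det = 1) {x₀ x : ℝ}
    (h10 : σ 1 0 < 0) (h00 : σ 0 0 = σ 1 0 * x₀) (hx : x ≠ x₀) :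
    realMoebius σ⁻¹ x = 1 / (σ 1 0) ^ 2 * (-1 / (x - x₀)) - σ 1 1 / σ 1 0 := by
  have hy : x - x₀ ≠ 0 := sub_ne_zero.2 hx
  have hc := h10.ne
  have hinv : σ⁻¹ = !![σ 1 1, -σ 0 1; -σ 1 0, σ 0 0] := by
    rw [inv_def, hσ, Ring.inverse_one, one_smul, adjugate_fin_two]
  rw [det_fin_two, h00] at hσ
  rw [hinv, realMoebius, h00]
  simp only [of_apply, cons_val', cons_val_zero, cons_val_one, cons_val_fin_one]
  obtain ⟨y, rfl⟩ : ∃ y, x = y + x₀ := ⟨x - x₀, by ring⟩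
  rw [add_sub_cancel_right] at hy ⊢
  have hden : -σ 1 0 * (y + x₀) + σ 1 0 * x₀ = -(σ 1 0 * y) := by ring
  rw [hden]
  field_simp
  linear_combination -hσ

/-- The displayed argument w satisfies σw = x₀ + z and j_σ(w) = 1/(qz) with q = -c. The convention c
< 0 makes q positive, so qz stays in the upper half-plane and the powers split without a branch
factor. -/
lemma eq_cpow_mul_slash {r : ℝ} {f : ℂ → ℂ} {σ : Matrix (Fin 2) (Fin 2) ℝ} (hσ : σ.det = 1)
    {x₀ : ℝ} (h10 : σ 1 0 < 0) (h00 : σ 0 0 = σ 1 0 * x₀) {z : ℂ} (hz : z ∈ halfPlane) :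
    f (x₀ + z) = z ^ ((-r : ℝ) : ℂ) * ((((-σ 1 0) ^ (-r) : ℝ) : ℂ) *
      slash r σ f (((1 / (σ 1 0) ^ 2 : ℝ) : ℂ) * (-1 / z) + ((-(σ 1 1 / σ 1 0) : ℝ) : ℂ))) := by
  have hz0 := Complex.slitPlane_ne_zero (halfPlane_subset_slitPlane hz)
  have hc : (σ 1 0 : ℂ) ≠ 0 := by exact_mod_cast h10.ne
  set q : ℝ := -σ 1 0 with hq
  have hq0 : 0 < q := by rw [hq]; linarith
  set w : ℂ := ((1 / (σ 1 0) ^ 2 : ℝ) : ℂ) * (-1 / z) + ((-(σ 1 1 / σ 1 0) : ℝ) : ℂ) with hw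
  have hj : autFactor σ w = ((q : ℂ) * z)⁻¹ := by
    rw [autFactor, hw, hq]
    push_cast
    field_simp
    ring
  have hm : moebius σ w = x₀ + z := by
    rw [moebius, hj, div_inv_eq_mul, h00, hw, hq]
    rw [det_fin_two, h00] at hσ
    have hσ' : (σ 1 0 : ℂ) * x₀ * σ 1 1 - σ 0 1 * σ 1 0 = 1 := by exact_mod_cast hσ
    push_cast
    field_simp
    linear_combination z * hσ'
  have hqz : (q : ℂ) * z ∈ halfPlane := by
    have hz' : 0 < z.im := hz
    rw [mem_ofPred_eq]
    simp only [Complex.mul_im, Complex.ofReal_re, Complex.ofReal_im, zero_mul, add_zero]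
    positivity
  rw [slash_of_det hσ, hm, hj, Complex.inv_cpow _ _ (ne_of_lt ?_)]
  · have e : ((q : ℂ) * z) ^ ((-r : ℝ) : ℂ) * ((q : ℂ) * z) ^ (r : ℂ) = 1 := by
      rw [← Complex.cpow_add _ _ (Complex.slitPlane_ne_zero (halfPlane_subset_slitPlane hqz))]
      push_cast
      rw [neg_add_cancel, Complex.cpow_zero]
    rw [ofReal_mul_cpow hq0 hz0] at e
    rw [div_inv_eq_mul]
    linear_combination (-f (x₀ + z)) * e
  · exact lt_of_le_of_ne (Complex.arg_le_pi _)
      (Complex.mem_slitPlane_iff_arg.1 (halfPlane_subset_slitPlane hqz)).1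

lemma memPointwiseHolder_translate {s : ℝ} {E : ℝ → ℂ} (hE : MemPointwiseHolder s 0 E) (k : ℂ)
    (x₀ : ℝ) : MemPointwiseHolder s x₀ (fun x => k * E (x - x₀)) := by
  obtain ⟨hc, P, hP, hO⟩ := hE
  refine ⟨by fun_prop, Polynomial.C k * P, fun n hn => hP n ?_, ?_⟩
  · rw [Polynomial.mem_support_iff, Polynomial.coeff_C_mul] at hn
    exact Polynomial.mem_support_iff.2 (right_ne_zero_of_mul hn)
  · have ht : Tendsto (fun x : ℝ => x - x₀) (𝓝 x₀) (𝓝 0) := by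
      have : Tendsto (fun x : ℝ => x - x₀) (𝓝 x₀) (𝓝 (x₀ - x₀)) :=
        (continuous_id.sub continuous_const).tendsto x₀
      rwa [sub_self] at this
    refine ((hO.comp_tendsto ht).const_mul_left k).congr (fun x => ?_) (fun x => ?_)
    · simp only [Function.comp, sub_zero, Polynomial.eval_mul, Polynomial.eval_C]
      ring
    · simp only [Function.comp, sub_zero]

/-- A finite cusp rules out c = 0, leaving c < 0 in the normalization; the second relation expresses
σ∞ = x₀. -/
lemma scalingMatrix_entries {g : SpecialLinearGroup (Fin 2) ℤ} {m : ℕ} {x₀ : ℚ} (hm : 0 < m)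
    (hg : SpecialLinearGroup.mapGL ℚ g • (OnePoint.infty : OnePoint ℚ) = (x₀ : OnePoint ℚ))
    (hgn : g 1 0 < 0 ∨ (g 1 0 = 0 ∧ g 1 1 = 1)) :
    (realMat g * dilation m) 1 0 < 0 ∧
      (realMat g * dilation m) 0 0 = (realMat g * dilation m) 1 0 * (x₀ : ℝ) := by
  have hm0 := Real.sqrt_pos.2 (show (0 : ℝ) < m by exact_mod_cast hm)
  have e10 : (realMat g * dilation m) 1 0 = (g 1 0 : ℝ) * √m := by
    simp [dilation, mul_apply, Fin.sum_univ_two, realMat_apply]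
  have e00 : (realMat g * dilation m) 0 0 = (g 0 0 : ℝ) * √m := by
    simp [dilation, mul_apply, Fin.sum_univ_two, realMat_apply]
  have h10 : ((SpecialLinearGroup.mapGL ℚ g : GL (Fin 2) ℚ) 1 0) = (g 1 0 : ℚ) := by simp
  have h00 : ((SpecialLinearGroup.mapGL ℚ g : GL (Fin 2) ℚ) 0 0) = (g 0 0 : ℚ) := by simp
  rw [OnePoint.smul_infty_eq_ite, h10, h00] at hg
  split_ifs at hg with h
  · exact absurd hg.symm (OnePoint.coe_ne_infty x₀)
  · have hc : g 1 0 < 0 := by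
      rcases hgn with h' | h'
      · exact h'
      · exact absurd (by exact_mod_cast h'.1) h
    have hx : (g 0 0 : ℚ) / g 1 0 = x₀ := OnePoint.coe_injective hg
    have hx' : (g 0 0 : ℝ) = g 1 0 * (x₀ : ℝ) := by
      rw [div_eq_iff h] at hx
      have : ((g 0 0 : ℚ) : ℝ) = ((x₀ * g 1 0 : ℚ) : ℝ) := by exact_mod_cast hx
      push_cast at this
      rw [this, mul_comm]
    have hc' : (g 1 0 : ℝ) < 0 := by exact_mod_cast hc
    rw [e10, e00]
    refine ⟨mul_neg_of_neg_of_pos hc' hm0, ?_⟩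
    rw [hx']; ring

end FracModular

/-! ### Transport from the origin to the rational point -/

open FracModular in
theorem theorem2p4
    (r : ℝ) (hr : 0 < r)
    (Γ : Subgroup (Matrix.SpecialLinearGroup (Fin 2) ℤ)) (hΓ : Γ.FiniteIndex)
    (μ : Γ → ℂ) (f : ℂ → ℂ)
    (hf : FracModular.IsModularForm r Γ μ f)
    (hf0 : ∃ z : ℂ, 0 < z.im ∧ f z ≠ 0)
    (hκ : FracModular.HasRationalCuspParameters r Γ f)
    (α : ℝ) (hα : FracModular.alphaZero r Γ f < α)
    (x₀ : ℚ) (σ : Matrix (Fin 2) (Fin 2) ℝ)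
    (hσ : FracModular.IsScalingMatrix Γ (x₀ : OnePoint ℚ) σ) :
    -- the series defining `f_α` and `f_α^σ` converge everywhere
    (∀ x : ℝ, ∃ l : ℂ, Filter.Tendsto
      (FracModular.fracPartialSum (FracModular.dilate Γ f) α x) Filter.atTop (nhds l)) ∧
    (∀ x : ℝ, ∃ l : ℂ, Filter.Tendsto
      (FracModular.fracPartialSum (FracModular.slash r σ f) α x) Filter.atTop (nhds l)) ∧
    ∃ A B : ℝ, A ≠ 0 ∧ 0 < B ∧ ∃ E : ℝ → ℂ,
      (∀ x : ℝ, x ≠ (x₀ : ℝ) →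
        FracModular.fracIntegral Γ f α x =
          (A : ℂ) * Complex.I ^ ((-α : ℝ) : ℂ) *
              FracModular.valueAtInfty (FracModular.slash r σ f) *
              FracModular.psi α r (x - (x₀ : ℝ)) +
            (B : ℂ) * ((|x - (x₀ : ℝ)| ^ (2 * α) : ℝ) : ℂ) *
              ((x - (x₀ : ℝ) : ℝ) : ℂ) ^ ((-r : ℝ) : ℂ) *
              FracModular.fracSeries (FracModular.slash r σ f) α
                (FracModular.realMoebius σ⁻¹ x) +
            E x) ∧
      E (x₀ : ℝ) = FracModular.fracIntegral Γ f α (x₀ : ℝ) ∧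
      FracModular.MemCkHolder 1 0 {(x₀ : ℝ)}ᶜ E ∧
      FracModular.MemPointwiseHolder (2 * α - r + 1) (x₀ : ℝ) E := by
  have hσ' := hσ
  obtain ⟨g, hg, hgn, hσg⟩ := hσ'
  obtain ⟨m, hm⟩ : ∃ m, m = cuspWidth Γ (x₀ : OnePoint ℚ) := ⟨_, rfl⟩
  rw [← hm] at hσg
  have hm' : m = cuspWidth Γ (SpecialLinearGroup.mapGL ℚ g • (OnePoint.infty : OnePoint ℚ)) := by
    rw [hg, hm]
  have hm0 := (exists_conj_T_pow_mem hΓ g hm').1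
  have hσd : σ = realMat g * dilation m := hσg
  have hdet : σ.det = 1 := by
    rw [hσd]; exact det_realMat_mul_dilation g (by exact_mod_cast hm0)
  obtain ⟨h10, h00⟩ := scalingMatrix_entries hm0 hg hgn
  rw [← hσd] at h10 h00
  have hG := cuspExpansion_slash hr hf hΓ hf0 g hm'
  rw [← hσd] at hG
  obtain ⟨hM, hF⟩ := cuspExpansion_dilate hr hf hΓ hf0
  set s := alphaZero r Γ f with hs
  have hrs : r / 2 ≤ s := half_le_alphaZero hr Γ f
  have hs0 : 0 < s := by linarith
  set M := cuspWidth Γ OnePoint.infty with hMdef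
  have hM0 : (0 : ℝ) < M := by exact_mod_cast hM
  set G := slash r σ f with hGdef
  set D := dilate Γ f with hD
  -- In these terms σ⁻¹x = l·(-1/(x - x₀)) + t, and the slashed form is rescaled by k = q^{-r}.
  set q : ℝ := -σ 1 0 with hq
  have hq0 : 0 < q := by rw [hq]; linarith
  set l : ℝ := 1 / (σ 1 0) ^ 2 with hl
  have hl0 : 0 < l := by
    rw [hl]; have := h10.ne; positivity
  set t : ℝ := -(σ 1 1 / σ 1 0) with ht
  set k : ℂ := ((q ^ (-r) : ℝ) : ℂ) with hk
  have hk0 : k ≠ 0 := by rw [hk]; exact_mod_cast (Real.rpow_pos_of_pos hq0 _).ne'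
  refine ⟨fun x => ⟨_, hF.tendsto hs0 hα x⟩, fun x => ⟨_, hG.tendsto hs0 hα x⟩, ?_⟩
  -- the two functions interchanged by inversion
  set f₀ : ℂ → ℂ := fun z => D (((1 / M : ℝ) : ℂ) * z + ((x₀ / M : ℝ) : ℂ)) with hf₀
  set g₀ : ℂ → ℂ := fun z => k * G ((l : ℂ) * z + t) with hg₀
  have hf₀f : ∀ z, f₀ z = f (((x₀ : ℝ) : ℂ) + z) := by
    intro z
    simp only [hf₀, hD, dilate, ← hMdef]
    congr 1
    have : (M : ℂ) ≠ 0 := by exact_mod_cast hM.ne'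
    push_cast
    field_simp
    ring
  have hadd : ∀ {z : ℂ}, z ∈ halfPlane → ∀ {b : ℝ}, 0 < b → ∀ y : ℝ, (b : ℂ) * z + y ∈ halfPlane := by
    intro z hz b hb y
    have hz' : 0 < z.im := hz
    simp only [Set.mem_ofPred_eq, Complex.add_im, Complex.mul_im, Complex.ofReal_re,
      Complex.ofReal_im, zero_mul, add_zero]
    positivity
  have hfd : DifferentiableOn ℂ f₀ halfPlane := hF.differentiableOn.comp
    (f := fun z => ((1 / M : ℝ) : ℂ) * z + ((x₀ / M : ℝ) : ℂ)) (by fun_prop)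
    fun z hz => hadd hz (by positivity) _
  have hgd : DifferentiableOn ℂ g₀ halfPlane := (hG.differentiableOn.comp
    (f := fun z => (l : ℂ) * z + t) (by fun_prop) fun z hz => hadd hz hl0 _).const_mul k
  have hfb : DecayBound s (fun z => f₀ z - valueAtInfty D) := by
    have := hF.decay.comp_affine 1 (one_div_pos.2 hM0) (x₀ / M)
    simpa only [one_mul] using this
  have hgb : DecayBound s (fun z => g₀ z - k * valueAtInfty G) := by
    have := hG.decay.comp_affine k hl0 t
    simpa only [mul_sub] using this
  obtain ⟨A, hA, E, hE, hE0, hEd, hEp⟩ := approx_functional_equation_zero hr hfd hgd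
    (fun z hz => by rw [hf₀f]; exact eq_cpow_mul_slash hdet h10 h00 hz) hfb hgb hs0 hα
    (by linarith) (fun hb => by
      -- A non-zero value at this cusp excludes cusp forms, so α₀ = r and hence r < α.
      have hv : valueAtInfty G ≠ 0 := right_ne_zero_of_mul hb
      have hnc : ¬ IsCuspForm r Γ f := fun hc => hv (hc _ _ hσ)
      rwa [hs, alphaZero, if_neg hnc] at hα)
  have hα0 : 0 < α := hs0.trans hα
  set c := gammaFactor α with hc
  have hc0 : 0 < c := by
    rw [hc, gammaFactor]
    have := Real.Gamma_pos_of_pos hα0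
    have := Real.pi_pos
    positivity
  -- the series as integrals
  have hfrac : ∀ x : ℝ, fracIntegral Γ f α x =
      (c : ℂ) * (((1 / M : ℝ) ^ α : ℝ) : ℂ) *
        vertIntegral α (fun z => f₀ z - valueAtInfty D) (x - x₀) := by
    intro x
    have h1 := vertIntegral_comp_affine α (fun z => D z - valueAtInfty D) 1 (one_div_pos.2 hM0)
      (x₀ / M) (x - x₀)
    simp only [one_mul] at h1
    have h2 : 1 / (M : ℝ) * (x - x₀) + x₀ / M = x / M := by field_simp; ring
    rw [h2] at h1
    have h3 : (((1 / M : ℝ) ^ α : ℝ) : ℂ) * (((1 / M : ℝ) ^ (-α) : ℝ) : ℂ) = 1 := by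
      rw [← Complex.ofReal_mul, ← Real.rpow_add (one_div_pos.2 hM0), add_neg_cancel,
        Real.rpow_zero, Complex.ofReal_one]
    rw [fracIntegral, fracSeries, (hF.tendsto hs0 hα _).limUnder_eq, h1, ← hMdef, ← hc]
    linear_combination (-(c : ℂ) * vertIntegral α (fun z => D z - valueAtInfty D) (x / M)) * h3
  have hser : ∀ x : ℝ, x ≠ x₀ → vertIntegral α (fun z => g₀ z - k * valueAtInfty G)
      (-1 / (x - x₀)) * c = k * ((l ^ (-α) : ℝ) : ℂ) * fracSeries G α (realMoebius σ⁻¹ x) := by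
    intro x hx
    have h1 := vertIntegral_comp_affine α (fun z => G z - valueAtInfty G) k hl0 t (-1 / (x - x₀))
    simp only [mul_sub] at h1
    have h2 : l * (-1 / (x - x₀)) - σ 1 1 / σ 1 0 = l * (-1 / (x - x₀)) + t := by
      rw [ht, sub_eq_add_neg]
    rw [fracSeries, (hG.tendsto hs0 hα _).limUnder_eq, realMoebius_inv_eq hdet h10 h00 hx, ← hl,
      h2, ← hc]
    simp only [hg₀]
    rw [h1]
    ring
  set b : ℝ := (1 / M : ℝ) ^ α with hb
  have hb0 : 0 < b := by positivity
  -- The factor c converts integrals into series, b comes from the width at infinity, and q^{-r} and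
  -- l^{-α} come from rescaling the form at the cusp. In the second constant c cancels, as both
  -- sides there are series.
  refine ⟨c * b * A * q ^ (-r), b * (q ^ (-r) * l ^ (-α)), ?_, by positivity,
    fun x => ((c * b : ℝ) : ℂ) * E (x - x₀), fun x hx => ?_, ?_, ?_, ?_⟩
  · have := (Real.rpow_pos_of_pos hq0 (-r)).ne'
    have := hc0.ne'
    have := hb0.ne'
    positivity
  · have hx' : x - (x₀ : ℝ) ≠ 0 := sub_ne_zero.2 hx
    rw [hfrac, hE _ hx', inversionFactor]
    have h1 := hser x hx
    simp only [hk] at h1 ⊢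
    push_cast at h1 ⊢
    linear_combination ((b : ℂ) * ((|x - (x₀ : ℝ)| ^ (2 * α) : ℝ) : ℂ) *
      ((x : ℂ) - (x₀ : ℂ)) ^ (-r : ℂ)) * h1
  · beta_reduce
    rw [hfrac, sub_self, hE0]
    push_cast
    ring
  · refine memCkHolder_of_contDiffOn isOpen_compl_singleton ?_
    refine contDiffOn_const.mul (hEd.comp (f := fun x : ℝ => x - x₀) (by fun_prop) fun x hx => ?_)
    exact sub_ne_zero.2 hx
  · exact memPointwiseHolder_translate hEp _ _
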